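/- Let $\xi$ be an ordinal, let $1\le p,q\le\infty$ with $1<p$ and $\frac1p+\frac1q=1$, let $X$ be a (real or complex) Banach space with scalar field $\mathbb K$ and closed unit ball $B_X$, and let $K\subset X^*$ be weak$^*$-compact. Then (i) $\displaystyle \inf_{n\ge 1}\theta_{\xi,n}(K)=\limsup_{n\to\infty}\frac{\alpha_{\xi,p,n}(K)}{n^{1/q}}$; (ii) $Sz(K)\le\omega^{\xi+1}$ if and only if $\inf_{n\ge1}\theta_{\xi,n}(K)=0$, if and only if $\limsup_{n}\alpha_{\xi,p,n}(K)/n^{1/q}=0$. Here the notation is as follows. *Szlenk index.* For $\varepsilon>0$ and $L\subset X^*$, $s_\varepsilon(L)$ is the set of $x^*\in L$ such that $\operatorname{diam}(V\cap L)>\varepsilon$ for every weak$^*$-neighbourhood $V$ of $x^*$; $s^0_\varepsilon(K)=K$, $s^{\zeta+1}_\varepsilon(K)=s_\varepsilon(s^\zeta_\varepsilon(K))$, and $s^\zeta_\varepsilon(K)=\bigcap_{\eta<\zeta}s^\eta_\varepsilon(K)$ for limit $\zeta$. $Sz(K,\varepsilon)$ is the least $\zeta$ with $s^\zeta_\varepsilon(K)=\varnothing$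 ($\infty$ if there is none), and $Sz(K)=\sup_{\varepsilon>0}Sz(K,\varepsilon)$. *Trees and weights.* Finite sequences are ordered by the initial segment relation, $MAX(T)$ is the set of maximal members of $T$, and $\zeta+(\zeta_1,\dots,\zeta_k)=(\zeta+\zeta_1,\dots,\zeta+\zeta_k)$. Trees $\Gamma_{\xi,n}$ ($n\ge1$) of finite non-empty sequences of ordinals and functions $\mathbb P_{\xi,n}:\Gamma_{\xi,n}\to[0,1]$ are defined recursively: $\Gamma_{0,1}=\{(0)\}$ and $\mathbb P_{0,1}((0))=1$; $\Gamma_{\xi,n}=\bigcup_{i=1}^n\Lambda_{\xi,n,i}$, where $\Lambda_{\xi,n,i}$ is the set of all $(\omega^\xi(n-1)+t_1)^\frown\cdots^\frown(\omega^\xi(n-i)+t_i)$ with $t_1,\dots,t_i\in\Gamma_{\xi,1}$ and $t_1,\dots,t_{i-1}\in MAX(\Gamma_{\xi,1})$, and $\mathbb P_{\xi,n}$ has the value $\mathbb P_{\xi,1}(t_i)$ at this sequence; $\Gamma_{\xi+1,1}=\bigcup_{n\ge1}\Gamma_{\xi,n}$, with $\mathbb P_{\xi+1,1}=\frac1n\mathbb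 P_{\xi,n}$ on $\Gamma_{\xi,n}$; and for a limit $\xi$, $\Gamma_{\xi,1}=\bigcup_{\zeta<\xi}(\omega^\zeta+\Gamma_{\zeta+1,1})$, with $\mathbb P_{\xi,1}(\omega^\zeta+t)=\mathbb P_{\zeta+1,1}(t)$. For a (non-empty) directed set $D$ and a set $T$ of sequences, $T.D$ is the set of all $((\zeta_1,u_1),\dots,(\zeta_k,u_k))$ with $(\zeta_1,\dots,\zeta_k)\in T$ and $u_1,\dots,u_k\in D$; for $s\in \Gamma_{\xi,n}.D$, $\mathbb P_{\xi,n}(s)$ denotes the value of $\mathbb P_{\xi,n}$ at the underlying sequence of ordinals. A collection $(x_t)_{t\in\Gamma_{\xi,n}.D}\subset X$ is weakly null if, for every $t\in\{\varnothing\}\cup\Gamma_{\xi,n}.D$ and every ordinal $\zeta$ such that $t^\frown(\zeta,u)\in\Gamma_{\xi,n}.D$ for $u\in D$, the net $(x_{t^\frown(\zeta,u)})_{u\in D}$ is weakly null. For $t\in MAX(\Gamma_{\xi,n}.D)$ and $1\le i\le n$ put $z_i^t=\sum_{s\le t,\ s\in\Lambda_{\xi,n,i}.D}\mathbb P_{\xi,n}(s)\,x_s$.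 *The quantities.* Let $r_K(x)=\max_{x^*\in K}\operatorname{Re}x^*(x)$, and $r_K=0$ if $K=\varnothing$. Then $\alpha_{\xi,p,n}(K)$ is the infimum of all $\alpha>0$ such that $$\inf_{t\in MAX(\Gamma_{\xi,n}.D)} r_K\Bigl(\sum_{i=1}^n a_iz_i^t\Bigr)\le\alpha\,\|(a_i)_{i=1}^n\|_{\ell_p^n}$$ for every directed set $D$, all $(a_i)_{i=1}^n\in\mathbb K^n$ and every weakly null $(x_t)_{t\in\Gamma_{\xi,n}.D}\subset B_X$; and $\theta_{\xi,n}(K)$ is the infimum of all $\theta>0$ such that $\inf_{t\in MAX(\Gamma_{\xi,n}.D)} r_K\bigl(\sum_{i=1}^n\frac1n z_i^t\bigr)\le\theta$ for every directed set $D$ and every weakly null $(x_t)_{t\in\Gamma_{\xi,n}.D}\subset B_X$. -/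

import Mathlib

open scoped ENNReal Topology Ordinal

universe u v w

noncomputable section

namespace SzlenkSum

/-! ### Trees of finite sequences -/

/-- The maximal members of a set of finite sequences, ordered by the initial segment relation. -/
def maxNodes {β : Type*} (T : Set (List β)) : Set (List β) :=
  {t | t ∈ T ∧ ∀ s ∈ T, t <+: s → s = t}

/-- `ζ + (ζ₁, …, ζₖ) = (ζ + ζ₁, …, ζ + ζₖ)`. -/
def shift (ζ : Ordinal.{v}) (t : List Ordinal.{v}) : List Ordinal.{v} :=
  t.map fun η => ζ + η

/-- For `G = Γ_{ξ,1}`, the `i`-th level `Λ_{ξ,n,i}` (`1 ≤ i ≤ n`) of `Γ_{ξ,n}`: the sequences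
`(ω ^ ξ (n - 1) + t₁) ⌢ … ⌢ (ω ^ ξ (n - i) + tᵢ)` where `t₁, …, tᵢ ∈ G` and `t₁, …, tᵢ₋₁` are
maximal in `G`. It is empty for all other pairs `(n, i)`. -/
def stackLevel (G : Set (List Ordinal.{v})) (ξ : Ordinal.{v}) : ℕ → ℕ → Set (List Ordinal.{v})
  | n + 1, 1 => {r | ∃ t ∈ G, r = shift (ω ^ ξ * (n : Ordinal.{v})) t}
  | n + 1, i + 2 => {r | ∃ t ∈ maxNodes G, ∃ s ∈ stackLevel G ξ n (i + 1),
      r = shift (ω ^ ξ * (n : Ordinal.{v})) t ++ s}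
  | _, _ => ∅

/-- The union of the levels: `Γ_{ξ,n}` for `G = Γ_{ξ,1}`. -/
def stackTree (G : Set (List Ordinal.{v})) (ξ : Ordinal.{v}) (n : ℕ) : Set (List Ordinal.{v}) :=
  ⋃ i : ℕ, stackLevel G ξ n i

/-- The tree `Γ_{ξ,1}`. -/
def GammaOne (ξ : Ordinal.{v}) : Set (List Ordinal.{v}) :=
  Ordinal.limitRecOn (motive := fun _ => Set (List Ordinal.{v})) ξ
    {[0]}
    (fun η G => ⋃ n : ℕ, stackTree G η n)
    (fun _ hη ih => {r | ∃ ζ, ∃ h : ζ < _, ∃ t ∈ ih (ζ + 1) (hη.add_one_lt h),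
      r = shift (ω ^ ζ) t})

/-- The level `Λ_{ξ,n,i}`, for `1 ≤ i ≤ n`. -/
def Lam (ξ : Ordinal.{v}) (n i : ℕ) : Set (List Ordinal.{v}) :=
  stackLevel (GammaOne ξ) ξ n i

/-- The tree `Γ_{ξ,n}`, for `n ≥ 1`. -/
def Gam (ξ : Ordinal.{v}) (n : ℕ) : Set (List Ordinal.{v}) :=
  stackTree (GammaOne ξ) ξ n

/-- The graph of the weight functions: `HasWeight ξ n t c` means that `t ∈ Γ_{ξ,n}` and
`ℙ_{ξ,n}(t) = c`. -/
inductive HasWeight : Ordinal.{v} → ℕ → List Ordinal.{v} → ℝ → Prop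
  /-- `ℙ_{0,1}((0)) = 1`. -/
  | zero : HasWeight 0 1 [0] 1
  /-- `ℙ_{ξ,1}(ω ^ ζ + t) = ℙ_{ζ+1,1}(t)` for a limit `ξ`, `ζ < ξ` and `t ∈ Γ_{ζ+1,1}`. -/
  | limit {ξ ζ : Ordinal.{v}} {t : List Ordinal.{v}} {c : ℝ} :
      Order.IsSuccLimit ξ → ζ < ξ → HasWeight (ζ + 1) 1 t c → HasWeight ξ 1 (shift (ω ^ ζ) t) c
  /-- `ℙ_{ξ+1,1}(t) = ℙ_{ξ,n}(t) / n` for `t ∈ Γ_{ξ,n}`. -/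
  | succ {ξ : Ordinal.{v}} {n : ℕ} {t : List Ordinal.{v}} {c : ℝ} :
      HasWeight ξ n t c → HasWeight (ξ + 1) 1 t (c / n)
  /-- On its first level, `ℙ_{ξ,n+1}` is `ℙ_{ξ,1}`. -/
  | head {ξ : Ordinal.{v}} {n : ℕ} {t : List Ordinal.{v}} {c : ℝ} :
      1 ≤ n → HasWeight ξ 1 t c → HasWeight ξ (n + 1) (shift (ω ^ ξ * (n : Ordinal.{v})) t) c
  /-- Above a maximal member of the first level of `Γ_{ξ,n+1}`, the function `ℙ_{ξ,n+1}`
  is `ℙ_{ξ,n}`. -/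
  | tail {ξ : Ordinal.{v}} {n : ℕ} {t s : List Ordinal.{v}} {c : ℝ} :
      1 ≤ n → t ∈ maxNodes (GammaOne ξ) → HasWeight ξ n s c →
        HasWeight ξ (n + 1) (shift (ω ^ ξ * (n : Ordinal.{v})) t ++ s) c

/-! ### The weight functions are well defined on the trees -/

theorem shift_inj {ζ : Ordinal.{v}} {t s : List Ordinal.{v}} (h : shift ζ t = shift ζ s) :
    t = s := by
  refine List.map_injective_iff.2 ?_ h
  intro a b hab
  simpa using hab

theorem GammaOne_zero : GammaOne (0 : Ordinal.{v}) = {[0]} := by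
  simp [GammaOne]

theorem GammaOne_add_one (ξ : Ordinal.{v}) : GammaOne (ξ + 1) = ⋃ n : ℕ, Gam ξ n := by
  simp [GammaOne, Gam]

theorem GammaOne_limit {ξ : Ordinal.{v}} (hξ : Order.IsSuccLimit ξ) :
    GammaOne ξ = {r | ∃ ζ < ξ, ∃ t ∈ GammaOne (ζ + 1), r = shift (ω ^ ζ) t} := by
  rw [GammaOne, Ordinal.limitRecOn_limit _ _ _ _ hξ]
  simp [GammaOne]

theorem stackLevel_lt {G : Set (List Ordinal.{v})} {ξ : Ordinal.{v}}
    (hG : ∀ t ∈ G, ∀ η ∈ t, η < ω ^ ξ) (n i : ℕ) :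
    ∀ t ∈ stackLevel G ξ n i, ∀ η ∈ t, η < ω ^ ξ * (n : Ordinal.{v}) := by
  have key : ∀ (n : ℕ) (t : List Ordinal.{v}), t ∈ G →
      ∀ η ∈ shift (ω ^ ξ * (n : Ordinal.{v})) t, η < ω ^ ξ * ((n + 1 : ℕ) : Ordinal.{v}) := by
    intro n t ht η hη
    obtain ⟨η', h', rfl⟩ := List.mem_map.1 hη
    rw [Nat.cast_add, Nat.cast_one, mul_add, mul_one]
    exact (add_lt_add_iff_left _).2 (hG t ht η' h')
  fun_induction stackLevel G ξ n i with
  | case1 n =>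
    rintro r ⟨t, ht, rfl⟩
    exact key n t ht
  | case2 n i ih =>
    rintro r ⟨t, ht, s, hs, rfl⟩ η hη
    rcases List.mem_append.1 hη with h | h
    · exact key n t ht.1 η h
    · refine (ih s hs η h).trans_le (mul_le_mul_right ?_ _)
      exact_mod_cast Nat.le_succ n
  | case3 => simp

theorem GammaOne_lt (ξ : Ordinal.{v}) : ∀ t ∈ GammaOne ξ, ∀ η ∈ t, η < ω ^ ξ := by
  induction ξ using Ordinal.limitRecOn with
  | zero => simp [GammaOne_zero]
  | add_one ξ ih =>
    rw [GammaOne_add_one]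
    intro t ht η hη
    obtain ⟨n, hn⟩ := Set.mem_iUnion.1 ht
    obtain ⟨i, hi⟩ := Set.mem_iUnion.1 hn
    refine (stackLevel_lt ih n i t hi η hη).trans ?_
    rw [Ordinal.opow_add, Ordinal.opow_one]
    exact (mul_lt_mul_iff_right₀ (Ordinal.opow_pos _ Ordinal.omega0_pos)).2
      (Ordinal.natCast_lt_omega0 n)
  | limit ξ hξ ih =>
    rw [GammaOne_limit hξ]
    rintro r ⟨ζ, hζ, t, ht, rfl⟩ η hη
    obtain ⟨η', h', rfl⟩ := List.mem_map.1 hη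
    refine Ordinal.isPrincipal_add_omega0_opow ξ ?_ ?_
    · exact (Ordinal.opow_lt_opow_iff_right Ordinal.one_lt_omega0).2 hζ
    · refine (ih _ (hξ.add_one_lt hζ) t ht η' h').trans ?_
      exact (Ordinal.opow_lt_opow_iff_right Ordinal.one_lt_omega0).2 (hξ.add_one_lt hζ)

theorem HasWeight.one_le {ξ : Ordinal.{v}} {n : ℕ} {t : List Ordinal.{v}} {c : ℝ}
    (h : HasWeight ξ n t c) : 1 ≤ n := by
  cases h <;> omega

theorem HasWeight.mem {ξ : Ordinal.{v}} {n : ℕ} {t : List Ordinal.{v}} {c : ℝ}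
    (h : HasWeight ξ n t c) : t ∈ Gam ξ n := by
  have one : ∀ {ξ : Ordinal.{v}} {t : List Ordinal.{v}}, t ∈ Gam ξ 1 ↔ t ∈ GammaOne ξ := by
    intro ξ t
    constructor
    · intro h
      obtain ⟨i, hi⟩ := Set.mem_iUnion.1 h
      match i, hi with
      | 1, ⟨s, hs, e⟩ => simpa [shift, e] using hs
      | i + 2, ⟨s, _, r, hr, _⟩ => exact absurd hr (by simp [stackLevel])
    · intro h
      exact Set.mem_iUnion.2 ⟨1, t, h, by simp [shift]⟩
  induction h with
  | zero => exact one.2 (by simp [GammaOne_zero])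
  | limit hξ hζ _ ih => exact one.2 (GammaOne_limit hξ ▸ ⟨_, hζ, _, one.1 ih, rfl⟩)
  | @succ ξ n t c _ ih => exact one.2 (GammaOne_add_one ξ ▸ Set.mem_iUnion.2 ⟨n, ih⟩)
  | head _ _ ih => exact Set.mem_iUnion.2 ⟨1, _, one.1 ih, rfl⟩
  | tail _ ht _ ih =>
    obtain ⟨i, hi⟩ := Set.mem_iUnion.1 ih
    match i, hi with
    | 0, hi => simp [stackLevel] at hi
    | i + 1, hi => exact Set.mem_iUnion.2 ⟨i + 2, _, ht, _, hi, rfl⟩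

theorem HasWeight.lt {ξ : Ordinal.{v}} {n : ℕ} {t : List Ordinal.{v}} {c : ℝ}
    (h : HasWeight ξ n t c) : ∀ η ∈ t, η < ω ^ ξ * (n : Ordinal.{v}) := by
  obtain ⟨i, hi⟩ := Set.mem_iUnion.1 h.mem
  exact stackLevel_lt (GammaOne_lt ξ) n i t hi

theorem HasWeight.ne_nil {ξ : Ordinal.{v}} {n : ℕ} {t : List Ordinal.{v}} {c : ℝ}
    (h : HasWeight ξ n t c) : t ≠ [] := by
  induction h with
  | zero => simp
  | limit _ _ _ ih => simpa [shift] using ih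
  | succ _ ih => exact ih
  | head _ _ ih => simpa [shift] using ih
  | tail _ _ _ ih => simp [ih]

theorem exists_weight_of_stackLevel {ξ : Ordinal.{v}}
    (hG : ∀ t ∈ GammaOne ξ, ∃ c, HasWeight ξ 1 t c) (n i : ℕ) :
    ∀ t ∈ stackLevel (GammaOne ξ) ξ n i, ∃ c, HasWeight ξ n t c := by
  have zero : ∀ t : List Ordinal.{v}, shift (ω ^ ξ * ((0 : ℕ) : Ordinal.{v})) t = t := by
    simp [shift]
  generalize hG' : GammaOne ξ = G
  fun_induction stackLevel G ξ n i with
  | case1 n =>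
    subst hG'
    rintro r ⟨t, ht, rfl⟩
    obtain ⟨c, hc⟩ := hG t ht
    rcases Nat.eq_zero_or_pos n with rfl | hn
    · exact ⟨c, by rw [zero]; exact hc⟩
    · exact ⟨c, .head hn hc⟩
  | case2 n i ih =>
    subst hG'
    rintro r ⟨t, ht, s, hs, rfl⟩
    obtain ⟨c, hc⟩ := ih s hs
    exact ⟨c, .tail hc.one_le ht hc⟩
  | case3 => simp

theorem exists_weight_of_GammaOne (ξ : Ordinal.{v}) :
    ∀ t ∈ GammaOne ξ, ∃ c, HasWeight ξ 1 t c := by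
  induction ξ using Ordinal.limitRecOn with
  | zero =>
    rw [GammaOne_zero]
    rintro _ rfl
    exact ⟨1, .zero⟩
  | add_one ξ ih =>
    rw [GammaOne_add_one]
    intro t ht
    obtain ⟨n, hn⟩ := Set.mem_iUnion.1 ht
    obtain ⟨i, hi⟩ := Set.mem_iUnion.1 hn
    obtain ⟨c, hc⟩ := exists_weight_of_stackLevel ih n i t hi
    exact ⟨_, .succ hc⟩
  | limit ξ hξ ih =>
    rw [GammaOne_limit hξ]
    rintro r ⟨ζ, hζ, t, ht, rfl⟩
    obtain ⟨c, hc⟩ := ih _ (hξ.add_one_lt hζ) t ht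
    exact ⟨c, .limit hξ hζ hc⟩

/-- The domain of `ℙ_{ξ,n}` is `Γ_{ξ,n}`. -/
theorem exists_hasWeight_iff {ξ : Ordinal.{v}} {n : ℕ} {t : List Ordinal.{v}} :
    (∃ c, HasWeight ξ n t c) ↔ t ∈ Gam ξ n := by
  constructor
  · rintro ⟨c, hc⟩
    exact hc.mem
  · intro h
    obtain ⟨i, hi⟩ := Set.mem_iUnion.1 h
    exact exists_weight_of_stackLevel (exists_weight_of_GammaOne ξ) n i t hi

theorem HasWeight.le_head {ξ : Ordinal.{v}} {n : ℕ} {t : List Ordinal.{v}} {c : ℝ}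
    (h : HasWeight ξ n t c) : ∃ η ∈ t.head?, ∀ m : ℕ, m < n → ω ^ ξ * (m : Ordinal.{v}) ≤ η := by
  have aux : ∀ {ξ : Ordinal.{v}} {n : ℕ} {t : List Ordinal.{v}} (s : List Ordinal.{v}), t ≠ [] →
      ∃ η ∈ (shift (ω ^ ξ * (n : Ordinal.{v})) t ++ s).head?,
        ∀ m : ℕ, m < n + 1 → ω ^ ξ * (m : Ordinal.{v}) ≤ η := by
    intro ξ n t s ht
    obtain ⟨a, l, rfl⟩ := List.exists_cons_of_ne_nil ht
    refine ⟨_, by simp [shift]; rfl, fun m hm => le_trans (mul_le_mul_right ?_ _) le_self_add⟩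
    exact_mod_cast Nat.lt_succ_iff.1 hm
  have triv : ∀ {ξ : Ordinal.{v}} {t : List Ordinal.{v}}, t ≠ [] →
      ∃ η ∈ t.head?, ∀ m : ℕ, m < 1 → ω ^ ξ * (m : Ordinal.{v}) ≤ η := by
    intro ξ t ht
    obtain ⟨a, l, rfl⟩ := List.exists_cons_of_ne_nil ht
    refine ⟨a, rfl, fun m hm => ?_⟩
    obtain rfl : m = 0 := by omega
    simp
  cases h with
  | zero => exact triv (by simp)
  | limit h1 h2 h3 => exact triv (HasWeight.limit h1 h2 h3).ne_nil
  | succ h => exact triv h.ne_nil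
  | head _ h => simpa using aux [] h.ne_nil
  | @tail _ n t s _ hn ht h =>
    obtain ⟨c, hc⟩ := exists_weight_of_GammaOne _ t ht.1
    exact aux s hc.ne_nil

/-- `ℙ_{ξ,n}` is single-valued. -/
theorem HasWeight.unique {ξ : Ordinal.{v}} {n : ℕ} {t : List Ordinal.{v}} {c c' : ℝ}
    (h : HasWeight ξ n t c) (h' : HasWeight ξ n t c') : c = c' := by
  have filt : ∀ {β : Ordinal.{v}} {t s : List Ordinal.{v}}, (∀ η ∈ s, η < β) →
      (shift β t ++ s).filter (fun η => decide (β ≤ η)) = shift β t ∧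
      (shift β t ++ s).filter (fun η => decide (¬ β ≤ η)) = s := by
    intro β t s hs
    constructor
    · rw [List.filter_append, List.filter_eq_self.2, List.filter_eq_nil_iff.2, List.append_nil]
      · simpa using hs
      · simp [shift]
    · rw [List.filter_append, List.filter_eq_nil_iff.2, List.filter_eq_self.2, List.nil_append]
      · simpa using hs
      · simp [shift]
  induction h generalizing c' with
  | zero =>
    generalize hz : (0 : Ordinal.{v}) = z at h'
    generalize hl : [z] = l at h'
    generalize hk : (1 : ℕ) = k at h'
    cases h' with
    | zero => rfl
    | limit h1 h2 _ => subst hz; exact absurd h2 not_lt_zero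
    | succ _ => exact absurd hz.symm (add_pos_of_nonneg_of_pos zero_le one_pos).ne'
    | head h1 _ => omega
    | tail h1 _ _ => omega
  | @limit ξ ζ t c hξ hζ h ih =>
    generalize hl : shift (ω ^ ζ) t = l at h'
    generalize hk : (1 : ℕ) = k at h'
    cases h' with
    | zero => simp at hζ
    | @limit _ ζ' t' _ _ hζ' h2 =>
      have bd : ∀ {α β : Ordinal.{v}} {a b : List Ordinal.{v}} {x y : ℝ},
          HasWeight (α + 1) 1 a x → HasWeight (β + 1) 1 b y →
          shift (ω ^ α) a = shift (ω ^ β) b → α ≤ β := by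
        intro α β a b x y ha hb hab
        by_contra! hlt
        obtain ⟨η, l, rfl⟩ := List.exists_cons_of_ne_nil ha.ne_nil
        obtain ⟨η', l', rfl⟩ := List.exists_cons_of_ne_nil hb.ne_nil
        have e : ω ^ α + η = ω ^ β + η' := by
          have := congrArg List.head? hab
          simpa [shift] using this
        have h1 : η' < ω ^ (β + 1) := by simpa using hb.lt η' (by simp)
        have h2 : ω ^ β + η' < ω ^ (β + 1) := Ordinal.isPrincipal_add_omega0_opow _
          ((Ordinal.opow_lt_opow_iff_right Ordinal.one_lt_omega0).2 (by simp)) h1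
        have h3 : ω ^ (β + 1) ≤ ω ^ α :=
          Ordinal.opow_le_opow_right Ordinal.omega0_pos (Order.add_one_le_of_lt hlt)
        exact absurd (e ▸ h2) (not_lt.2 (h3.trans le_self_add))
      obtain rfl : ζ = ζ' := le_antisymm (bd h h2 hl) (bd h2 h hl.symm)
      obtain rfl := shift_inj hl
      exact ih h2
    | succ _ => exact absurd hξ (by simp)
    | head h1 _ => omega
    | tail h1 _ _ => omega
  | @succ ξ n t c h ih =>
    generalize hz : ξ + 1 = z at h'
    generalize hk : (1 : ℕ) = k at h'
    cases h' with
    | zero => simp at hz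
    | limit h1 _ _ => subst hz; exact absurd h1 (by simp)
    | @succ ξ' n' _ c' h2 =>
      obtain rfl : ξ = ξ' := by simpa using hz
      have bd : ∀ {a b : ℕ} {x y : ℝ}, HasWeight ξ a t x → HasWeight ξ b t y → a ≤ b := by
        intro a b x y ha hb
        by_contra! hlt
        obtain ⟨η, hη, hm⟩ := ha.le_head
        exact absurd (hb.lt η (List.mem_of_mem_head? hη)) (not_lt.2 (hm b hlt))
      obtain rfl : n = n' := le_antisymm (bd h h2) (bd h2 h)
      rw [ih h2]
    | head h1 _ => omega
    | tail h1 _ _ => omega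
  | @head ξ n t c hn h ih =>
    generalize hl : shift (ω ^ ξ * (n : Ordinal.{v})) t = l at h'
    generalize hk : n + 1 = k at h'
    cases h' with
    | zero => omega
    | limit _ _ _ => omega
    | succ _ => omega
    | @head _ n' t' _ _ h2 =>
      obtain rfl : n = n' := by omega
      obtain rfl := shift_inj hl
      exact ih h2
    | @tail _ n' t' s' _ _ ht h2 =>
      obtain rfl : n = n' := by omega
      have f1 := (filt (t := t) (s := []) (β := ω ^ ξ * (n : Ordinal.{v})) (by simp)).2
      have f2 := (filt (t := t') h2.lt).2
      rw [List.append_nil, hl, f2] at f1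
      exact absurd f1 h2.ne_nil
  | @tail ξ n t s c hn ht h ih =>
    generalize hl : shift (ω ^ ξ * (n : Ordinal.{v})) t ++ s = l at h'
    generalize hk : n + 1 = k at h'
    cases h' with
    | zero => omega
    | limit _ _ _ => omega
    | succ _ => omega
    | @head _ n' t' _ _ h2 =>
      obtain rfl : n = n' := by omega
      have f1 := (filt (t := t') (s := []) (β := ω ^ ξ * (n : Ordinal.{v})) (by simp)).2
      have f2 := (filt (t := t) h.lt).2
      rw [List.append_nil, ← hl, f2] at f1
      exact absurd f1 h.ne_nil
    | @tail _ n' t' s' _ _ _ h2 =>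
      obtain rfl : n = n' := by omega
      have f2 := (filt (t := t) h.lt).2
      rw [hl, (filt (t := t') h2.lt).2] at f2
      subst f2
      exact ih h2

open Classical in
/-- The weight `ℙ_{ξ,n}(t)` of `t ∈ Γ_{ξ,n}` (and `0` for all other `t`). -/
def weight (ξ : Ordinal.{v}) (n : ℕ) (t : List Ordinal.{v}) : ℝ :=
  if h : ∃ c, HasWeight ξ n t c then h.choose else 0

/-- For a tree `T` and a set `D`, the tree `T.D` of all sequences `((ζ₁, u₁), …, (ζₖ, uₖ))` with
`(ζ₁, …, ζₖ) ∈ T` and `u₁, …, uₖ ∈ D`. -/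
def prodTree (T : Set (List Ordinal.{v})) (D : Type u) : Set (List (Ordinal.{v} × D)) :=
  {t | t.map Prod.fst ∈ T}

/-! ### Weakly null collections, and the quantities `θ` and `α` -/

/-- A collection `(x_t)_{t ∈ T.D}` is weakly null if for every `t ∈ {∅} ∪ T.D` and every ordinal `ζ`
such that `t ⌢ (ζ, u) ∈ T.D` for (all) `u ∈ D`, the net `(x_{t ⌢ (ζ, u)})_{u ∈ D}` is weakly
null. -/
def IsWeaklyNull (𝕜 : Type w) [RCLike 𝕜] {X : Type u} [NormedAddCommGroup X] [NormedSpace 𝕜 X]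
    (T : Set (List Ordinal.{v})) {D : Type u} [Preorder D] (x : List (Ordinal.{v} × D) → X) :
    Prop :=
  ∀ (t : List (Ordinal.{v} × D)) (ζ : Ordinal.{v}), t.map Prod.fst ++ [ζ] ∈ T →
    ∀ f : StrongDual 𝕜 X, Filter.Tendsto (fun d : D => f (x (t ++ [(ζ, d)]))) Filter.atTop (𝓝 0)

open Classical in
/-- `z_i^t`, for `t ∈ MAX(Γ_{ξ,n}.D)` and `1 ≤ i ≤ n`: the sum of `ℙ_{ξ,n}(s) x_s` over all
`s ≤ t` in the level `Λ_{ξ,n,i}.D`. -/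
def blockSum (𝕜 : Type w) [RCLike 𝕜] {X : Type u} [NormedAddCommGroup X] [NormedSpace 𝕜 X]
    (ξ : Ordinal.{v}) (n : ℕ) {D : Type u} (x : List (Ordinal.{v} × D) → X)
    (t : List (Ordinal.{v} × D)) (i : ℕ) : X :=
  ∑ s ∈ t.inits.toFinset with s ∈ prodTree (Lam ξ n i) D,
    ((weight ξ n (s.map Prod.fst) : ℝ) : 𝕜) • x s

section

variable {𝕜 : Type w} [RCLike 𝕜] {X : Type u} [NormedAddCommGroup X] [NormedSpace 𝕜 X]

/-- `r_K(x) = max_{f ∈ K} Re f(x)`, and `r_K(x) = 0` if `K` is empty. -/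
def supportFun (K : Set (WeakDual 𝕜 X)) (x : X) : ℝ :=
  sSup ((fun f : WeakDual 𝕜 X => RCLike.re (f x)) '' K)

/-- `inf_{t ∈ MAX(Γ_{ξ,n}.D)} r_K(∑_{i=1}^n a_i z_i^t)`. -/
def treeInf (K : Set (WeakDual 𝕜 X)) (ξ : Ordinal.{v}) (n : ℕ) {D : Type u}
    (x : List (Ordinal.{v} × D) → X) (a : Fin n → 𝕜) : ℝ :=
  ⨅ t : maxNodes (prodTree (Gam ξ n) D),
    supportFun K (∑ i : Fin n, a i • blockSum 𝕜 ξ n x t.1 (i + 1))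

/-- `α_{ξ,p,n}(K)`, for `n ≥ 1`. -/
def alpha (ξ : Ordinal.{v}) (p : ℝ≥0∞) (n : ℕ) (K : Set (WeakDual 𝕜 X)) : ℝ :=
  sInf {α : ℝ | 0 < α ∧
    ∀ (D : Type u) [Preorder D] [IsDirectedOrder D] [Nonempty D] (a : Fin n → 𝕜)
      (x : List (Ordinal.{v} × D) → X),
      (∀ t ∈ prodTree (Gam ξ n) D, ‖x t‖ ≤ 1) → IsWeaklyNull 𝕜 (Gam ξ n) x →
        treeInf K ξ n x a ≤ α * ‖(WithLp.toLp p a : PiLp p fun _ : Fin n => 𝕜)‖}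

/-- `θ_{ξ,n}(K)`, for `n ≥ 1`. -/
def theta (ξ : Ordinal.{v}) (n : ℕ) (K : Set (WeakDual 𝕜 X)) : ℝ :=
  sInf {θ : ℝ | 0 < θ ∧
    ∀ (D : Type u) [Preorder D] [IsDirectedOrder D] [Nonempty D]
      (x : List (Ordinal.{v} × D) → X),
      (∀ t ∈ prodTree (Gam ξ n) D, ‖x t‖ ≤ 1) → IsWeaklyNull 𝕜 (Gam ξ n) x →
        treeInf K ξ n x (fun _ => (1 / n : 𝕜)) ≤ θ}

/-! ### The Szlenk index -/

/-- `s_ε(K)`: the set of those `f ∈ K` such that `diam (V ∩ K) > ε` (in the norm of the dual)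
for every weak* neighbourhood `V` of `f`. -/
def szDeriv (ε : ℝ) (K : Set (WeakDual 𝕜 X)) : Set (WeakDual 𝕜 X) :=
  {f | f ∈ K ∧ ∀ V ∈ 𝓝 f,
    ENNReal.ofReal ε < Metric.ediam (WeakDual.toStrongDual '' (V ∩ K) : Set (StrongDual 𝕜 X))}

/-- The transfinite derivations `s_ε^ξ(K)`. -/
def szDerivIter (ε : ℝ) (K : Set (WeakDual 𝕜 X)) (ξ : Ordinal.{v}) : Set (WeakDual 𝕜 X) :=
  Ordinal.limitRecOn (motive := fun _ => Set (WeakDual 𝕜 X)) ξ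
    K
    (fun _ L => szDeriv ε L)
    (fun η _ ih => ⋂ (ζ : Ordinal.{v}) (h : ζ < η), ih ζ h)

open Classical in
/-- `Sz(K, ε)`: the least `ξ` such that `s_ε^ξ(K) = ∅`, and `∞` if there is no such ordinal. -/
def szEps (K : Set (WeakDual 𝕜 X)) (ε : ℝ) : WithTop Ordinal.{v} :=
  if ∃ ξ : Ordinal.{v}, szDerivIter ε K ξ = ∅ then
    ((sInf {ξ : Ordinal.{v} | szDerivIter ε K ξ = ∅} : Ordinal.{v}) : WithTop Ordinal.{v})
  else ⊤

/-- The Szlenk index `Sz(K) = sup_{ε > 0} Sz(K, ε)`. -/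
def Sz (K : Set (WeakDual 𝕜 X)) : WithTop Ordinal.{v} :=
  ⨆ (ε : ℝ) (_ : 0 < ε), szEps K ε

end

end SzlenkSum

end

noncomputable section

namespace SzlenkSum

/-! ### Averaging operators on Lipschitz functions -/

section Operators

variable {X : Type u}

/-! The infima over branches are values of games, and these values are computed by nonlinear
averaging operators on Lipschitz functions on `X`. One move of length `a` sends `g` to the upper
limit of `g (x + a y)` as `y` tends weakly to `0` in the unit ball (`baseOp`). The recursion for the
trees becomes a recursion for `op`: at a successor the operator is the infum over `n` of `n`
successive moves of length `a / n`, and at a limit it is an infimum over earlier successors. By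
`upperAt` and `lowerAt`, the largest infimum that a weakly null collection in the ball can force is
exactly the operator value at `0`. In particular `θ_{ξ,n}(K)` is the value of `n` moves of length `1
/ n` applied to the support function of `K`.

All these operators share the axioms `StepOp`. The decisive one is subadditivity: a move `b` after a
move `a` is worth at most one move `a + b`. With the Lipschitz dependence on the length, it lets
many short moves be grouped into `m` equal ones, with an error of order `m` times the longest short
move (`StepOp.opL_group`).

For (i), constant coefficients give `θ_n ≤ α_n / n^{1/q}`. Conversely, coefficients of `ℓ_p` norm
`N` are moves of length at most `N` with total length at most `n^{1/q} N`. Grouping them into `m`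
equal moves gives `α_n ≤ n^{1/q} θ_m + 2 R m`. Since `p > 1`, `n^{1/q}` tends to infinity, so the
quotients converge to the infimum of the `θ_m`.

For (ii), a functional in the derivation of order `ω^ξ` makes a move of length `a` gain at least `a
ε / 4` (`le_op_supportFun`), so a non-empty derivation of order `ω^(ξ+1)` keeps every `θ_n` above `ε
/ 4`. Conversely, a move of length `b` either gains at most `b ε` or gains at most `b R` and passes
to the derivation of order `ω^ξ` (`domStep_op`). If the derivation of order `ω^ξ n` is empty, fewer
than `n` of `N` moves are of the second kind, whence `θ_N ≤ ε + n R / N`. -/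

/-- The composition of the operators `S a`, for `a` in a list. -/
def opL (S : ℝ → (X → ℝ) → X → ℝ) (l : List ℝ) (g : X → ℝ) : X → ℝ :=
  l.foldr S g

theorem opL_cons (S : ℝ → (X → ℝ) → X → ℝ) (a : ℝ) (l : List ℝ) (g : X → ℝ) :
    opL S (a :: l) g = S a (opL S l g) := rfl

theorem opL_append (S : ℝ → (X → ℝ) → X → ℝ) (l l' : List ℝ) (g : X → ℝ) :
    opL S (l ++ l') g = opL S l (opL S l' g) := by
  simp [opL]

variable [NormedAddCommGroup X]

/-- The one-sided form of the Lipschitz condition. -/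
def IsLip (R : ℝ) (g : X → ℝ) : Prop :=
  ∀ x y, g x ≤ g y + R * ‖x - y‖

/-- The properties shared by the operators that give the values of the games on the trees. -/
structure StepOp (R : ℝ) (S : ℝ → (X → ℝ) → X → ℝ) : Prop where
  lip : ∀ {a : ℝ} {g : X → ℝ}, 0 ≤ a → IsLip R g → IsLip R (S a g)
  mono : ∀ {a : ℝ} {g h : X → ℝ}, 0 ≤ a → IsLip R g → IsLip R h → (∀ x, g x ≤ h x) →
    ∀ x, S a g x ≤ S a h x
  le : ∀ {a : ℝ} {g : X → ℝ}, 0 ≤ a → IsLip R g → ∀ x, g x ≤ S a g x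
  const : ∀ {a : ℝ} {g : X → ℝ}, 0 ≤ a → IsLip R g → ∀ c x, S a (fun y => g y + c) x ≤ S a g x + c
  step : ∀ {a b : ℝ} {g : X → ℝ}, 0 ≤ a → 0 ≤ b → IsLip R g → ∀ x,
    S a g x ≤ S b g x + R * |a - b|
  sub : ∀ {a b : ℝ} {g : X → ℝ}, 0 ≤ a → 0 ≤ b → IsLip R g → ∀ x,
    S a (S b g) x ≤ S (a + b) g x

theorem IsLip.add_const {R : ℝ} {g : X → ℝ} (hg : IsLip R g) (c : ℝ) :
    IsLip R (fun x => g x + c) := by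
  intro x y
  linarith [hg x y]

theorem le_of_forall_nat_le_add_div {a b c : ℝ} (h : ∀ n : ℕ, a ≤ b + c / ((n : ℝ) + 1)) :
    a ≤ b := by
  have h1 : Filter.Tendsto (fun n : ℕ => b + c * (1 / ((n : ℝ) + 1))) Filter.atTop
      (𝓝 (b + c * 0)) :=
    (tendsto_one_div_add_atTop_nhds_zero_nat.const_mul c).const_add b
  simpa using ge_of_tendsto' h1 fun n => by simpa [div_eq_mul_inv] using h n

namespace StepOp

variable {R : ℝ} {S : ℝ → (X → ℝ) → X → ℝ}

theorem mono_add (hS : StepOp R S) {a : ℝ} {g h : X → ℝ} (ha : 0 ≤ a) (hg : IsLip R g)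
    (hh : IsLip R h) {c : ℝ} (H : ∀ x, g x ≤ h x + c) (x : X) : S a g x ≤ S a h x + c :=
  (hS.mono ha hg (hh.add_const c) H x).trans (hS.const ha hh c x)

theorem opL_lip (hS : StepOp R S) {l : List ℝ} (hl : ∀ a ∈ l, 0 ≤ a) {g : X → ℝ}
    (hg : IsLip R g) : IsLip R (opL S l g) := by
  induction l with
  | nil => exact hg
  | cons a l ih =>
    exact hS.lip (hl a (by simp)) (ih fun b hb => hl b (by simp [hb]))

theorem opL_mono_add (hS : StepOp R S) {l : List ℝ} (hl : ∀ a ∈ l, 0 ≤ a) {g h : X → ℝ}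
    (hg : IsLip R g) (hh : IsLip R h) {c : ℝ} (H : ∀ x, g x ≤ h x + c) (x : X) :
    opL S l g x ≤ opL S l h x + c := by
  induction l generalizing x with
  | nil => exact H x
  | cons a l ih =>
    have hl' : ∀ b ∈ l, 0 ≤ b := fun b hb => hl b (by simp [hb])
    exact hS.mono_add (hl a (by simp)) (hS.opL_lip hl' hg) (hS.opL_lip hl' hh)
      (fun x => ih hl' x) x

theorem opL_mono (hS : StepOp R S) {l : List ℝ} (hl : ∀ a ∈ l, 0 ≤ a) {g h : X → ℝ}
    (hg : IsLip R g) (hh : IsLip R h) (H : ∀ x, g x ≤ h x) (x : X) :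
    opL S l g x ≤ opL S l h x := by
  simpa using hS.opL_mono_add hl hg hh (c := 0) (by simpa using H) x

theorem le_opL (hS : StepOp R S) {l : List ℝ} (hl : ∀ a ∈ l, 0 ≤ a) {g : X → ℝ}
    (hg : IsLip R g) (x : X) : g x ≤ opL S l g x := by
  induction l generalizing x with
  | nil => exact le_rfl
  | cons a l ih =>
    have hl' : ∀ b ∈ l, 0 ≤ b := fun b hb => hl b (by simp [hb])
    exact (ih hl' x).trans (hS.le (hl a (by simp)) (hS.opL_lip hl' hg) x)

theorem opL_replicate_step (hS : StepOp R S) (n : ℕ) {a b : ℝ} (ha : 0 ≤ a) (hb : 0 ≤ b)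
    {g : X → ℝ} (hg : IsLip R g) (x : X) :
    opL S (List.replicate n a) g x ≤ opL S (List.replicate n b) g x + n * (R * |a - b|) := by
  induction n generalizing x with
  | zero => simp [opL]
  | succ n ih =>
    have h1 : ∀ {c : ℝ}, 0 ≤ c → ∀ d ∈ List.replicate n c, 0 ≤ d := by
      intro c hc d hd
      rw [List.eq_of_mem_replicate hd]; exact hc
    have h2 := hS.mono_add ha (hS.opL_lip (h1 ha) hg) (hS.opL_lip (h1 hb) hg) ih x
    have h3 := hS.step ha hb (hS.opL_lip (h1 hb) hg) x
    simp only [List.replicate_succ, opL_cons]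
    push_cast
    linarith

theorem opL_le_sum (hS : StepOp R S) {l : List ℝ} (hl : ∀ a ∈ l, 0 ≤ a) {g : X → ℝ}
    (hg : IsLip R g) (x : X) : opL S l g x ≤ S l.sum g x := by
  induction l generalizing x with
  | nil => exact hS.le le_rfl hg x
  | cons a l ih =>
    have hl' : ∀ b ∈ l, 0 ≤ b := fun b hb => hl b (by simp [hb])
    have ha := hl a (by simp)
    have hs := List.sum_nonneg hl'
    rw [opL_cons, List.sum_cons]
    exact (hS.mono ha (hS.opL_lip hl' hg) (hS.lip hs hg) (fun x => ih hl' x) x).trans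
      (hS.sub ha hs hg x)

end StepOp

theorem exists_prefix_sum {η : ℝ} (hη : 0 ≤ η) {l : List ℝ} (hl : ∀ a ∈ l, a ≤ η) {b : ℝ}
    (hb : 0 ≤ b) (hbl : b ≤ l.sum) :
    ∃ l₁ l₂, l = l₁ ++ l₂ ∧ l₁.sum ≤ b ∧ b ≤ l₁.sum + η := by
  induction l generalizing b with
  | nil => exact ⟨[], [], rfl, by simpa using hb, by simp at hbl; simp; linarith⟩
  | cons a l ih =>
    rw [List.sum_cons] at hbl
    rcases le_or_gt a b with h | h
    · obtain ⟨l₁, l₂, h1, h2, h3⟩ := ih (fun c hc => hl c (by simp [hc])) (sub_nonneg.2 h)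
        (by linarith)
      refine ⟨a :: l₁, l₂, by simp [h1], ?_, ?_⟩ <;> rw [List.sum_cons] <;> linarith
    · refine ⟨[], a :: l, rfl, by simpa using hb, ?_⟩
      have := hl a (by simp)
      simp only [List.sum_nil]
      linarith

/-- Grouping successive steps into longer ones with prescribed lengths. -/
theorem StepOp.opL_group {R : ℝ} (hR : 0 ≤ R) {S : ℝ → (X → ℝ) → X → ℝ} (hS : StepOp R S) {η : ℝ}
    (hη : 0 ≤ η) {g : X → ℝ} (hg : IsLip R g) (bs : List ℝ) :
    ∀ (b : ℝ) (l : List ℝ), (∀ a ∈ l, 0 ≤ a ∧ a ≤ η) → (∀ a ∈ b :: bs, 0 ≤ a) →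
      l.sum = (b :: bs).sum → ∀ x,
      opL S l g x ≤ opL S (b :: bs) g x + 2 * R * η * bs.length := by
  induction bs with
  | nil =>
    intro b l hl hb hs x
    have := hS.opL_le_sum (fun a ha => (hl a ha).1) hg x
    rw [hs] at this
    simpa [opL] using this
  | cons b' bs ih =>
    intro b l hl hb hs x
    have hb0 : 0 ≤ b := hb b (by simp)
    have hb'0 : 0 ≤ b' := hb b' (by simp)
    have hbs0 : ∀ a ∈ bs, 0 ≤ a := fun a ha => hb a (by simp [ha])
    have hbs1 : 0 ≤ bs.sum := List.sum_nonneg hbs0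
    simp only [List.sum_cons] at hs
    -- The prefix `l₁` falls short of `b` by at most `η`. The deficit is added to the next target,
    -- which keeps the totals equal for the induction.
    obtain ⟨l₁, l₂, rfl, h2, h3⟩ := exists_prefix_sum hη (fun a ha => (hl a ha).2) hb0
      (by linarith)
    have hl₁ : ∀ a ∈ l₁, 0 ≤ a := fun a ha => (hl a (by simp [ha])).1
    have hl₂ : ∀ a ∈ l₂, 0 ≤ a := fun a ha => (hl a (by simp [ha])).1
    have hσ : 0 ≤ l₁.sum := List.sum_nonneg hl₁
    have hc : 0 ≤ b' + (b - l₁.sum) := by linarith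
    rw [List.sum_append] at hs
    have hcs : ∀ a ∈ (b' + (b - l₁.sum)) :: bs, 0 ≤ a := by
      intro a ha
      rcases List.mem_cons.1 ha with rfl | ha
      exacts [hc, hbs0 a ha]
    have key := ih (b' + (b - l₁.sum)) l₂ (fun a ha => hl a (by simp [ha])) hcs (by
      rw [List.sum_cons]; linarith)
    have hh : IsLip R (opL S bs g) := hS.opL_lip hbs0 hg
    -- Each boundary between groups costs `R η` twice: once to remove the deficit from `b'`, once to
    -- lengthen `l₁.sum` to `b`.
    have e1 : ∀ y, opL S l₂ g y ≤ S b' (opL S bs g) y + (R * η + 2 * R * η * bs.length) := by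
      intro y
      have := hS.step hc hb'0 hh y
      have h4 : R * |b' + (b - l₁.sum) - b'| ≤ R * η := by
        refine mul_le_mul_of_nonneg_left ?_ hR
        rw [abs_of_nonneg (by linarith)]
        linarith
      have h5 := key y
      rw [opL_cons] at h5
      linarith
    have e2 := hS.mono_add hσ (hS.opL_lip hl₂ hg) (hS.lip hb'0 hh) e1 x
    have e3 := hS.step hσ hb0 (hS.lip hb'0 hh) x
    have e4 : R * |l₁.sum - b| ≤ R * η := by
      refine mul_le_mul_of_nonneg_left ?_ hR
      rw [abs_of_nonpos (by linarith)]
      linarith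
    have e5 := hS.opL_le_sum hl₁ (hS.opL_lip hl₂ hg) x
    rw [opL_append, opL_cons, opL_cons, List.length_cons]
    push_cast
    linarith

theorem StepOp.opL_le_replicate {R : ℝ} (hR : 0 ≤ R) {S : ℝ → (X → ℝ) → X → ℝ} (hS : StepOp R S)
    {η : ℝ} (hη : 0 ≤ η) {g : X → ℝ} (hg : IsLip R g) {l : List ℝ} (hl : ∀ a ∈ l, 0 ≤ a ∧ a ≤ η)
    (n : ℕ) (x : X) :
    opL S l g x ≤ opL S (List.replicate (n + 1) (l.sum / (n + 1))) g x + 2 * R * η * n := by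
  have hs : 0 ≤ l.sum := List.sum_nonneg fun a ha => (hl a ha).1
  have := hS.opL_group hR hη hg (List.replicate n (l.sum / (n + 1))) (l.sum / (n + 1)) l hl
    (by
      intro a ha
      rw [← List.replicate_succ] at ha
      rw [List.eq_of_mem_replicate ha]
      positivity)
    (by
      rw [← List.replicate_succ, List.sum_replicate, nsmul_eq_mul]
      push_cast
      field_simp) x
  simpa [List.replicate_succ] using this

/-- The operator for the successor of a stage: the best of all subdivisions. -/
def succOp (S : ℝ → (X → ℝ) → X → ℝ) (a : ℝ) (g : X → ℝ) (x : X) : ℝ :=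
  ⨅ n : ℕ, opL S (List.replicate (n + 1) (a / (n + 1))) g x

theorem nonneg_of_mem_replicate_div {a : ℝ} (ha : 0 ≤ a) (n m : ℕ) :
    ∀ b ∈ List.replicate m (a / (n + 1)), 0 ≤ b := by
  intro b hb
  rw [List.eq_of_mem_replicate hb]
  positivity

theorem StepOp.succOp_le {R : ℝ} {S : ℝ → (X → ℝ) → X → ℝ} (hS : StepOp R S) {a : ℝ} (ha : 0 ≤ a)
    {g : X → ℝ} (hg : IsLip R g) (n : ℕ) (x : X) :
    succOp S a g x ≤ opL S (List.replicate (n + 1) (a / (n + 1))) g x :=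
  ciInf_le ⟨g x, by rintro _ ⟨m, rfl⟩; exact hS.le_opL (nonneg_of_mem_replicate_div ha m _) hg x⟩ n

/-- Only subadditivity needs work: cut both moves into very short pieces, regroup all pieces into `n
+ 1` equal moves of total length `a + b`, and let the pieces shrink. -/
theorem StepOp.succOp {R : ℝ} (hR : 0 ≤ R) {S : ℝ → (X → ℝ) → X → ℝ} (hS : StepOp R S) :
    StepOp R (succOp S) := by
  have hlip : ∀ {a : ℝ} {g : X → ℝ}, 0 ≤ a → IsLip R g → IsLip R (SzlenkSum.succOp S a g) := by
    intro a g ha hg x y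
    rw [← sub_le_iff_le_add]
    refine le_ciInf fun n => ?_
    have h1 := hS.succOp_le ha hg n x
    have h2 := hS.opL_lip (nonneg_of_mem_replicate_div ha n (n + 1)) hg x y
    linarith
  refine ⟨hlip, ?_, ?_, ?_, ?_, ?_⟩
  · intro a g h ha hg hh H x
    exact le_ciInf fun n => (hS.succOp_le ha hg n x).trans
      (hS.opL_mono (nonneg_of_mem_replicate_div ha n _) hg hh H x)
  · intro a g ha hg x
    exact le_ciInf fun n => hS.le_opL (nonneg_of_mem_replicate_div ha n _) hg x
  · intro a g ha hg c x
    rw [← sub_le_iff_le_add]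
    refine le_ciInf fun n => ?_
    have h1 := hS.succOp_le ha (hg.add_const c) n x
    have h2 := hS.opL_mono_add (nonneg_of_mem_replicate_div ha n (n + 1)) (hg.add_const c) hg
      (c := c) (fun _ => le_rfl) x
    linarith
  · intro a b g ha hb hg x
    rw [← sub_le_iff_le_add]
    refine le_ciInf fun n => ?_
    have h1 := hS.succOp_le ha hg n x
    have h2 := hS.opL_replicate_step (n + 1) (a := a / (n + 1)) (b := b / (n + 1))
      (by positivity) (by positivity) hg x
    have h3 : ((n + 1 : ℕ) : ℝ) * (R * |a / (n + 1) - b / (n + 1)|) = R * |a - b| := by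
      rw [← sub_div, abs_div, abs_of_pos (show (0 : ℝ) < n + 1 by positivity)]
      push_cast
      field_simp
    linarith
  · intro a b g ha hb hg x
    refine le_ciInf fun n => ?_
    -- Here `n` is fixed by the infimum on the right, while `N` is the free fineness on the left.
    -- The regrouping error is `2 R n` times the longest piece `max a b / (N + 1)`.
    refine le_of_forall_nat_le_add_div (c := 2 * R * max a b * n) fun N => ?_
    have h1 : SzlenkSum.succOp S a (SzlenkSum.succOp S b g) x ≤
        opL S (List.replicate (N + 1) (a / (N + 1)) ++ List.replicate (N + 1) (b / (N + 1))) g x := by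
      rw [opL_append]
      exact (hS.succOp_le ha (hlip hb hg) N x).trans
        (hS.opL_mono (nonneg_of_mem_replicate_div ha N _) (hlip hb hg)
          (hS.opL_lip (nonneg_of_mem_replicate_div hb N _) hg) (hS.succOp_le hb hg N) x)
    have h2 := hS.opL_le_replicate hR (η := max a b / (N + 1)) (by positivity) hg
      (l := List.replicate (N + 1) (a / (N + 1)) ++ List.replicate (N + 1) (b / (N + 1)))
      (by
        intro c hc
        rcases List.mem_append.1 hc with hc | hc <;> rw [List.eq_of_mem_replicate hc]
        · exact ⟨by positivity, by gcongr; exact le_max_left _ _⟩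
        · exact ⟨by positivity, by gcongr; exact le_max_right _ _⟩) n x
    have h3 : (List.replicate (N + 1) (a / (N + 1)) ++
        List.replicate (N + 1) (b / ((N : ℝ) + 1))).sum = a + b := by
      rw [List.sum_append, List.sum_replicate, List.sum_replicate, nsmul_eq_mul, nsmul_eq_mul]
      push_cast
      field_simp
    rw [h3] at h2
    refine h1.trans (h2.trans (le_of_eq ?_))
    ring

/-- For subadditivity, both infima on the left are bounded by the same index `i`, where `S i` is
already subadditive. -/
theorem StepOp.iInf {R : ℝ} {ι : Type*} [LinearOrder ι] [Nonempty ι]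
    {S : ι → ℝ → (X → ℝ) → X → ℝ} (hS : ∀ i, StepOp R (S i)) :
    StepOp R (fun a g x => ⨅ i, S i a g x) := by
  have hle : ∀ {a : ℝ} {g : X → ℝ}, 0 ≤ a → IsLip R g → ∀ i x, ⨅ i, S i a g x ≤ S i a g x :=
    fun {a g} ha hg i x => ciInf_le ⟨g x, by rintro _ ⟨m, rfl⟩; exact (hS m).le ha hg x⟩ i
  have hlip : ∀ {a : ℝ} {g : X → ℝ}, 0 ≤ a → IsLip R g → IsLip R (fun x => ⨅ i, S i a g x) := by
    intro a g ha hg x y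
    rw [← sub_le_iff_le_add]
    refine le_ciInf fun n => ?_
    have h1 := hle ha hg n x
    have h2 := (hS n).lip ha hg x y
    simp only
    linarith
  refine ⟨hlip, ?_, ?_, ?_, ?_, ?_⟩
  · intro a g h ha hg hh H x
    exact le_ciInf fun n => (hle ha hg n x).trans ((hS n).mono ha hg hh H x)
  · intro a g ha hg x
    exact le_ciInf fun n => (hS n).le ha hg x
  · intro a g ha hg c x
    rw [← sub_le_iff_le_add]
    refine le_ciInf fun n => ?_
    linarith [hle ha (hg.add_const c) n x, (hS n).const ha hg c x]
  · intro a b g ha hb hg x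
    rw [← sub_le_iff_le_add]
    refine le_ciInf fun n => ?_
    linarith [hle ha hg n x, (hS n).step ha hb hg x]
  · intro a b g ha hb hg x
    refine le_ciInf fun n => ?_
    exact (hle ha (hlip hb hg) n x).trans (((hS n).mono ha (hlip hb hg) ((hS n).lip hb hg)
      (hle hb hg n) x).trans ((hS n).sub ha hb hg x))

end Operators

/-! ### The operators attached to the trees -/

section Game

variable (𝕜 : Type w) [RCLike 𝕜] (X : Type u) [NormedAddCommGroup X] [NormedSpace 𝕜 X]

/-- The filter of weak neighbourhoods of `0` in the unit ball. -/
def ballFilter : Filter X :=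
  (⨅ f : StrongDual 𝕜 X, Filter.comap f (𝓝 0)) ⊓ Filter.principal (Metric.closedBall 0 1)

variable {X}

theorem tendsto_ballFilter {ι : Type*} {l : Filter ι} {φ : ι → X} :
    Filter.Tendsto φ l (ballFilter 𝕜 X) ↔
      (∀ f : StrongDual 𝕜 X, Filter.Tendsto (fun i => f (φ i)) l (𝓝 0)) ∧
        ∀ᶠ i in l, ‖φ i‖ ≤ 1 := by
  simp [ballFilter, Filter.tendsto_inf, Filter.tendsto_iInf, Filter.tendsto_comap_iff,
    Function.comp_def]

theorem pure_zero_le_ballFilter : pure (0 : X) ≤ ballFilter 𝕜 X := by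
  have : Filter.Tendsto (fun y : X => y) (pure (0 : X)) (ballFilter 𝕜 X) := by
    refine (tendsto_ballFilter 𝕜).2 ⟨fun f => ?_, ?_⟩
    · simpa only [map_zero] using tendsto_pure_nhds f (0 : X)
    · exact Filter.eventually_pure.2 (by simp)
  simpa [Filter.Tendsto] using this

instance : (ballFilter 𝕜 X).NeBot :=
  Filter.neBot_of_le (pure_zero_le_ballFilter 𝕜)

theorem eventually_ballFilter_norm_le : ∀ᶠ y in ballFilter 𝕜 X, ‖y‖ ≤ 1 :=
  ((tendsto_ballFilter 𝕜).1 Filter.tendsto_id).2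

theorem tendsto_ballFilter_apply (f : StrongDual 𝕜 X) :
    Filter.Tendsto f (ballFilter 𝕜 X) (𝓝 0) :=
  ((tendsto_ballFilter 𝕜).1 Filter.tendsto_id).1 f

/-- The operator for a single vector chosen in a weak neighbourhood of `0` in the unit ball. -/
def baseOp (a : ℝ) (g : X → ℝ) (x : X) : ℝ :=
  Filter.limsup (fun y => g (x + (a : 𝕜) • y)) (ballFilter 𝕜 X)

variable {𝕜}

theorem IsLip.abs_sub_le {R : ℝ} (hR : 0 ≤ R) {g : X → ℝ} (hg : IsLip R g) {a : ℝ} (ha : 0 ≤ a)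
    (x : X) : ∀ᶠ y in ballFilter 𝕜 X, |g (x + (a : 𝕜) • y) - g x| ≤ R * a := by
  filter_upwards [eventually_ballFilter_norm_le 𝕜] with y hy
  have h1 := hg (x + (a : 𝕜) • y) x
  have h2 := hg x (x + (a : 𝕜) • y)
  have h3 : R * ‖(a : 𝕜) • y‖ ≤ R * a := by
    refine mul_le_mul_of_nonneg_left ?_ hR
    rw [norm_smul, RCLike.norm_ofReal, abs_of_nonneg ha]
    exact mul_le_of_le_one_right ha hy
  rw [add_sub_cancel_left] at h1
  rw [sub_add_cancel_left, norm_neg] at h2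
  rw [abs_sub_le_iff]
  constructor <;> linarith

theorem isBoundedUnder_base {R : ℝ} (hR : 0 ≤ R) {g : X → ℝ} (hg : IsLip R g) {a : ℝ}
    (ha : 0 ≤ a) {x : X} :
    Filter.IsBoundedUnder (· ≤ ·) (ballFilter 𝕜 X) (fun y => g (x + (a : 𝕜) • y)) := by
  refine Filter.isBoundedUnder_of_eventually_le (a := g x + R * a) ?_
  filter_upwards [hg.abs_sub_le (𝕜 := 𝕜) hR ha x] with y hy
  linarith [(abs_sub_le_iff.1 hy).1]

theorem isCoboundedUnder_base {R : ℝ} (hR : 0 ≤ R) {g : X → ℝ} (hg : IsLip R g) {a : ℝ}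
    (ha : 0 ≤ a) {x : X} :
    Filter.IsCoboundedUnder (· ≤ ·) (ballFilter 𝕜 X) (fun y => g (x + (a : 𝕜) • y)) := by
  refine Filter.IsCoboundedUnder.of_frequently_ge (a := g x - R * a)
    (Filter.Eventually.frequently ?_)
  filter_upwards [hg.abs_sub_le (𝕜 := 𝕜) hR ha x] with y hy
  linarith [(abs_sub_le_iff.1 hy).2]

theorem baseOp_le {R : ℝ} (hR : 0 ≤ R) {g : X → ℝ} (hg : IsLip R g) {a : ℝ}
    (ha : 0 ≤ a) {x : X} {c : ℝ}
    (h : ∀ᶠ y in ballFilter 𝕜 X, g (x + (a : 𝕜) • y) ≤ c) : baseOp 𝕜 a g x ≤ c :=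
  Filter.limsup_le_of_le (isCoboundedUnder_base hR hg ha) h

theorem eventually_lt_of_baseOp_lt {R : ℝ} (hR : 0 ≤ R) {g : X → ℝ} (hg : IsLip R g) {a : ℝ}
    (ha : 0 ≤ a) {x : X} {c : ℝ}
    (h : baseOp 𝕜 a g x < c) :
    ∀ᶠ y in ballFilter 𝕜 X, g (x + (a : 𝕜) • y) < c :=
  Filter.eventually_lt_of_limsup_lt h (isBoundedUnder_base hR hg ha)

theorem frequently_lt_of_lt_baseOp {R : ℝ} (hR : 0 ≤ R) {g : X → ℝ} (hg : IsLip R g) {a : ℝ}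
    (ha : 0 ≤ a) {x : X} {c : ℝ}
    (h : c < baseOp 𝕜 a g x) :
    ∃ᶠ y in ballFilter 𝕜 X, c < g (x + (a : 𝕜) • y) :=
  Filter.frequently_lt_of_lt_limsup (isCoboundedUnder_base hR hg ha) h

theorem tendsto_convexComb_ballFilter {a b : ℝ} (ha : 0 ≤ a) (hb : 0 ≤ b) (hab : a + b = 1) :
    Filter.Tendsto (fun y : X × X => (a : 𝕜) • y.1 + (b : 𝕜) • y.2)
      (ballFilter 𝕜 X ×ˢ ballFilter 𝕜 X) (ballFilter 𝕜 X) := by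
  rw [tendsto_ballFilter]
  constructor
  · intro f
    have h1 : Filter.Tendsto (fun y : X × X => f y.1) (ballFilter 𝕜 X ×ˢ ballFilter 𝕜 X) (𝓝 0) :=
      (tendsto_ballFilter_apply 𝕜 f).comp Filter.tendsto_fst
    have h2 : Filter.Tendsto (fun y : X × X => f y.2) (ballFilter 𝕜 X ×ˢ ballFilter 𝕜 X) (𝓝 0) :=
      (tendsto_ballFilter_apply 𝕜 f).comp Filter.tendsto_snd
    simpa using (h1.const_mul (a : 𝕜)).add (h2.const_mul (b : 𝕜))
  · filter_upwards [(Filter.tendsto_fst (f := ballFilter 𝕜 X) (g := ballFilter 𝕜 X)).eventually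
      (eventually_ballFilter_norm_le 𝕜),
      (Filter.tendsto_snd (f := ballFilter 𝕜 X) (g := ballFilter 𝕜 X)).eventually
      (eventually_ballFilter_norm_le 𝕜)] with y h1 h2
    refine (norm_add_le _ _).trans ?_
    rw [norm_smul, norm_smul, RCLike.norm_ofReal, RCLike.norm_ofReal, abs_of_nonneg ha,
      abs_of_nonneg hb, ← hab]
    exact add_le_add (mul_le_of_le_one_right ha h1) (mul_le_of_le_one_right hb h2)

/-- Subadditivity comes from convexity of the ball: a move `a y` followed by `b z` is a single move
of length `a + b` in the direction `(a y + b z) / (a + b)`, which is again small and in the ball. -/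
theorem StepOp.baseOp {R : ℝ} (hR : 0 ≤ R) : StepOp R (baseOp 𝕜 (X := X)) := by
  have hlip : ∀ {a : ℝ} {g : X → ℝ}, 0 ≤ a → IsLip R g → IsLip R (SzlenkSum.baseOp 𝕜 a g) := by
    intro a g ha hg x y
    refine le_of_forall_gt fun c hc => ?_
    have h := eventually_lt_of_baseOp_lt (𝕜 := 𝕜) hR hg ha (x := y) (c := c - R * ‖x - y‖)
      (by linarith)
    obtain ⟨c', hc', hc''⟩ := exists_between hc
    refine lt_of_le_of_lt (baseOp_le hR hg ha (c := c') ?_) hc''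
    filter_upwards [eventually_lt_of_baseOp_lt (𝕜 := 𝕜) hR hg ha (x := y) (c := c' - R * ‖x - y‖)
      (by linarith)] with z hz
    have := hg (x + (a : 𝕜) • z) (y + (a : 𝕜) • z)
    rw [add_sub_add_right_eq_sub] at this
    linarith
  have key : ∀ {a b : ℝ} {g h : X → ℝ} {e : ℝ} {x : X}, 0 ≤ a → 0 ≤ b → IsLip R g → IsLip R h →
      (∀ᶠ y in ballFilter 𝕜 X, g (x + (a : 𝕜) • y) ≤ h (x + (b : 𝕜) • y) + e) →
      SzlenkSum.baseOp 𝕜 a g x ≤ SzlenkSum.baseOp 𝕜 b h x + e := by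
    intro a b g h e x ha hb hg hh H
    refine le_of_forall_gt_imp_ge_of_dense fun c hc => baseOp_le hR hg ha ?_
    filter_upwards [H, eventually_lt_of_baseOp_lt (𝕜 := 𝕜) hR hh hb (x := x) (c := c - e)
      (by linarith)] with y h1 h2
    linarith
  refine ⟨hlip, ?_, ?_, ?_, ?_, ?_⟩
  · intro a g h ha hg hh H x
    simpa using key (e := 0) (x := x) ha ha hg hh (.of_forall fun y => by simpa using H _)
  · intro a g ha hg x
    refine le_of_forall_gt_imp_ge_of_dense fun c hc => ?_
    -- The vector `0` lies in every weak neighbourhood of `0`, so standing still is always allowed.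
    have h := (pure_zero_le_ballFilter 𝕜 (X := X)) (eventually_lt_of_baseOp_lt hR hg ha hc)
    simpa using (show g (x + (a : 𝕜) • (0 : X)) < c from h).le
  · intro a g ha hg c x
    exact key ha ha (hg.add_const c) hg (.of_forall fun y => le_rfl)
  · intro a b g ha hb hg x
    refine key ha hb hg hg ?_
    filter_upwards [eventually_ballFilter_norm_le 𝕜] with y hy
    refine (hg _ (x + (b : 𝕜) • y)).trans ?_
    gcongr
    rw [add_sub_add_left_eq_sub, ← sub_smul, norm_smul, ← RCLike.ofReal_sub, RCLike.norm_ofReal]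
    exact mul_le_of_le_one_right (abs_nonneg _) hy
  · intro a b g ha hb hg x
    refine le_of_forall_gt_imp_ge_of_dense fun c hc => ?_
    rcases (add_nonneg ha hb).eq_or_lt with h0 | h0
    · obtain rfl : a = 0 := by linarith
      obtain rfl : b = 0 := by linarith
      simp only [SzlenkSum.baseOp, RCLike.ofReal_zero, zero_smul, add_zero] at hc ⊢
      simpa using hc.le
    have h1 := eventually_lt_of_baseOp_lt (𝕜 := 𝕜) hR hg h0.le hc
    have h2 := (tendsto_convexComb_ballFilter (𝕜 := 𝕜) (X := X) (a := a / (a + b))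
      (b := b / (a + b)) (by positivity) (by positivity) (by field_simp)).eventually h1
    refine baseOp_le hR (hlip hb hg) ha ?_
    -- A statement valid for small pairs `(y, z)` jointly is valid for small `y` and then for small
    -- `z` depending on `y`, as the iterated upper limit requires.
    filter_upwards [h2.curry] with y hy
    refine baseOp_le hR hg hb ?_
    filter_upwards [hy] with z hz
    have hne : ((a : 𝕜) + (b : 𝕜)) ≠ 0 := by
      rw [← RCLike.ofReal_add]
      exact_mod_cast h0.ne'
    have e : x + ((a + b : ℝ) : 𝕜) • (((a / (a + b) : ℝ) : 𝕜) • y + ((b / (a + b) : ℝ) : 𝕜) • z) =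
        x + (a : 𝕜) • y + (b : 𝕜) • z := by
      rw [smul_add, smul_smul, smul_smul, ← RCLike.ofReal_mul, ← RCLike.ofReal_mul,
        mul_div_cancel₀ _ h0.ne', mul_div_cancel₀ _ h0.ne', add_assoc]
    simp only [e] at hz
    exact hz.le

variable (𝕜)

/-- The operator giving the value of the game on `Γ_{ξ,1}`. -/
def op (ξ : Ordinal.{v}) : ℝ → (X → ℝ) → X → ℝ :=
  Ordinal.limitRecOn (motive := fun _ => ℝ → (X → ℝ) → X → ℝ) ξ (baseOp 𝕜) (fun _ S => succOp S)
    (fun ξ hξ ih a g x => ⨅ ζ : Set.Iio ξ, ih (ζ.1 + 1) (hξ.add_one_lt ζ.2) a g x)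

theorem op_zero : op 𝕜 (0 : Ordinal.{v}) = baseOp 𝕜 (X := X) := by
  simp [op]

theorem op_add_one (ξ : Ordinal.{v}) : op 𝕜 (ξ + 1) = succOp (op 𝕜 ξ (X := X)) := by
  simp [op]

theorem op_limit {ξ : Ordinal.{v}} (hξ : Order.IsSuccLimit ξ) :
    op 𝕜 ξ (X := X) = fun a g x => ⨅ ζ : Set.Iio ξ, op 𝕜 (ζ.1 + 1) a g x := by
  rw [op, Ordinal.limitRecOn_limit _ _ _ _ hξ]
  rfl

theorem stepOp_op {R : ℝ} (hR : 0 ≤ R) (ξ : Ordinal.{v}) : StepOp R (op 𝕜 ξ (X := X)) := by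
  induction ξ using Ordinal.limitRecOn with
  | zero => rw [op_zero]; exact .baseOp hR
  | add_one ξ ih => rw [op_add_one]; exact ih.succOp hR
  | limit ξ hξ ih =>
    rw [op_limit 𝕜 hξ]
    have : Nonempty (Set.Iio ξ) := ⟨⟨0, hξ.bot_lt⟩⟩
    exact StepOp.iInf fun ζ => ih _ (hξ.add_one_lt ζ.2)

theorem op_limit_le {R : ℝ} (hR : 0 ≤ R) {ξ ζ : Ordinal.{v}} (hξ : Order.IsSuccLimit ξ)
    (hζ : ζ < ξ) {a : ℝ} (ha : 0 ≤ a) {g : X → ℝ} (hg : IsLip R g) (x : X) :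
    op 𝕜 ξ a g x ≤ op 𝕜 (ζ + 1) a g x := by
  rw [op_limit 𝕜 hξ]
  refine ciInf_le (f := fun ζ : Set.Iio ξ => op 𝕜 (ζ.1 + 1) a g x) ⟨g x, ?_⟩ ⟨ζ, hζ⟩
  rintro _ ⟨η, rfl⟩
  exact (stepOp_op 𝕜 hR _).le ha hg x

end Game

/-! ### Support functions and Szlenk derivations -/

section Szlenk

variable {𝕜 : Type w} [RCLike 𝕜] {X : Type u} [NormedAddCommGroup X] [NormedSpace 𝕜 X]

/-- All members of `L` have norm at most `R`. -/
def DualBdd (R : ℝ) (L : Set (WeakDual 𝕜 X)) : Prop :=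
  ∀ f ∈ L, ∀ x, ‖f x‖ ≤ R * ‖x‖

/-- This is the uniform boundedness principle, the place where completeness of `X` enters. -/
theorem exists_dualBdd [CompleteSpace X] {K : Set (WeakDual 𝕜 X)} (hK : IsCompact K) :
    ∃ R, 0 ≤ R ∧ DualBdd R K := by
  have h : Bornology.IsBounded K :=
    WeakDual.isBounded_iff_isVonNBounded.2 (hK.isVonNBounded 𝕜)
  have h' : Bornology.IsBounded (WeakDual.toStrongDual '' K) := by
    rw [← WeakDual.isBounded_toStrongDual_preimage_iff_isBounded,
      Set.preimage_image_eq _ (LinearEquiv.injective _)]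
    exact h
  obtain ⟨R, hR⟩ := isBounded_iff_forall_norm_le.1 h'
  refine ⟨max R 0, le_max_right _ _, fun f hf x => ?_⟩
  refine ((WeakDual.toStrongDual f).le_opNorm x).trans ?_
  gcongr
  exact (hR _ ⟨f, hf, rfl⟩).trans (le_max_left _ _)

theorem DualBdd.mono {R : ℝ} {L L' : Set (WeakDual 𝕜 X)} (h : DualBdd R L) (hL : L' ⊆ L) :
    DualBdd R L' :=
  fun f hf => h f (hL hf)

theorem DualBdd.le_supportFun {R : ℝ} {L : Set (WeakDual 𝕜 X)} (h : DualBdd R L)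
    {f : WeakDual 𝕜 X} (hf : f ∈ L) (x : X) : RCLike.re (f x) ≤ supportFun L x := by
  refine le_csSup ⟨R * ‖x‖, ?_⟩ ⟨f, hf, rfl⟩
  rintro _ ⟨g, hg, rfl⟩
  exact (RCLike.re_le_norm _).trans (h g hg x)

theorem supportFun_empty (x : X) : supportFun (∅ : Set (WeakDual 𝕜 X)) x = 0 := by
  simp [supportFun]

theorem supportFun_le {L : Set (WeakDual 𝕜 X)} (hL : L.Nonempty) {x : X} {M : ℝ}
    (h : ∀ f ∈ L, RCLike.re (f x) ≤ M) : supportFun L x ≤ M := by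
  refine csSup_le (hL.image _) ?_
  rintro _ ⟨g, hg, rfl⟩
  exact h g hg

theorem DualBdd.isLip {R : ℝ} (hR : 0 ≤ R) {L : Set (WeakDual 𝕜 X)} (h : DualBdd R L) :
    IsLip R (supportFun L) := by
  intro x y
  rcases L.eq_empty_or_nonempty with rfl | hL
  · rw [supportFun_empty, supportFun_empty]
    positivity
  refine supportFun_le hL fun f hf => ?_
  have h1 := h.le_supportFun hf y
  have h2 := (RCLike.re_le_norm (f (x - y))).trans (h f hf (x - y))
  rw [map_sub, map_sub] at h2
  linarith

theorem supportFun_zero (L : Set (WeakDual 𝕜 X)) : supportFun L 0 = 0 := by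
  rcases L.eq_empty_or_nonempty with rfl | hL
  · exact supportFun_empty _
  · simp [supportFun, hL.image_const]

theorem supportFun_real_smul (L : Set (WeakDual 𝕜 X)) {a : ℝ} (ha : 0 ≤ a) (x : X) :
    supportFun L ((a : 𝕜) • x) = a * supportFun L x := by
  rw [supportFun, supportFun, ← smul_eq_mul, ← Real.sSup_smul_of_nonneg ha]
  congr 1
  ext r
  simp [Set.mem_smul_set]

theorem szDeriv_subset (ε : ℝ) (L : Set (WeakDual 𝕜 X)) : szDeriv ε L ⊆ L :=
  fun _ h => h.1

theorem isClosed_szDeriv {ε : ℝ} {L : Set (WeakDual 𝕜 X)} (hL : IsClosed L) :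
    IsClosed (szDeriv ε L) := by
  rw [← isOpen_compl_iff, isOpen_iff_mem_nhds]
  intro f hf
  by_cases hfL : f ∈ L
  · simp only [szDeriv, Set.mem_compl_iff, Set.mem_ofPred_eq, hfL, true_and, not_forall] at hf
    obtain ⟨V, hV, hd⟩ := hf
    filter_upwards [eventually_mem_nhds_iff.2 hV] with g hg hg'
    exact hd (hg'.2 V hg)
  · filter_upwards [hL.isOpen_compl.mem_nhds hfL] with g hg hg'
    exact hg hg'.1

theorem szDerivIter_zero (ε : ℝ) (K : Set (WeakDual 𝕜 X)) :
    szDerivIter ε K (0 : Ordinal.{v}) = K := by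
  simp [szDerivIter]

theorem szDerivIter_add_one (ε : ℝ) (K : Set (WeakDual 𝕜 X)) (ξ : Ordinal.{v}) :
    szDerivIter ε K (ξ + 1) = szDeriv ε (szDerivIter ε K ξ) := by
  simp [szDerivIter]

theorem szDerivIter_limit (ε : ℝ) (K : Set (WeakDual 𝕜 X)) {ξ : Ordinal.{v}}
    (hξ : Order.IsSuccLimit ξ) :
    szDerivIter ε K ξ = ⋂ (ζ : Ordinal.{v}) (_ : ζ < ξ), szDerivIter ε K ζ := by
  rw [szDerivIter, Ordinal.limitRecOn_limit _ _ _ _ hξ]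
  rfl

theorem szDerivIter_anti (ε : ℝ) (K : Set (WeakDual 𝕜 X)) {η ξ : Ordinal.{v}} (h : η ≤ ξ) :
    szDerivIter ε K ξ ⊆ szDerivIter ε K η := by
  induction ξ using Ordinal.limitRecOn with
  | zero => rw [nonpos_iff_eq_zero.1 h]
  | add_one ξ ih =>
    rcases h.lt_or_eq with h | rfl
    · rw [szDerivIter_add_one]
      exact (szDeriv_subset _ _).trans (ih (Order.lt_add_one_iff.1 h))
    · exact subset_rfl
  | limit ξ hξ _ =>
    rcases h.lt_or_eq with h | rfl
    · rw [szDerivIter_limit ε K hξ]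
      exact Set.iInter₂_subset η h
    · exact subset_rfl

theorem szDerivIter_subset (ε : ℝ) (K : Set (WeakDual 𝕜 X)) (ξ : Ordinal.{v}) :
    szDerivIter ε K ξ ⊆ K := by
  simpa [szDerivIter_zero] using szDerivIter_anti ε K (zero_le (a := ξ))

theorem isClosed_szDerivIter {ε : ℝ} {K : Set (WeakDual 𝕜 X)} (hK : IsClosed K)
    (ξ : Ordinal.{v}) : IsClosed (szDerivIter ε K ξ) := by
  induction ξ using Ordinal.limitRecOn with
  | zero => rwa [szDerivIter_zero]
  | add_one ξ ih => rw [szDerivIter_add_one]; exact isClosed_szDeriv ih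
  | limit ξ hξ ih =>
    rw [szDerivIter_limit ε K hξ]
    exact isClosed_iInter fun ζ => isClosed_iInter fun hζ => ih ζ hζ

theorem isCompact_szDerivIter {ε : ℝ} {K : Set (WeakDual 𝕜 X)} (hK : IsCompact K)
    (ξ : Ordinal.{v}) : IsCompact (szDerivIter ε K ξ) :=
  hK.of_isClosed_subset (isClosed_szDerivIter hK.isClosed ξ) (szDerivIter_subset ε K ξ)

theorem szDerivIter_add (ε : ℝ) (K : Set (WeakDual 𝕜 X)) (η ξ : Ordinal.{v}) :
    szDerivIter ε K (η + ξ) = szDerivIter ε (szDerivIter ε K η) ξ := by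
  induction ξ using Ordinal.limitRecOn with
  | zero => rw [add_zero, szDerivIter_zero]
  | add_one ξ ih => rw [← add_assoc, szDerivIter_add_one, szDerivIter_add_one, ih]
  | limit ξ hξ ih =>
    rw [szDerivIter_limit ε K (Ordinal.isSuccLimit_add η hξ), szDerivIter_limit ε _ hξ]
    apply subset_antisymm
    · refine Set.subset_iInter₂ fun ζ hζ => ?_
      rw [← ih ζ hζ]
      exact fun f hf => Set.mem_iInter₂.1 hf (η + ζ) ((add_lt_add_iff_left η).2 hζ)
    · refine Set.subset_iInter₂ fun ζ hζ => ?_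
      obtain ⟨ρ, hρ, h⟩ := (Ordinal.lt_add_iff_of_isSuccLimit hξ).1 hζ
      refine (Set.iInter₂_subset ρ hρ).trans ?_
      rw [← ih ρ hρ]
      exact szDerivIter_anti ε K h.le

/-- At a limit stage of the derivation, a strict bound holds already at an earlier stage. -/
theorem exists_lt_forall_szDerivIter {ε : ℝ} {K : Set (WeakDual 𝕜 X)} (hK : IsCompact K)
    {ξ : Ordinal.{v}} (hξ : Order.IsSuccLimit ξ) {x : X} {M : ℝ}
    (h : ∀ f ∈ szDerivIter ε K ξ, RCLike.re (f x) < M) :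
    ∃ η < ξ, ∀ f ∈ szDerivIter ε K η, RCLike.re (f x) < M := by
  have : Nonempty (Set.Iio ξ) := ⟨⟨0, hξ.bot_lt⟩⟩
  have hre : Continuous fun f : WeakDual 𝕜 X => RCLike.re (f x) :=
    RCLike.continuous_re.comp (WeakDual.eval_continuous x)
  -- The sets of functionals in the stage `η` that violate the bound are closed in `K` and decrease
  -- to the empty set, so one of them is already empty.
  obtain ⟨⟨η, hη⟩, H⟩ := hK.elim_directed_family_closed
    (fun η : Set.Iio ξ => szDerivIter ε K η.1 ∩ {f | M ≤ RCLike.re (f x)})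
    (fun η => (isClosed_szDerivIter hK.isClosed η.1).inter (isClosed_le continuous_const hre))
    (by
      rw [Set.eq_empty_iff_forall_notMem]
      rintro f ⟨-, hf⟩
      simp only [Set.mem_iInter, Set.mem_inter_iff, Set.mem_ofPred_eq, Subtype.forall,
        Set.mem_Iio] at hf
      have h1 : f ∈ szDerivIter ε K ξ := by
        rw [szDerivIter_limit ε K hξ]
        exact Set.mem_iInter₂.2 fun ζ hζ => (hf ζ hζ).1
      exact (h f h1).not_ge (hf 0 hξ.bot_lt).2)
    (by
      intro a b
      refine ⟨max a b, ?_, ?_⟩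
      · exact Set.inter_subset_inter_left _ (szDerivIter_anti ε K (le_max_left a b))
      · exact Set.inter_subset_inter_left _ (szDerivIter_anti ε K (le_max_right a b)))
  refine ⟨η, hη, fun f hf => ?_⟩
  by_contra! hM
  exact Set.eq_empty_iff_forall_notMem.1 H f ⟨szDerivIter_subset ε K η hf, hf, hM⟩

theorem exists_lt_szDerivIter_eq_empty {ε : ℝ} {K : Set (WeakDual 𝕜 X)} (hK : IsCompact K)
    {ξ : Ordinal.{v}} (hξ : Order.IsSuccLimit ξ) (h : szDerivIter ε K ξ = ∅) :
    ∃ η < ξ, szDerivIter ε K η = ∅ := by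
  -- At `x = 0` the bound `0 < 0` is false for every functional, so it holds on a stage only if that
  -- stage is empty.
  obtain ⟨η, hη, H⟩ := exists_lt_forall_szDerivIter (ε := ε) hK hξ (x := 0) (M := 0)
    (by simp [h])
  exact ⟨η, hη, Set.eq_empty_iff_forall_notMem.2 fun f hf => by simpa using H f hf⟩

theorem isSuccLimit_opow_add_one (ξ : Ordinal.{v}) : Order.IsSuccLimit (ω ^ (ξ + 1)) :=
  Ordinal.isSuccLimit_opow_left Ordinal.isSuccLimit_omega0 (by simp)

theorem exists_nat_of_lt_opow_add_one {ξ η : Ordinal.{v}} (h : η < ω ^ (ξ + 1)) :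
    ∃ n : ℕ, η < ω ^ ξ * (n : Ordinal.{v}) := by
  rw [Ordinal.opow_add, Ordinal.opow_one,
    Ordinal.lt_mul_iff_of_isSuccLimit Ordinal.isSuccLimit_omega0] at h
  obtain ⟨c, hc, h⟩ := h
  obtain ⟨n, rfl⟩ := Ordinal.lt_omega0.1 hc
  exact ⟨n, h⟩

theorem opow_mul_natCast_le (ξ : Ordinal.{v}) (n : ℕ) :
    ω ^ ξ * (n : Ordinal.{v}) ≤ ω ^ (ξ + 1) := by
  rw [Ordinal.opow_add, Ordinal.opow_one]
  exact mul_le_mul_right (Ordinal.natCast_lt_omega0 n).le _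

/-! ### The lower estimate of the operators -/

theorem exists_re_apply_gt {h : StrongDual 𝕜 X} {r : ℝ} (hr : r < ‖h‖) :
    ∃ y : X, ‖y‖ ≤ 1 ∧ r < RCLike.re (h y) := by
  rcases lt_or_ge r 0 with hr0 | hr0
  · exact ⟨0, by simp, by simpa using hr0⟩
  obtain ⟨x, hx, hrx⟩ := h.exists_lt_apply_of_lt_opNorm hr
  have h0 : (‖h x‖ : 𝕜) ≠ 0 := by exact_mod_cast (hr0.trans_lt hrx).ne'
  refine ⟨(starRingEnd 𝕜 (h x) / (‖h x‖ : 𝕜)) • x, ?_, ?_⟩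
  · rw [norm_smul, norm_div, RCLike.norm_conj, RCLike.norm_ofReal, abs_norm,
      div_self (hr0.trans_lt hrx).ne', one_mul]
    exact hx.le
  · rw [map_smul, smul_eq_mul, div_mul_eq_mul_div, RCLike.conj_mul, sq, mul_div_cancel_right₀ _ h0,
      RCLike.ofReal_re]
    exact hrx

/-- A bounded family need not converge weakly, but along an ultrafilter every functional has a limit
on it. Differences therefore tend weakly to `0`, and halving returns them to the ball. -/
theorem exists_ball_map_tendsto {ι : Type*} (U : Ultrafilter ι) {Y : ι → X}
    (hY : ∀ i, ‖Y i‖ ≤ 1) :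
    Filter.Tendsto (fun p : ι × ι => ((2⁻¹ : ℝ) : 𝕜) • (Y p.2 - Y p.1))
      ((U : Filter ι) ×ˢ (U : Filter ι)) (ballFilter 𝕜 X) := by
  refine (tendsto_ballFilter 𝕜).2 ⟨fun h => ?_, .of_forall fun p => ?_⟩
  · obtain ⟨z, -, hz⟩ := (isCompact_closedBall (0 : 𝕜) ‖h‖).ultrafilter_le_nhds
      (U.map fun i => h (Y i)) (by
        rw [Filter.le_principal_iff]
        refine Filter.Eventually.of_forall (f := (U : Filter ι)) fun i => ?_
        rw [mem_closedBall_zero_iff]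
        exact (h.le_opNorm _).trans (mul_le_of_le_one_right (norm_nonneg _) (hY i)))
    have hz' : Filter.Tendsto (fun i => h (Y i)) (U : Filter ι) (𝓝 z) := hz
    have h1 := (hz'.comp (Filter.tendsto_snd (f := (U : Filter ι)) (g := (U : Filter ι)))).sub
      (hz'.comp (Filter.tendsto_fst (f := (U : Filter ι)) (g := (U : Filter ι))))
    simpa using h1.const_mul ((2⁻¹ : ℝ) : 𝕜)
  · rw [norm_smul, RCLike.norm_ofReal, abs_of_pos (by norm_num)]
    linarith [norm_sub_le (Y p.2) (Y p.1), hY p.1, hY p.2]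

/-- Functionals `g` in `L` at distance more than `ε / 2` from `f` accumulate weak* at `f`. Vectors
`Y g` on which `g - f` is large yield the weakly null directions `(Y g - Y g') / 2`. One factor `2`
in `ε / 4` is the passage from diameter to radius, the other is this halving. -/
theorem le_baseOp_supportFun {R : ℝ} (hR : 0 ≤ R) {L : Set (WeakDual 𝕜 X)} (hL : DualBdd R L)
    {ε : ℝ} {f : WeakDual 𝕜 X} (hf : f ∈ szDeriv ε L) {a : ℝ} (ha : 0 ≤ a) (x : X) :
    RCLike.re (f x) + a * (ε / 4) ≤ baseOp 𝕜 a (supportFun L) x := by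
  classical
  refine le_of_forall_gt_imp_ge_of_dense fun c hc => ?_
  have hE := eventually_lt_of_baseOp_lt (𝕜 := 𝕜) hR (hL.isLip hR) ha hc
  set A : Set (WeakDual 𝕜 X) := {g | g ∈ L ∧ ε / 2 < ‖WeakDual.toStrongDual (g - f)‖} with hA
  have hN : (𝓝 f ⊓ Filter.principal A).NeBot := by
    rw [Filter.inf_principal_neBot_iff]
    intro V hV
    by_contra! hne
    refine (hf.2 V hV).not_ge (Metric.ediam_le ?_)
    have hg : ∀ g ∈ V ∩ L, ‖WeakDual.toStrongDual (g - f)‖ ≤ ε / 2 := by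
      intro g hg
      by_contra! h
      exact Set.eq_empty_iff_forall_notMem.1 hne g ⟨hg.1, hg.2, h⟩
    rintro _ ⟨g, hg1, rfl⟩ _ ⟨g', hg2, rfl⟩
    rw [edist_dist, dist_eq_norm]
    refine ENNReal.ofReal_le_ofReal ?_
    have e : WeakDual.toStrongDual g - WeakDual.toStrongDual g' =
        WeakDual.toStrongDual (g - f) - WeakDual.toStrongDual (g' - f) := by
      simp only [map_sub]; abel
    rw [e]
    linarith [norm_sub_le (WeakDual.toStrongDual (g - f)) (WeakDual.toStrongDual (g' - f)),
      hg g hg1, hg g' hg2]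
  have hY : ∀ g : WeakDual 𝕜 X, ∃ y : X, ‖y‖ ≤ 1 ∧ (g ∈ A → ε / 2 < RCLike.re ((g - f) y)) := by
    intro g
    by_cases hg : g ∈ A
    · obtain ⟨y, hy, hy'⟩ := exists_re_apply_gt hg.2
      exact ⟨y, hy, fun _ => hy'⟩
    · exact ⟨0, by simp, fun h => absurd h hg⟩
  choose Y hY1 hY2 using hY
  set U := Ultrafilter.of (𝓝 f ⊓ Filter.principal A) with hU
  have hU1 : (U : Filter _) ≤ 𝓝 f := (Ultrafilter.of_le _).trans inf_le_left
  have hU2 : ∀ᶠ g in (U : Filter _), g ∈ A :=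
    Filter.le_principal_iff.1 ((Ultrafilter.of_le _).trans inf_le_right)
  refine le_of_forall_pos_le_add fun δ hδ => ?_
  -- The final estimate loses `δ'` at `x` and at most `2 δ'` in the direction of the move, hence `(1
  -- + 2 a) δ'` in all.
  set δ' := δ / (1 + 2 * a) with hδ'
  have hδ'0 : 0 < δ' := by positivity
  have hδ'1 : δ' * (1 + 2 * a) = δ := by rw [hδ']; field_simp
  have hf0 : ∀ᶠ y in ballFilter 𝕜 X, -δ' < RCLike.re (f y) := by
    have := (RCLike.continuous_re.tendsto _).comp
      (tendsto_ballFilter_apply 𝕜 (WeakDual.toStrongDual f))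
    refine this.eventually_const_lt ?_
    simpa using hδ'0
  -- Fixing `g'` before `g` is essential: `Y g'` is then a single vector, and weak* convergence
  -- makes `g (Y g')` close to `f (Y g')`.
  have hcur := ((exists_ball_map_tendsto (𝕜 := 𝕜) U hY1).eventually (hE.and hf0)).curry
  obtain ⟨g', hg'⟩ := hcur.exists
  have hev : ∀ y : X, Filter.Tendsto (fun g : WeakDual 𝕜 X => RCLike.re (g y)) (U : Filter _)
      (𝓝 (RCLike.re (f y))) := fun y =>
    ((RCLike.continuous_re.comp (WeakDual.eval_continuous y)).tendsto f).mono_left hU1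
  obtain ⟨g, ⟨h1, h2⟩, h3, h4, h5⟩ := (hg'.and (hU2.and
    (((hev x).eventually_const_lt (show RCLike.re (f x) - δ' < _ by linarith)).and
      ((hev (Y g')).eventually_lt_const (show _ < RCLike.re (f (Y g')) + δ' by linarith))))).exists
  have h6 := hY2 g h3
  have h7 := hL.le_supportFun h3.1 (x + (a : 𝕜) • ((2⁻¹ : ℝ) : 𝕜) • (Y g - Y g'))
  have h8 : RCLike.re ((g - f) (Y g)) = RCLike.re (g (Y g)) - RCLike.re (f (Y g)) := by
    rw [← map_sub]; rfl
  simp only [map_add, map_smul, map_sub, smul_eq_mul, RCLike.re_ofReal_mul] at h7 h2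
  have h9 : ε / 4 - 2 * δ' ≤
      2⁻¹ * (RCLike.re (g (Y g)) - RCLike.re (g (Y g'))) := by
    linarith
  have h10 := mul_le_mul_of_nonneg_left h9 ha
  nlinarith

/-- By induction, `n` moves dominate the support function of the stage `ρ n` raised by `n b e`. One
more move is then applied to that derived set. -/
theorem le_opL_of_le_step {R : ℝ} (hR : 0 ≤ R) {S : ℝ → (X → ℝ) → X → ℝ} (hS : StepOp R S)
    {ε e b : ℝ} (hb : 0 ≤ b) (ρ : Ordinal.{v})
    (H : ∀ (L : Set (WeakDual 𝕜 X)), DualBdd R L → ∀ f ∈ szDerivIter ε L ρ, ∀ x,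
      RCLike.re (f x) + b * e ≤ S b (supportFun L) x) (n : ℕ)
    {L : Set (WeakDual 𝕜 X)} (hL : DualBdd R L) {f : WeakDual 𝕜 X}
    (hf : f ∈ szDerivIter ε L (ρ * (n : Ordinal.{v}))) (x : X) :
    RCLike.re (f x) + n * (b * e) ≤ opL S (List.replicate n b) (supportFun L) x := by
  induction n generalizing f x with
  | zero =>
    rw [Nat.cast_zero, mul_zero, szDerivIter_zero] at hf
    simpa [opL] using hL.le_supportFun hf x
  | succ n ih =>
    rw [Nat.cast_add, Nat.cast_one, mul_add, mul_one, szDerivIter_add] at hf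
    have hL' := hL.mono (szDerivIter_subset ε L (ρ * (n : Ordinal.{v})))
    have hne : (szDerivIter ε L (ρ * (n : Ordinal.{v}))).Nonempty :=
      ⟨f, szDerivIter_subset _ _ _ hf⟩
    have hn : ∀ c ∈ List.replicate n b, 0 ≤ c := fun c hc => by
      rwa [List.eq_of_mem_replicate hc]
    have h1 := hS.mono_add hb (hL'.isLip hR) (hS.opL_lip hn (hL.isLip hR)) (c := -(n * (b * e)))
      (fun y => supportFun_le hne fun g hg => by linarith [ih hg y]) x
    have h2 := H _ hL' f hf x
    rw [List.replicate_succ, opL_cons]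
    push_cast
    linarith

/-- The gain is linear in the length, so it survives subdivision: the stage `ω^(ξ+1)` lies inside
every `ω^ξ n`, and `n` moves of length `a / n` still gain `a ε / 4`. -/
theorem le_op_supportFun {R : ℝ} (hR : 0 ≤ R) {ε : ℝ} (ξ : Ordinal.{v})
    {L : Set (WeakDual 𝕜 X)} (hL : DualBdd R L) {f : WeakDual 𝕜 X}
    (hf : f ∈ szDerivIter ε L (ω ^ ξ)) {a : ℝ} (ha : 0 ≤ a) (x : X) :
    RCLike.re (f x) + a * (ε / 4) ≤ op 𝕜 ξ a (supportFun L) x := by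
  induction ξ using Ordinal.limitRecOn generalizing L f a x with
  | zero =>
    rw [Ordinal.opow_zero, ← zero_add 1, szDerivIter_add_one, szDerivIter_zero] at hf
    rw [op_zero]
    exact le_baseOp_supportFun hR hL hf ha x
  | add_one ξ ih =>
    rw [op_add_one]
    refine le_ciInf fun n => ?_
    have hf' := szDerivIter_anti ε L (opow_mul_natCast_le ξ (n + 1)) hf
    have hb : 0 ≤ a / (n + 1) := by positivity
    refine le_trans (le_of_eq ?_) (le_opL_of_le_step hR (stepOp_op 𝕜 hR ξ) hb (ω ^ ξ)
      (fun L hL f hf x => ih hL hf hb x) (n + 1) hL hf' x)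
    push_cast
    field_simp
  | limit ξ hξ ih =>
    rw [op_limit 𝕜 hξ]
    have : Nonempty (Set.Iio ξ) := ⟨⟨0, hξ.bot_lt⟩⟩
    refine le_ciInf fun ζ => ?_
    have hζ := hξ.add_one_lt ζ.2
    exact ih _ hζ hL (szDerivIter_anti ε L
      (Ordinal.opow_le_opow_right Ordinal.omega0_pos hζ.le) hf) ha x

/-! ### The upper estimate of the operators -/

/-- The function `g` is at most the supremum of the functions `x ↦ Re f(x) + c`, where `f ∈ L` and
`(L, c)` is in the family. -/
def DomBy (F : Set (Set (WeakDual 𝕜 X) × ℝ)) (g : X → ℝ) : Prop :=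
  ∀ x M, (∀ P ∈ F, ∀ f ∈ P.1, RCLike.re (f x) + P.2 ≤ M) → g x ≤ M

/-- The family that dominates `S b g` if `F` dominates `g` and `S` uses the derivation of
order `ρ`. -/
def stepFamily (R ε b : ℝ) (ρ : Ordinal.{v}) (F : Set (Set (WeakDual 𝕜 X) × ℝ)) (n : ℕ) :
    Set (Set (WeakDual 𝕜 X) × ℝ) :=
  ⋃ k ∈ Set.Iic n, (fun P => (szDerivIter ε P.1 (ρ * (k : Ordinal.{v})),
    P.2 + k * (b * R) + (n - k) * (b * ε))) '' F

/-- For a single move the index `k` is `0` or `1`: stay in the set and gain `b ε`, or pass to the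
derived set and gain `b R`. -/
theorem domBy_stepFamily_one {R ε b : ℝ} {ρ : Ordinal.{v}} {F : Set (Set (WeakDual 𝕜 X) × ℝ)}
    {g : X → ℝ} : DomBy (stepFamily R ε b ρ F 1) g ↔ ∀ x M,
      (∀ P ∈ F, (∀ f ∈ P.1, RCLike.re (f x) + P.2 + b * ε ≤ M) ∧
        ∀ f ∈ szDerivIter ε P.1 ρ, RCLike.re (f x) + P.2 + b * R ≤ M) → g x ≤ M := by
  refine forall₂_congr fun x M => imp_congr_left ?_
  simp only [stepFamily, Set.mem_Iic, Set.mem_iUnion, Set.mem_image, forall_exists_index, and_imp,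
    exists_prop]
  constructor
  · intro H P hP
    have h0 := H _ 0 (by simp) P hP rfl
    have h1 := H _ 1 (by simp) P hP rfl
    simp only [Nat.cast_zero, mul_zero, szDerivIter_zero, Nat.cast_one, mul_one] at h0 h1
    exact ⟨fun f hf => by linarith [h0 f hf], fun f hf => by linarith [h1 f hf]⟩
  · rintro H _ k hk P hP rfl f hf
    interval_cases k
    · simp only [Nat.cast_zero, mul_zero, szDerivIter_zero] at hf
      have := (H P hP).1 f hf
      norm_num
      linarith
    · simp only [Nat.cast_one, mul_one] at hf
      have := (H P hP).2 f hf
      norm_num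
      linarith

/-- In the derived set only the norm bound `R` on the gain is available. Outside it, some
neighbourhood has diameter at most `ε`, so there `g y` exceeds `f y` by at most `ε`, and `f y` tends
to `0`. -/
theorem exists_nhds_eventually_le {R ε : ℝ} (hR : 0 ≤ R) (hε : 0 ≤ ε) {L : Set (WeakDual 𝕜 X)}
    (hL : DualBdd R L) {b : ℝ} (hb : 0 ≤ b) {x : X} {M : ℝ} {δ : ℝ} (hδ : 0 < δ)
    {f : WeakDual 𝕜 X} (hf : f ∈ L) (h1 : RCLike.re (f x) + b * ε ≤ M)
    (h2 : f ∈ szDeriv ε L → RCLike.re (f x) + b * R ≤ M) :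
    ∃ V ∈ 𝓝[L] f, ∀ᶠ y in ballFilter 𝕜 X, ∀ g ∈ V,
      RCLike.re (g (x + (b : 𝕜) • y)) ≤ M + δ := by
  have hcont : ∀ᶠ g in 𝓝 f, RCLike.re (g x) < RCLike.re (f x) + δ / 2 :=
    ((RCLike.continuous_re.comp (WeakDual.eval_continuous x)).tendsto f).eventually_lt_const
      (by simpa using by positivity)
  by_cases hfs : f ∈ szDeriv ε L
  · refine ⟨{g | RCLike.re (g x) < RCLike.re (f x) + δ / 2} ∩ L,
      Filter.inter_mem (mem_nhdsWithin_of_mem_nhds hcont) self_mem_nhdsWithin, ?_⟩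
    filter_upwards [eventually_ballFilter_norm_le 𝕜] with y hy g hg
    rw [map_add, map_smul, map_add, smul_eq_mul, RCLike.re_ofReal_mul]
    have h3 := (RCLike.re_le_norm (g y)).trans ((hL g hg.2 y).trans
      (mul_le_of_le_one_right hR hy))
    have h4 := mul_le_mul_of_nonneg_left h3 hb
    have h5 : RCLike.re (g x) < RCLike.re (f x) + δ / 2 := hg.1
    linarith [h2 hfs]
  · simp only [szDeriv, Set.mem_ofPred_eq, hf, true_and, not_forall, not_lt] at hfs
    obtain ⟨V, hV, hd⟩ := hfs
    refine ⟨{g | RCLike.re (g x) < RCLike.re (f x) + δ / 2} ∩ V ∩ L,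
      Filter.inter_mem (mem_nhdsWithin_of_mem_nhds (Filter.inter_mem hcont hV))
        self_mem_nhdsWithin, ?_⟩
    have hf0 : ∀ᶠ y in ballFilter 𝕜 X, b * RCLike.re (f y) < δ / 2 := by
      have := ((RCLike.continuous_re.tendsto _).comp
        (tendsto_ballFilter_apply 𝕜 (WeakDual.toStrongDual f))).const_mul b
      refine this.eventually_lt_const ?_
      simpa using hδ
    filter_upwards [eventually_ballFilter_norm_le 𝕜, hf0] with y hy hfy g hg
    rw [map_add, map_smul, map_add, smul_eq_mul, RCLike.re_ofReal_mul]
    have h3 : ‖WeakDual.toStrongDual g - WeakDual.toStrongDual f‖ ≤ ε := by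
      have := (Metric.edist_le_ediam_of_mem (Set.mem_image_of_mem WeakDual.toStrongDual
        (show g ∈ V ∩ L from ⟨hg.1.2, hg.2⟩)) (Set.mem_image_of_mem WeakDual.toStrongDual
        (show f ∈ V ∩ L from ⟨mem_of_mem_nhds hV, hf⟩))).trans hd
      rwa [edist_dist, dist_eq_norm, ENNReal.ofReal_le_ofReal_iff hε] at this
    have h4 : RCLike.re (g y) - RCLike.re (f y) ≤ ε := by
      rw [← map_sub]
      refine (RCLike.re_le_norm _).trans ((((WeakDual.toStrongDual g -
        WeakDual.toStrongDual f).le_opNorm y).trans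
        (mul_le_mul_of_nonneg_right h3 (norm_nonneg _))).trans (mul_le_of_le_one_right hε hy))
    have h5 := mul_le_mul_of_nonneg_left h4 hb
    have h6 : RCLike.re (g x) < RCLike.re (f x) + δ / 2 := hg.1.1
    linarith

/-- Compactness of each set and finiteness of the family turn the local estimates of
`exists_nhds_eventually_le` into one weak neighbourhood of `0` that serves for all functionals. -/
theorem domBy_baseOp {R ε : ℝ} (hR : 0 ≤ R) (hε : 0 ≤ ε) {F : Set (Set (WeakDual 𝕜 X) × ℝ)}
    (hF : F.Finite) (hFc : ∀ P ∈ F, IsCompact P.1) (hFb : ∀ P ∈ F, DualBdd R P.1)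
    {g : X → ℝ} (hg : IsLip R g) (hFg : DomBy F g) {b : ℝ} (hb : 0 ≤ b) :
    DomBy (stepFamily R ε b (1 : Ordinal.{v}) F 1) (baseOp 𝕜 b g) := by
  rw [domBy_stepFamily_one]
  intro x M H
  refine le_of_forall_pos_le_add fun δ hδ => baseOp_le hR hg hb ?_
  have key : ∀ P ∈ F, ∀ᶠ y in ballFilter 𝕜 X, ∀ f ∈ P.1,
      RCLike.re (f (x + (b : 𝕜) • y)) ≤ M - P.2 + δ := by
    intro P hP
    refine (hFc P hP).induction_on
      (p := fun s => ∀ᶠ y in ballFilter 𝕜 X, ∀ f ∈ s, RCLike.re (f (x + (b : 𝕜) • y)) ≤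
        M - P.2 + δ) (by simp) ?_ ?_ ?_
    · intro s t hst h
      filter_upwards [h] with y hy f hf using hy f (hst hf)
    · intro s t hs ht
      filter_upwards [hs, ht] with y h1 h2 f hf
      exact hf.elim (h1 f) (h2 f)
    · intro f hf
      refine exists_nhds_eventually_le hR hε (hFb P hP) hb hδ hf ?_ ?_
      · linarith [(H P hP).1 f hf]
      · intro h
        have := (H P hP).2 f (by
          rwa [← zero_add 1, szDerivIter_add_one, szDerivIter_zero])
        linarith
  filter_upwards [(Filter.eventually_all_finite hF).2 key] with y hy
  exact hFg _ _ fun P hP f hf => by linarith [hy P hP f hf]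

theorem finite_stepFamily {R ε b : ℝ} {ρ : Ordinal.{v}} {F : Set (Set (WeakDual 𝕜 X) × ℝ)}
    (hF : F.Finite) (n : ℕ) : (stepFamily R ε b ρ F n).Finite :=
  (Set.finite_Iic n).biUnion fun _ _ => hF.image _

/-- The operator `S` is controlled by the derivation of order `ρ`. -/
def DomStep (𝕜 : Type w) [RCLike 𝕜] {X : Type u} [NormedAddCommGroup X] [NormedSpace 𝕜 X]
    (R ε : ℝ) (ρ : Ordinal.{v}) (S : ℝ → (X → ℝ) → X → ℝ) : Prop :=
  ∀ F : Set (Set (WeakDual 𝕜 X) × ℝ), F.Finite → (∀ P ∈ F, IsCompact P.1) →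
    (∀ P ∈ F, DualBdd R P.1) → ∀ g : X → ℝ, IsLip R g → DomBy F g → ∀ b : ℝ, 0 ≤ b →
      DomBy (stepFamily R ε b ρ F 1) (S b g)

/-- The index `k` in the family counts how many of the `n` moves passed to the derived set.
Domination must be formulated for families because several values of `k` compete after the first
move. -/
theorem DomStep.opL {R ε : ℝ} {ρ : Ordinal.{v}} {S : ℝ → (X → ℝ) → X → ℝ}
    (hS : StepOp R S) (h : DomStep 𝕜 R ε ρ S) {F : Set (Set (WeakDual 𝕜 X) × ℝ)} (hF : F.Finite)
    (hFc : ∀ P ∈ F, IsCompact P.1) (hFb : ∀ P ∈ F, DualBdd R P.1) {g : X → ℝ} (hg : IsLip R g)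
    (hFg : DomBy F g) {b : ℝ} (hb : 0 ≤ b) (n : ℕ) :
    DomBy (stepFamily R ε b ρ F n) (opL S (List.replicate n b) g) := by
  induction n with
  | zero =>
    intro x M H
    refine hFg x M fun P hP f hf => ?_
    have := H (P.1, P.2) (by
      simp only [stepFamily, Set.mem_iUnion]
      exact ⟨0, by simp, P, hP, by simp [szDerivIter_zero]⟩) f hf
    simpa using this
  | succ n ih =>
    have hn : ∀ c ∈ List.replicate n b, 0 ≤ c := fun c hc => by
      rwa [List.eq_of_mem_replicate hc]
    have mem : ∀ Q ∈ stepFamily R ε b ρ F n, ∃ k ≤ n, ∃ P ∈ F,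
        (szDerivIter ε P.1 (ρ * (k : Ordinal.{v})), P.2 + k * (b * R) + (n - k) * (b * ε)) = Q := by
      intro Q hQ
      simpa [stepFamily] using hQ
    have := h (stepFamily R ε b ρ F n) (finite_stepFamily hF n)
      (by
        intro Q hQ
        obtain ⟨k, -, P, hP, rfl⟩ := mem Q hQ
        exact isCompact_szDerivIter (hFc P hP) _)
      (by
        intro Q hQ
        obtain ⟨k, -, P, hP, rfl⟩ := mem Q hQ
        exact (hFb P hP).mono (szDerivIter_subset _ _ _)) _ (hS.opL_lip hn hg) ih b hb
    rw [domBy_stepFamily_one] at this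
    intro x M H
    rw [List.replicate_succ, opL_cons]
    refine this x M fun Q hQ => ?_
    obtain ⟨k, hk, P, hP, rfl⟩ := mem Q hQ
    have hin : ∀ j ≤ n + 1, ∀ f ∈ szDerivIter ε P.1 (ρ * (j : Ordinal.{v})),
        RCLike.re (f x) + (P.2 + j * (b * R) + ((n + 1 : ℕ) - j) * (b * ε)) ≤ M := by
      intro j hj
      refine H (_, _) ?_
      simp only [stepFamily, Set.mem_iUnion]
      exact ⟨j, hj, P, hP, rfl⟩
    constructor
    · intro f hf
      have := hin k (by omega) f hf
      push_cast at this
      simp only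
      linarith
    · intro f hf
      have := hin (k + 1) (by omega) f (by
        rw [Nat.cast_add, Nat.cast_one, mul_add, mul_one, szDerivIter_add]
        exact hf)
      push_cast at this
      simp only
      linarith

theorem exists_lt_forall_family {R ε b : ℝ} {F : Set (Set (WeakDual 𝕜 X) × ℝ)} (hF : F.Finite)
    (hFc : ∀ P ∈ F, IsCompact P.1) {ξ : Ordinal.{v}} (hξ : Order.IsSuccLimit ξ) {x : X} {M δ : ℝ}
    (hδ : 0 < δ)
    (H : ∀ P ∈ F, ∀ f ∈ szDerivIter ε P.1 ξ, RCLike.re (f x) + P.2 + b * R ≤ M) :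
    ∃ η < ξ, ∀ P ∈ F, ∀ f ∈ szDerivIter ε P.1 η, RCLike.re (f x) + P.2 + b * R ≤ M + δ := by
  have key : ∀ P ∈ F, ∃ η < ξ, ∀ f ∈ szDerivIter ε P.1 η, RCLike.re (f x) < M + δ - P.2 - b * R :=
    fun P hP => exists_lt_forall_szDerivIter (hFc P hP) hξ fun f hf => by linarith [H P hP f hf]
  choose! η h1 h2 using key
  obtain ⟨ζ, hζ, hζ'⟩ : ∃ ζ < ξ, ∀ P ∈ F, η P ≤ ζ := by
    clear h2 H hFc
    induction F, hF using Set.Finite.induction_on with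
    | empty => exact ⟨0, hξ.bot_lt, by simp⟩
    | @insert P F _ _ ih =>
      obtain ⟨ζ, h3, h4⟩ := ih fun Q hQ => h1 Q (Set.mem_insert_of_mem _ hQ)
      refine ⟨max ζ (η P), max_lt h3 (h1 P (Set.mem_insert _ _)), ?_⟩
      rintro Q (rfl | hQ)
      · exact le_max_right _ _
      · exact (h4 Q hQ).trans (le_max_left _ _)
  exact ⟨ζ, hζ, fun P hP f hf => by
    linarith [h2 P hP f (szDerivIter_anti ε P.1 (hζ' P hP) hf)]⟩

/-- At a successor, by compactness the bound on the stage `ω^(ξ+1)` persists up to `δ` on some stage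
`ω^ξ m`. After subdivision, fewer than `m` derivations have negligible cost, and at least `m` of
them lead into that stage. -/
theorem domStep_op {R ε : ℝ} (hε : 0 ≤ ε) (hεR : ε ≤ R) (ξ : Ordinal.{v}) :
    DomStep 𝕜 R ε (ω ^ ξ) (op 𝕜 ξ (X := X)) := by
  have hR := hε.trans hεR
  induction ξ using Ordinal.limitRecOn with
  | zero =>
    intro F hF hFc hFb g hg hFg b hb
    rw [Ordinal.opow_zero, op_zero]
    exact domBy_baseOp hR hε hF hFc hFb hg hFg hb
  | add_one ξ ih =>
    intro F hF hFc hFb g hg hFg b hb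
    rw [domBy_stepFamily_one, op_add_one]
    intro x M H
    refine le_of_forall_pos_le_add fun δ hδ => ?_
    obtain ⟨η, hη, h1⟩ := exists_lt_forall_family hF hFc (isSuccLimit_opow_add_one ξ) hδ
      fun P hP => (H P hP).2
    obtain ⟨m, hm⟩ := exists_nat_of_lt_opow_add_one hη
    -- With this `N`, up to `m` short moves of gain `b R / (N + 1)` cost at most `δ` together.
    obtain ⟨N, hN⟩ := exists_nat_gt (m * (b * R) / δ)
    have hN0 : (0 : ℝ) < N + 1 := by positivity
    refine ((stepOp_op 𝕜 hR ξ).succOp_le hb hg N x).trans ?_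
    refine ih.opL (stepOp_op 𝕜 hR ξ) hF hFc hFb hg hFg (b := b / (N + 1)) (by positivity)
      (N + 1) x _ ?_
    intro Q hQ f hf
    obtain ⟨k, hk, P, hP, rfl⟩ : ∃ k ≤ N + 1, ∃ P ∈ F, (szDerivIter ε P.1 (ω ^ ξ * (k : Ordinal.{v})),
        P.2 + k * (b / (N + 1) * R) + ((N + 1 : ℕ) - k) * (b / (N + 1) * ε)) = Q := by
      simpa [stepFamily] using hQ
    have hk' : (k : ℝ) ≤ N + 1 := by exact_mod_cast hk
    simp only at hf ⊢
    have e1 : (k : ℝ) * (b / (N + 1) * R) + ((N + 1 : ℕ) - k) * (b / (N + 1) * ε) =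
        b * ε + k * (b / (N + 1)) * (R - ε) := by
      push_cast
      field_simp
      ring
    -- For `m ≤ k` the functional lies in the deep stage, and the total gain is at most `b R`. For
    -- `k < m` the excess over `b ε` is at most `δ`.
    rcases le_or_gt m k with hmk | hmk
    · have h2 := h1 P hP f (szDerivIter_anti ε P.1
        (hm.le.trans (mul_le_mul_right (by exact_mod_cast hmk) _)) hf)
      have h3 : (k : ℝ) * (b / (N + 1)) ≤ b := by
        rw [mul_div_assoc', div_le_iff₀ hN0, mul_comm]
        gcongr
      have h4 := mul_le_mul_of_nonneg_right h3 (sub_nonneg.2 hεR)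
      linarith
    · have h2 := (H P hP).1 f (szDerivIter_subset _ _ _ hf)
      have h3 : (k : ℝ) * (b / (N + 1)) * (R - ε) ≤ m * (b * R) / (N + 1) := by
        rw [mul_div_assoc', div_mul_eq_mul_div, mul_assoc]
        have : R - ε ≤ R := by linarith
        have : (0 : ℝ) ≤ R - ε := by linarith
        gcongr
      have h4 : m * (b * R) / (N + 1) ≤ δ := by
        rw [div_lt_iff₀ hδ] at hN
        rw [div_le_iff₀ hN0]
        nlinarith
      linarith
  | limit ξ hξ ih =>
    intro F hF hFc hFb g hg hFg b hb
    rw [domBy_stepFamily_one]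
    intro x M H
    refine le_of_forall_pos_le_add fun δ hδ => ?_
    obtain ⟨η, hη, h1⟩ := exists_lt_forall_family hF hFc
      (Ordinal.isSuccLimit_opow Ordinal.one_lt_omega0 hξ) hδ fun P hP => (H P hP).2
    obtain ⟨ζ, hζ, h2⟩ := (Ordinal.lt_opow_of_isSuccLimit Ordinal.omega0_ne_zero hξ).1 hη
    refine (op_limit_le 𝕜 hR hξ hζ hb hg x).trans ?_
    refine domBy_stepFamily_one.1 (ih _ (hξ.add_one_lt hζ) F hF hFc hFb g hg hFg b hb) x _ ?_
    intro P hP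
    refine ⟨fun f hf => by linarith [(H P hP).1 f hf], fun f hf => h1 P hP f ?_⟩
    refine szDerivIter_anti ε P.1 (h2.le.trans ?_) hf
    exact Ordinal.opow_le_opow_right Ordinal.omega0_pos (le_add_of_nonneg_right zero_le)

/-- Starting from `K` alone, only indices `k < n` contribute, because the later derived sets are
empty. Such an index gives `ε + k (R - ε) / (N + 1)`. -/
theorem opL_supportFun_le {R ε : ℝ} (hε : 0 ≤ ε) (hεR : ε ≤ R) (ξ : Ordinal.{v})
    {K : Set (WeakDual 𝕜 X)} (hK : IsCompact K) (hKb : DualBdd R K) (hne : K.Nonempty) {n : ℕ}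
    (hn : szDerivIter ε K (ω ^ ξ * (n : Ordinal.{v})) = ∅) (N : ℕ) :
    opL (op 𝕜 ξ) (List.replicate (N + 1) (1 / ((N : ℝ) + 1))) (supportFun K) 0 ≤
      ε + n * R / (N + 1) := by
  have hR := hε.trans hεR
  have hN0 : (0 : ℝ) < N + 1 := by positivity
  refine (domStep_op hε hεR ξ).opL (stepOp_op 𝕜 hR ξ) (Set.finite_singleton (K, (0 : ℝ)))
    (by simpa using hK) (by simpa using hKb) (hKb.isLip hR) ?_ (b := 1 / (N + 1)) (by positivity)
    (N + 1) 0 _ ?_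
  · intro x M H
    exact supportFun_le hne fun f hf => by simpa using H (K, 0) rfl f hf
  · intro Q hQ f hf
    obtain ⟨k, hk, rfl⟩ : ∃ k ≤ N + 1, (szDerivIter ε K (ω ^ ξ * (k : Ordinal.{v})),
        (0 : ℝ) + k * (1 / (N + 1) * R) + ((N + 1 : ℕ) - k) * (1 / (N + 1) * ε)) = Q := by
      simpa [stepFamily, eq_comm] using hQ
    have hkn : k < n := by
      by_contra! h
      have := szDerivIter_anti ε K
        (mul_le_mul_right (show (n : Ordinal.{v}) ≤ k by exact_mod_cast h) (ω ^ ξ)) hf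
      rw [hn] at this
      exact this
    have hkn' : (k : ℝ) ≤ n := by exact_mod_cast hkn.le
    have e1 : (0 : ℝ) + k * (1 / (N + 1) * R) + ((N + 1 : ℕ) - k) * (1 / (N + 1) * ε) =
        ε + k * (R - ε) / (N + 1) := by
      push_cast
      field_simp
      ring
    simp only [map_zero, zero_add] at e1 ⊢
    rw [e1]
    gcongr
    linarith

end Szlenk

/-! ### Combinatorics of the trees -/

section Trees

theorem mem_Gam_one {ξ : Ordinal.{v}} {t : List Ordinal.{v}} : t ∈ Gam ξ 1 ↔ t ∈ GammaOne ξ := by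
  constructor
  · intro h
    obtain ⟨i, hi⟩ := Set.mem_iUnion.1 h
    match i, hi with
    | 1, ⟨s, hs, e⟩ => simpa [shift, e] using hs
    | i + 2, ⟨s, _, r, hr, _⟩ => exact absurd hr (by simp [stackLevel])
  · intro h
    exact Set.mem_iUnion.2 ⟨1, t, h, by simp [shift]⟩

theorem Gam_one (ξ : Ordinal.{v}) : Gam ξ 1 = GammaOne ξ :=
  Set.ext fun _ => mem_Gam_one

theorem Gam_zero (ξ : Ordinal.{v}) : Gam ξ 0 = ∅ := by
  simp [Gam, stackTree, stackLevel]

theorem ne_nil_of_mem_Gam {ξ : Ordinal.{v}} {n : ℕ} {t : List Ordinal.{v}} (h : t ∈ Gam ξ n) :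
    t ≠ [] := by
  obtain ⟨c, hc⟩ := exists_hasWeight_iff.2 h
  exact hc.ne_nil

theorem ne_nil_of_mem_GammaOne {ξ : Ordinal.{v}} {t : List Ordinal.{v}} (h : t ∈ GammaOne ξ) :
    t ≠ [] :=
  ne_nil_of_mem_Gam (mem_Gam_one.2 h)

theorem lt_of_mem_Gam {ξ : Ordinal.{v}} {n : ℕ} {t : List Ordinal.{v}} (h : t ∈ Gam ξ n) :
    ∀ η ∈ t, η < ω ^ ξ * (n : Ordinal.{v}) := by
  obtain ⟨c, hc⟩ := exists_hasWeight_iff.2 h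
  exact hc.lt

theorem mem_Gam_add_one {ξ : Ordinal.{v}} {n : ℕ} {r : List Ordinal.{v}} :
    r ∈ Gam ξ (n + 1) ↔ (∃ t ∈ GammaOne ξ, r = shift (ω ^ ξ * (n : Ordinal.{v})) t) ∨
      ∃ t ∈ maxNodes (GammaOne ξ), ∃ s ∈ Gam ξ n,
        r = shift (ω ^ ξ * (n : Ordinal.{v})) t ++ s := by
  constructor
  · intro h
    obtain ⟨i, hi⟩ := Set.mem_iUnion.1 h
    match i, hi with
    | 1, ⟨t, ht, e⟩ => exact Or.inl ⟨t, ht, e⟩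
    | i + 2, ⟨t, ht, s, hs, e⟩ => exact Or.inr ⟨t, ht, s, Set.mem_iUnion.2 ⟨i + 1, hs⟩, e⟩
  · rintro (⟨t, ht, e⟩ | ⟨t, ht, s, hs, e⟩)
    · exact Set.mem_iUnion.2 ⟨1, t, ht, e⟩
    · obtain ⟨i, hi⟩ := Set.mem_iUnion.1 hs
      match i, hi with
      | 0, hi => simp [stackLevel] at hi
      | i + 1, hi => exact Set.mem_iUnion.2 ⟨i + 2, t, ht, s, hi, e⟩

/-- The entries of the shifted part are at least `β` and the others are below it, so a concatenation
determines its two parts. All uniqueness of decompositions in `Γ_{ξ,n+1}` rests on this. -/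
theorem filter_shift_append {β : Ordinal.{v}} (t : List Ordinal.{v}) {s : List Ordinal.{v}}
    (hs : ∀ η ∈ s, η < β) :
    (shift β t ++ s).filter (fun η => decide (β ≤ η)) = shift β t ∧
      (shift β t ++ s).filter (fun η => decide (¬ β ≤ η)) = s := by
  constructor
  · rw [List.filter_append, List.filter_eq_self.2, List.filter_eq_nil_iff.2, List.append_nil]
    · simpa using hs
    · simp [shift]
  · rw [List.filter_append, List.filter_eq_nil_iff.2, List.filter_eq_self.2, List.nil_append]
    · simpa using hs
    · simp [shift]

theorem shift_prefix_iff {β : Ordinal.{v}} {t t' : List Ordinal.{v}} :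
    shift β t <+: shift β t' ↔ t <+: t' :=
  List.prefix_map_iff_of_injective fun a b hab => by simpa using hab

theorem prefix_of_shift_append_prefix {β : Ordinal.{v}} {t t' s s' : List Ordinal.{v}}
    (hs : ∀ η ∈ s, η < β) (hs' : ∀ η ∈ s', η < β)
    (h : shift β t ++ s <+: shift β t' ++ s') : t <+: t' ∧ s <+: s' := by
  have h1 := h.filter (fun η => decide (β ≤ η))
  have h2 := h.filter (fun η => decide (¬ β ≤ η))
  rw [(filter_shift_append t hs).1, (filter_shift_append t' hs').1] at h1
  rw [(filter_shift_append t hs).2, (filter_shift_append t' hs').2] at h2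
  exact ⟨shift_prefix_iff.1 h1, h2⟩

theorem shift_append_inj {β : Ordinal.{v}} {t t' s s' : List Ordinal.{v}}
    (hs : ∀ η ∈ s, η < β) (hs' : ∀ η ∈ s', η < β)
    (h : shift β t ++ s = shift β t' ++ s') : t = t' ∧ s = s' := by
  have h1 := prefix_of_shift_append_prefix hs hs' ⟨[], by rw [List.append_nil, h]⟩
  have h2 := prefix_of_shift_append_prefix hs' hs ⟨[], by rw [List.append_nil, h]⟩
  exact ⟨h1.1.eq_of_length_le h2.1.length_le, h1.2.eq_of_length_le h2.2.length_le⟩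

/-- The first entry of a member of `Γ_{ξ,n}` lies in the interval from `ω^ξ (n - 1)` to `ω^ξ n`.
Thus the trees united in `Γ_{ξ+1,1}` are pairwise incomparable. -/
theorem eq_of_mem_Gam_of_head {ξ : Ordinal.{v}} {n m : ℕ} {t s : List Ordinal.{v}}
    (ht : t ∈ Gam ξ n) (hs : s ∈ Gam ξ m) (h : s.head? = t.head?) : n = m := by
  have bd : ∀ {n m : ℕ} {t s : List Ordinal.{v}}, t ∈ Gam ξ n → s ∈ Gam ξ m → s.head? = t.head? →
      n ≤ m := by
    intro n m t s ht hs h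
    by_contra! hlt
    obtain ⟨c, hc⟩ := exists_hasWeight_iff.2 ht
    obtain ⟨η, hη, hm⟩ := hc.le_head
    exact absurd (lt_of_mem_Gam hs η (List.mem_of_mem_head? (h ▸ hη))) (not_lt.2 (hm m hlt))
  exact le_antisymm (bd ht hs h) (bd hs ht h.symm)

theorem head?_eq_of_prefix {α : Type*} {s t : List α} (h : s <+: t) (hs : s ≠ []) :
    t.head? = s.head? := by
  obtain ⟨r, rfl⟩ := h
  rw [List.head?_append_of_ne_nil _ hs]

/-- The ordinal `ω^α + η` lies between `ω^α` and `ω^(α+1)`, which fixes `α`. This separates the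
trees united at a limit. -/
theorem eq_of_opow_add_eq {α β η η' : Ordinal.{v}} (hη : η < ω ^ (α + 1)) (hη' : η' < ω ^ (β + 1))
    (h : ω ^ α + η = ω ^ β + η') : α = β := by
  have bd : ∀ {α β η η' : Ordinal.{v}}, η' < ω ^ (β + 1) → ω ^ α + η = ω ^ β + η' → α ≤ β := by
    intro α β η η' h1 e
    by_contra! hlt
    have h2 : ω ^ β + η' < ω ^ (β + 1) := Ordinal.isPrincipal_add_omega0_opow _
      ((Ordinal.opow_lt_opow_iff_right Ordinal.one_lt_omega0).2 (by simp)) h1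
    have h3 : ω ^ (β + 1) ≤ ω ^ α :=
      Ordinal.opow_le_opow_right Ordinal.omega0_pos (Order.add_one_le_of_lt hlt)
    exact absurd (e ▸ h2) (not_lt.2 (h3.trans le_self_add))
  exact le_antisymm (bd hη' h) (bd hη h.symm)

theorem eq_of_mem_GammaOne_of_head {α β : Ordinal.{v}} {t s : List Ordinal.{v}}
    (ht : t ∈ GammaOne (α + 1)) (hs : s ∈ GammaOne (β + 1))
    (h : (shift (ω ^ β) s).head? = (shift (ω ^ α) t).head?) : α = β := by
  obtain ⟨η, l, rfl⟩ := List.exists_cons_of_ne_nil (ne_nil_of_mem_GammaOne ht)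
  obtain ⟨η', l', rfl⟩ := List.exists_cons_of_ne_nil (ne_nil_of_mem_GammaOne hs)
  refine eq_of_opow_add_eq (GammaOne_lt _ _ ht η (by simp)) (GammaOne_lt _ _ hs η' (by simp)) ?_
  simpa [shift] using h.symm

/-! ### Maximal nodes -/

theorem maxNodes_GammaOne_zero : maxNodes (GammaOne (0 : Ordinal.{v})) = {[0]} := by
  rw [GammaOne_zero]
  ext t
  simp only [maxNodes, Set.mem_ofPred_eq, Set.mem_singleton_iff, forall_eq]
  exact ⟨fun h => h.1, fun h => ⟨h, fun _ => h.symm⟩⟩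

theorem shift_append_mem_maxNodes {ξ : Ordinal.{v}} {n : ℕ} {t s : List Ordinal.{v}}
    (ht : t ∈ maxNodes (GammaOne ξ)) (hs : s ∈ maxNodes (Gam ξ n)) :
    shift (ω ^ ξ * (n : Ordinal.{v})) t ++ s ∈ maxNodes (Gam ξ (n + 1)) := by
  refine ⟨mem_Gam_add_one.2 (Or.inr ⟨t, ht, s, hs.1, rfl⟩), fun r hr h => ?_⟩
  rcases mem_Gam_add_one.1 hr with ⟨t', ht', rfl⟩ | ⟨t', ht', s', hs', rfl⟩
  · rw [← List.append_nil (shift _ t')] at h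
    have := (prefix_of_shift_append_prefix (lt_of_mem_Gam hs.1) (by simp) h).2
    exact absurd (List.prefix_nil.1 this) (ne_nil_of_mem_Gam hs.1)
  · obtain ⟨h1, h2⟩ := prefix_of_shift_append_prefix (lt_of_mem_Gam hs.1) (lt_of_mem_Gam hs') h
    rw [ht.2 t' ht'.1 h1, hs.2 s' hs' h2]

theorem mem_maxNodes_GammaOne_add_one {ξ : Ordinal.{v}} {n : ℕ} {t : List Ordinal.{v}}
    (ht : t ∈ Gam ξ n) : t ∈ maxNodes (GammaOne (ξ + 1)) ↔ t ∈ maxNodes (Gam ξ n) := by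
  rw [GammaOne_add_one]
  refine ⟨fun h => ⟨ht, fun s hs => h.2 s (Set.mem_iUnion.2 ⟨n, hs⟩)⟩,
    fun h => ⟨Set.mem_iUnion.2 ⟨n, ht⟩, fun s hs hp => ?_⟩⟩
  obtain ⟨m, hm⟩ := Set.mem_iUnion.1 hs
  obtain rfl := eq_of_mem_Gam_of_head ht hm (head?_eq_of_prefix hp (ne_nil_of_mem_Gam ht))
  exact h.2 s hm hp

theorem shift_mem_maxNodes_limit {ξ ζ : Ordinal.{v}} (hξ : Order.IsSuccLimit ξ) (hζ : ζ < ξ)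
    {t : List Ordinal.{v}} (ht : t ∈ GammaOne (ζ + 1)) :
    shift (ω ^ ζ) t ∈ maxNodes (GammaOne ξ) ↔ t ∈ maxNodes (GammaOne (ζ + 1)) := by
  rw [GammaOne_limit hξ]
  constructor
  · refine fun h => ⟨ht, fun s hs hp => ?_⟩
    exact shift_inj (h.2 _ ⟨ζ, hζ, s, hs, rfl⟩ (shift_prefix_iff.2 hp))
  · refine fun h => ⟨⟨ζ, hζ, t, ht, rfl⟩, ?_⟩
    rintro _ ⟨ζ', hζ', s, hs, rfl⟩ hp
    obtain rfl := eq_of_mem_GammaOne_of_head ht hs (head?_eq_of_prefix hp (by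
      simpa [shift] using ne_nil_of_mem_GammaOne ht))
    rw [h.2 s hs (shift_prefix_iff.1 hp)]

theorem exists_maxNodes_Gam_of_GammaOne {ξ : Ordinal.{v}} (hne : (GammaOne ξ).Nonempty)
    (H : ∀ t ∈ GammaOne ξ, ∃ m ∈ maxNodes (GammaOne ξ), t <+: m) (n : ℕ) :
    (Gam ξ (n + 1)).Nonempty ∧
      ∀ t ∈ Gam ξ (n + 1), ∃ m ∈ maxNodes (Gam ξ (n + 1)), t <+: m := by
  induction n with
  | zero =>
    rw [zero_add, Gam_one]
    exact ⟨hne, H⟩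
  | succ n ih =>
    obtain ⟨⟨s₀, hs₀⟩, ih⟩ := ih
    obtain ⟨m₀, hm₀, -⟩ := ih s₀ hs₀
    constructor
    · obtain ⟨t, ht⟩ := hne
      exact ⟨_, mem_Gam_add_one.2 (Or.inl ⟨t, ht, rfl⟩)⟩
    · intro r hr
      rcases mem_Gam_add_one.1 hr with ⟨t, ht, rfl⟩ | ⟨t, ht, s, hs, rfl⟩
      · obtain ⟨m, hm, htm⟩ := H t ht
        exact ⟨_, shift_append_mem_maxNodes hm hm₀,
          (shift_prefix_iff.2 htm).trans (List.prefix_append _ _)⟩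
      · obtain ⟨m, hm, hsm⟩ := ih s hs
        exact ⟨_, shift_append_mem_maxNodes ht hm, (List.prefix_append_right_inj _).2 hsm⟩

theorem exists_maxNodes_GammaOne (ξ : Ordinal.{v}) : (GammaOne ξ).Nonempty ∧
    ∀ t ∈ GammaOne ξ, ∃ m ∈ maxNodes (GammaOne ξ), t <+: m := by
  induction ξ using Ordinal.limitRecOn with
  | zero =>
    rw [maxNodes_GammaOne_zero, GammaOne_zero]
    simp
  | add_one ξ ih =>
    constructor
    · rw [GammaOne_add_one]
      obtain ⟨t, ht⟩ := ih.1
      exact ⟨t, Set.mem_iUnion.2 ⟨1, mem_Gam_one.2 ht⟩⟩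
    · intro t ht
      rw [GammaOne_add_one] at ht
      obtain ⟨n, hn⟩ := Set.mem_iUnion.1 ht
      cases n with
      | zero => simp [Gam_zero] at hn
      | succ n =>
        obtain ⟨m, hm, h⟩ := (exists_maxNodes_Gam_of_GammaOne ih.1 ih.2 n).2 t hn
        exact ⟨m, (mem_maxNodes_GammaOne_add_one hm.1).2 hm, h⟩
  | limit ξ hξ ih =>
    constructor
    · rw [GammaOne_limit hξ]
      obtain ⟨t, ht⟩ := (ih (0 + 1) (hξ.add_one_lt hξ.bot_lt)).1
      exact ⟨_, 0, hξ.bot_lt, t, ht, rfl⟩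
    · intro t ht
      rw [GammaOne_limit hξ] at ht
      obtain ⟨ζ, hζ, s, hs, rfl⟩ := ht
      obtain ⟨m, hm, h⟩ := (ih _ (hξ.add_one_lt hζ)).2 s hs
      exact ⟨_, (shift_mem_maxNodes_limit hξ hζ hm.1).2 hm, shift_prefix_iff.2 h⟩

theorem maxNodes_Gam_nonempty (ξ : Ordinal.{v}) (n : ℕ) : (maxNodes (Gam ξ (n + 1))).Nonempty := by
  obtain ⟨h1, h2⟩ := exists_maxNodes_GammaOne ξ
  obtain ⟨⟨t, ht⟩, h⟩ := exists_maxNodes_Gam_of_GammaOne h1 h2 n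
  obtain ⟨m, hm, -⟩ := h t ht
  exact ⟨m, hm⟩

/-- A member of the first level is never maximal here: it extends to a maximal member of that level,
above which `Γ_{ξ,n+1}` still stands. -/
theorem exists_of_mem_maxNodes_Gam {ξ : Ordinal.{v}} {n : ℕ} {r : List Ordinal.{v}}
    (hr : r ∈ maxNodes (Gam ξ (n + 2))) : ∃ t ∈ maxNodes (GammaOne ξ),
      ∃ s ∈ maxNodes (Gam ξ (n + 1)), r = shift (ω ^ ξ * ((n + 1 : ℕ) : Ordinal.{v})) t ++ s := by
  rcases mem_Gam_add_one.1 hr.1 with ⟨t, ht, rfl⟩ | ⟨t, ht, s, hs, rfl⟩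
  · obtain ⟨m, hm, htm⟩ := (exists_maxNodes_GammaOne ξ).2 t ht
    obtain ⟨s, hs⟩ := maxNodes_Gam_nonempty ξ n
    have := hr.2 _ (mem_Gam_add_one.2 (Or.inr ⟨m, hm, s, hs.1, rfl⟩))
      ((shift_prefix_iff.2 htm).trans (List.prefix_append _ _))
    rw [← List.append_nil (shift _ t)] at this
    exact absurd (shift_append_inj (lt_of_mem_Gam hs.1) (by simp) this).2
      (ne_nil_of_mem_Gam hs.1)
  · refine ⟨t, ht, s, ⟨hs, fun s' hs' h => ?_⟩, rfl⟩
    exact List.append_cancel_left (hr.2 _ (mem_Gam_add_one.2 (Or.inr ⟨t, ht, s', hs', rfl⟩))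
      ((List.prefix_append_right_inj _).2 h))

theorem mem_maxNodes_prodTree {T : Set (List Ordinal.{v})} {D : Type u} [Nonempty D]
    {t : List (Ordinal.{v} × D)} :
    t ∈ maxNodes (prodTree T D) ↔ t.map Prod.fst ∈ maxNodes T := by
  constructor
  · refine fun h => ⟨h.1, ?_⟩
    rintro _ hs ⟨r, rfl⟩
    -- An extension in the ordinal tree is lifted to the product tree by filling the new second
    -- coordinates arbitrarily.
    let d : D := Classical.arbitrary D
    have e : (t ++ r.map fun η => (η, d)).map Prod.fst = t.map Prod.fst ++ r := by
      simp [Function.comp_def]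
    have := h.2 (t ++ r.map fun η => (η, d)) (by
      change List.map Prod.fst _ ∈ T
      rwa [e]) (List.prefix_append _ _)
    rw [← e, this]
  · refine fun h => ⟨h.1, fun s hs hp => ?_⟩
    have := h.2 _ hs (hp.map Prod.fst)
    refine (hp.eq_of_length ?_).symm
    rw [← List.length_map Prod.fst, ← this, List.length_map]

/-! ### Levels and weights -/

theorem weight_eq {ξ : Ordinal.{v}} {n : ℕ} {t : List Ordinal.{v}} {c : ℝ}
    (h : HasWeight ξ n t c) : weight ξ n t = c := by
  have h' : ∃ c, HasWeight ξ n t c := ⟨c, h⟩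
  rw [weight, dif_pos h']
  exact h'.choose_spec.unique h

theorem hasWeight_weight {ξ : Ordinal.{v}} {n : ℕ} {t : List Ordinal.{v}} (h : t ∈ Gam ξ n) :
    HasWeight ξ n t (weight ξ n t) := by
  obtain ⟨c, hc⟩ := exists_hasWeight_iff.2 h
  rwa [weight_eq hc]

theorem Lam_subset (ξ : Ordinal.{v}) (n i : ℕ) : Lam ξ n i ⊆ Gam ξ n :=
  fun _ h => Set.mem_iUnion.2 ⟨i, h⟩

theorem shift_mem_Lam_one {ξ : Ordinal.{v}} {n : ℕ} {t : List Ordinal.{v}} :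
    shift (ω ^ ξ * (n : Ordinal.{v})) t ∈ Lam ξ (n + 1) 1 ↔ t ∈ GammaOne ξ := by
  constructor
  · rintro ⟨t', ht', e⟩
    rwa [shift_inj e]
  · exact fun h => ⟨t, h, rfl⟩

theorem mem_Lam_one_one {ξ : Ordinal.{v}} {t : List Ordinal.{v}} :
    t ∈ Lam ξ 1 1 ↔ t ∈ GammaOne ξ := by
  simpa [shift] using shift_mem_Lam_one (ξ := ξ) (n := 0) (t := t)

theorem shift_notMem_Lam {ξ : Ordinal.{v}} {n i : ℕ} {t : List Ordinal.{v}} :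
    shift (ω ^ ξ * (n : Ordinal.{v})) t ∉ Lam ξ (n + 1) (i + 2) := by
  rintro ⟨t', _, s, hs, e⟩
  rw [← List.append_nil (shift _ t)] at e
  have hs' := Lam_subset _ _ _ hs
  exact ne_nil_of_mem_Gam hs' (shift_append_inj (by simp) (lt_of_mem_Gam hs') e).2.symm

theorem shift_append_notMem_Lam {ξ : Ordinal.{v}} {n : ℕ} {t s : List Ordinal.{v}} (hs : s ≠ [])
    (hs' : ∀ η ∈ s, η < ω ^ ξ * (n : Ordinal.{v})) :
    shift (ω ^ ξ * (n : Ordinal.{v})) t ++ s ∉ Lam ξ (n + 1) 1 := by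
  rintro ⟨t', _, e⟩
  rw [← List.append_nil (shift _ t')] at e
  exact hs (shift_append_inj hs' (by simp) e).2

theorem shift_append_mem_Lam {ξ : Ordinal.{v}} {n i : ℕ} {t s : List Ordinal.{v}}
    (ht : t ∈ maxNodes (GammaOne ξ)) (hs' : ∀ η ∈ s, η < ω ^ ξ * (n : Ordinal.{v})) :
    shift (ω ^ ξ * (n : Ordinal.{v})) t ++ s ∈ Lam ξ (n + 1) (i + 2) ↔ s ∈ Lam ξ n (i + 1) := by
  constructor
  · rintro ⟨t', _, s', hs, e⟩
    rwa [(shift_append_inj hs' (lt_of_mem_Gam (Lam_subset _ _ _ hs)) e).2]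
  · exact fun h => ⟨t, ht, s, h, rfl⟩

open Classical in
/-- The weight of a sequence, counted on a single level. -/
def coef (ξ : Ordinal.{v}) (n i : ℕ) (s : List Ordinal.{v}) : ℝ :=
  if s ∈ Lam ξ n i then weight ξ n s else 0

theorem coef_one_one {ξ : Ordinal.{v}} {s : List Ordinal.{v}} :
    coef ξ 1 1 s = weight ξ 1 s := by
  by_cases h : s ∈ Lam ξ 1 1
  · exact if_pos h
  rw [coef, if_neg h]
  symm
  rw [weight, dif_neg]
  rwa [exists_hasWeight_iff, mem_Gam_one, ← mem_Lam_one_one]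

theorem coef_shift_one {ξ : Ordinal.{v}} {n : ℕ} {t : List Ordinal.{v}} :
    coef ξ (n + 1) 1 (shift (ω ^ ξ * (n : Ordinal.{v})) t) = coef ξ 1 1 t := by
  by_cases h : t ∈ GammaOne ξ
  swap
  · rw [coef, coef, if_neg (by rwa [shift_mem_Lam_one]), if_neg (by rwa [mem_Lam_one_one])]
  rw [coef, coef, if_pos (shift_mem_Lam_one.2 h), if_pos (mem_Lam_one_one.2 h)]
  have hw := hasWeight_weight (mem_Gam_one.2 h)
  rcases Nat.eq_zero_or_pos n with rfl | hn
  · simp [shift]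
  · exact weight_eq (.head hn hw)

theorem coef_shift_add_two {ξ : Ordinal.{v}} {n i : ℕ} {t : List Ordinal.{v}} :
    coef ξ (n + 1) (i + 2) (shift (ω ^ ξ * (n : Ordinal.{v})) t) = 0 :=
  if_neg shift_notMem_Lam

theorem coef_shift_append_one {ξ : Ordinal.{v}} {n : ℕ} {t s : List Ordinal.{v}} (hs : s ≠ [])
    (hs' : ∀ η ∈ s, η < ω ^ ξ * (n : Ordinal.{v})) :
    coef ξ (n + 1) 1 (shift (ω ^ ξ * (n : Ordinal.{v})) t ++ s) = 0 :=
  if_neg (shift_append_notMem_Lam hs hs')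

theorem coef_shift_append_add_two {ξ : Ordinal.{v}} {n i : ℕ} {t s : List Ordinal.{v}}
    (ht : t ∈ maxNodes (GammaOne ξ)) (hs' : ∀ η ∈ s, η < ω ^ ξ * (n : Ordinal.{v})) :
    coef ξ (n + 1) (i + 2) (shift (ω ^ ξ * (n : Ordinal.{v})) t ++ s) = coef ξ n (i + 1) s := by
  by_cases h : s ∈ Lam ξ n (i + 1)
  swap
  · rw [coef, coef, if_neg (by rwa [shift_append_mem_Lam ht hs']), if_neg h]
  rw [coef, coef, if_pos ((shift_append_mem_Lam ht hs').2 h), if_pos h]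
  have hw := hasWeight_weight (Lam_subset _ _ _ h)
  exact weight_eq (.tail hw.one_le ht hw)

-- The levels partition the tree, so a weight is the sum of its parts counted level by level.
open Classical in
theorem sum_Lam_indicator {ξ : Ordinal.{v}} {n : ℕ} {s : List Ordinal.{v}} (hs : s ∈ Gam ξ n) :
    ∑ i : Fin n, (if s ∈ Lam ξ n (i + 1) then (1 : ℝ) else 0) = 1 := by
  induction n generalizing s with
  | zero => simp [Gam_zero] at hs
  | succ n ih =>
    rw [Fin.sum_univ_succ]
    simp only [Fin.val_zero, zero_add, Fin.val_succ, add_assoc, one_add_one_eq_two]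
    rcases mem_Gam_add_one.1 hs with ⟨t, ht, rfl⟩ | ⟨t, ht, s, hs', rfl⟩
    · simp only [shift_mem_Lam_one, shift_notMem_Lam]
      simp [ht]
    · simp only [shift_append_mem_Lam ht (lt_of_mem_Gam hs'),
        shift_append_notMem_Lam (ne_nil_of_mem_Gam hs') (lt_of_mem_Gam hs'), ih hs']
      simp

/-- A common first entry forces `s` to belong to the same `Γ_{ξ,n}` as `t` if it belongs to
`Γ_{ξ+1,1}` at all. Otherwise both sides vanish. -/
theorem coef_add_one {ξ : Ordinal.{v}} {n : ℕ} {t s : List Ordinal.{v}} (ht : t ∈ Gam ξ n)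
    (h : t.head? = s.head?) :
    coef (ξ + 1) 1 1 s = ∑ i : Fin n, (1 / n : ℝ) * coef ξ n (i + 1) s := by
  classical
  by_cases hs : s ∈ Gam ξ n
  · have e : ∀ i : Fin n, (1 / n : ℝ) * coef ξ n (i + 1) s =
        (weight ξ n s / n) * (if s ∈ Lam ξ n (i + 1) then (1 : ℝ) else 0) := by
      intro i
      rw [coef]
      split_ifs <;> ring
    rw [Finset.sum_congr rfl fun i _ => e i, ← Finset.mul_sum, sum_Lam_indicator hs, mul_one,
      coef_one_one, weight_eq (.succ (hasWeight_weight hs))]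
  · rw [Finset.sum_eq_zero, coef, if_neg]
    · rw [mem_Lam_one_one, GammaOne_add_one, Set.mem_iUnion]
      rintro ⟨m, hm⟩
      rw [eq_of_mem_Gam_of_head hm ht h] at hm
      exact hs hm
    · intro i _
      rw [coef, if_neg fun h => hs (Lam_subset _ _ _ h), mul_zero]

theorem coef_limit {ξ ζ : Ordinal.{v}} (hξ : Order.IsSuccLimit ξ) (hζ : ζ < ξ)
    {t s : List Ordinal.{v}} (ht : t ∈ GammaOne (ζ + 1)) (h : t.head? = s.head?) :
    coef ξ 1 1 (shift (ω ^ ζ) s) = coef (ζ + 1) 1 1 s := by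
  by_cases hs : s ∈ GammaOne (ζ + 1)
  · rw [coef_one_one, coef_one_one]
    exact weight_eq (.limit hξ hζ (hasWeight_weight (mem_Gam_one.2 hs)))
  · rw [coef, coef, if_neg, if_neg]
    · rwa [mem_Lam_one_one]
    · rw [mem_Lam_one_one, GammaOne_limit hξ]
      rintro ⟨ζ', hζ', s', hs', e⟩
      obtain rfl := eq_of_mem_GammaOne_of_head ht hs' (by rw [← e]; simp [shift, h])
      rw [shift_inj e] at hs
      exact hs hs'

end Trees

/-! ### Sums along branches -/

section Paths

variable {D : Type u}

/-- The translation of the ordinals in a sequence of pairs. -/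
def shiftD (β : Ordinal.{v}) (t : List (Ordinal.{v} × D)) : List (Ordinal.{v} × D) :=
  t.map fun p => (β + p.1, p.2)

/-- The inverse of `shiftD`. -/
def unshiftD (β : Ordinal.{v}) (t : List (Ordinal.{v} × D)) : List (Ordinal.{v} × D) :=
  t.map fun p => (p.1 - β, p.2)

theorem map_fst_shiftD (β : Ordinal.{v}) (t : List (Ordinal.{v} × D)) :
    (shiftD β t).map Prod.fst = shift β (t.map Prod.fst) := by
  simp [shiftD, shift]

theorem unshiftD_shiftD (β : Ordinal.{v}) (t : List (Ordinal.{v} × D)) :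
    unshiftD β (shiftD β t) = t := by
  simp [shiftD, unshiftD, Function.comp_def]

theorem exists_shiftD_eq {β : Ordinal.{v}} {t : List (Ordinal.{v} × D)} {r : List Ordinal.{v}}
    (h : t.map Prod.fst = shift β r) : ∃ s : List (Ordinal.{v} × D),
      s.map Prod.fst = r ∧ t = shiftD β s := by
  induction t generalizing r with
  | nil =>
    refine ⟨[], ?_, rfl⟩
    simpa [shift] using h.symm
  | cons p t ih =>
    cases r with
    | nil => simp [shift] at h
    | cons η r =>
      simp only [shift, List.map_cons, List.cons.injEq] at h
      obtain ⟨s, rfl, rfl⟩ := ih h.2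
      exact ⟨(η, p.2) :: s, rfl, by simp [shiftD, ← h.1]⟩

theorem exists_shiftD_append_eq {β : Ordinal.{v}} {t : List (Ordinal.{v} × D)}
    {r r' : List Ordinal.{v}} (h : t.map Prod.fst = shift β r ++ r') :
    ∃ s s' : List (Ordinal.{v} × D), s.map Prod.fst = r ∧ s'.map Prod.fst = r' ∧
      t = shiftD β s ++ s' := by
  obtain ⟨l₁, l₂, rfl, h1, h2⟩ := List.map_eq_append_iff.1 h
  obtain ⟨s, hs, rfl⟩ := exists_shiftD_eq h1
  exact ⟨s, l₂, hs, h2, rfl⟩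

theorem shiftD_append_inj {β : Ordinal.{v}} {t t' s s' : List (Ordinal.{v} × D)}
    (hs : ∀ η ∈ s.map Prod.fst, η < β) (hs' : ∀ η ∈ s'.map Prod.fst, η < β)
    (h : shiftD β t ++ s = shiftD β t' ++ s') : t = t' ∧ s = s' := by
  have h1 := congrArg (List.map Prod.fst) h
  rw [List.map_append, List.map_append, map_fst_shiftD, map_fst_shiftD] at h1
  have h2 := congrArg List.length (shift_append_inj hs hs' h1).1
  obtain ⟨h3, h4⟩ := List.append_inj h (by simpa [shiftD] using h2)
  refine ⟨?_, h4⟩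
  rw [← unshiftD_shiftD β t, h3, unshiftD_shiftD]

variable {X : Type u} [AddCommGroup X]

/-- The sum of `F` over the non-empty initial segments of a sequence. -/
def pathSum {α : Type*} (F : List α → X) (t : List α) : X :=
  (t.inits.tail.map F).sum

theorem mem_inits_tail {α : Type*} {s t : List α} (h : s ∈ t.inits.tail) : s ≠ [] ∧ s <+: t := by
  refine ⟨?_, (List.mem_inits _ _).1 (List.mem_of_mem_tail h)⟩
  cases t with
  | nil => simp at h
  | cons a l =>
    rw [List.inits_cons, List.tail_cons] at h
    obtain ⟨r, -, rfl⟩ := List.mem_map.1 h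
    simp

theorem pathSum_congr {α : Type*} {F G : List α → X} {t : List α}
    (h : ∀ s, s ≠ [] → s <+: t → F s = G s) : pathSum F t = pathSum G t := by
  rw [pathSum, pathSum, List.map_congr_left]
  intro s hs
  obtain ⟨h1, h2⟩ := mem_inits_tail hs
  exact h s h1 h2

theorem pathSum_eq_zero {α : Type*} {F : List α → X} {t : List α}
    (h : ∀ s, s ≠ [] → s <+: t → F s = 0) : pathSum F t = 0 := by
  rw [pathSum_congr h]
  simp [pathSum]

theorem pathSum_append {α : Type*} (F : List α → X) (t s : List α) :
    pathSum F (t ++ s) = pathSum F t + pathSum (fun r => F (t ++ r)) s := by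
  rw [pathSum, List.inits_append, List.tail_append_of_ne_nil (by cases t <;> simp),
    List.map_append, List.sum_append, List.map_map]
  rfl

theorem pathSum_shiftD (β : Ordinal.{v}) (F : List (Ordinal.{v} × D) → X)
    (t : List (Ordinal.{v} × D)) : pathSum F (shiftD β t) = pathSum (fun r => F (shiftD β r)) t := by
  rw [pathSum, shiftD, List.map_inits, ← List.map_tail, List.map_map]
  rfl

theorem nodup_inits {α : Type*} (t : List α) : t.inits.Nodup := by
  induction t with
  | nil => simp
  | cons a t ih =>
    rw [List.inits_cons, List.nodup_cons]
    exact ⟨by simp, ih.map fun _ _ h => by simpa using h⟩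

end Paths

/-! ### Recursion for the block sums along the trees -/

section Blocks

variable {𝕜 : Type w} [RCLike 𝕜] {X : Type u} [NormedAddCommGroup X] [NormedSpace 𝕜 X] {D : Type u}

theorem coef_nil (ξ : Ordinal.{v}) (n i : ℕ) : coef ξ n i [] = 0 :=
  if_neg fun h => ne_nil_of_mem_Gam (Lam_subset _ _ _ h) rfl

/-- Path sums split along concatenations and shifts, unlike the filtered finite set sum. The empty
initial segment has coefficient `0` and may be dropped. -/
theorem blockSum_eq_pathSum (ξ : Ordinal.{v}) (n : ℕ) (x : List (Ordinal.{v} × D) → X)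
    (t : List (Ordinal.{v} × D)) (i : ℕ) :
    blockSum 𝕜 ξ n x t i =
      pathSum (fun s => ((coef ξ n i (s.map Prod.fst) : ℝ) : 𝕜) • x s) t := by
  classical
  have h1 : blockSum 𝕜 ξ n x t i = ∑ s ∈ t.inits.toFinset,
      ((coef ξ n i (s.map Prod.fst) : ℝ) : 𝕜) • x s := by
    rw [blockSum, Finset.sum_filter]
    refine Finset.sum_congr (by congr) fun s _ => ?_
    by_cases h : s ∈ prodTree (Lam ξ n i) D
    · rw [if_pos h, coef, if_pos (show s.map Prod.fst ∈ Lam ξ n i from h)]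
    · rw [if_neg h, coef, if_neg (show s.map Prod.fst ∉ Lam ξ n i from h)]
      simp
  rw [h1, List.sum_toFinset _ (nodup_inits t), pathSum]
  cases t with
  | nil => simp [coef_nil]
  | cons a t => simp [coef_nil]

/-- The vector `∑ a_i z_i^t`. -/
def combo (ξ : Ordinal.{v}) (n : ℕ) (x : List (Ordinal.{v} × D) → X) (a : Fin n → 𝕜)
    (t : List (Ordinal.{v} × D)) : X :=
  ∑ i : Fin n, a i • blockSum 𝕜 ξ n x t (i + 1)

theorem blockSum_congr {ξ : Ordinal.{v}} {n : ℕ} {x y : List (Ordinal.{v} × D) → X}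
    {t : List (Ordinal.{v} × D)} (h : ∀ s, s.map Prod.fst ∈ Gam ξ n → s <+: t → x s = y s) (i : ℕ) :
    blockSum 𝕜 ξ n x t i = blockSum 𝕜 ξ n y t i := by
  rw [blockSum_eq_pathSum, blockSum_eq_pathSum]
  refine pathSum_congr fun s _ hs => ?_
  by_cases h' : s.map Prod.fst ∈ Gam ξ n
  · rw [h s h' hs]
  · rw [coef, if_neg fun h => h' (Lam_subset _ _ _ h)]
    simp

theorem lt_of_prefix {β : Ordinal.{v}} {s r : List (Ordinal.{v} × D)}
    (hs : ∀ η ∈ s.map Prod.fst, η < β) (h : r <+: s) : ∀ η ∈ r.map Prod.fst, η < β :=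
  fun η hη => hs η ((h.map Prod.fst).mem hη)

/-- This matches `opL_cons`: the first block is the first move, and the remaining blocks form a
combination for the collection above it. -/
theorem combo_shiftD_append {ξ : Ordinal.{v}} {n : ℕ} (x : List (Ordinal.{v} × D) → X)
    (a : Fin (n + 1) → 𝕜) {t s : List (Ordinal.{v} × D)}
    (ht : t.map Prod.fst ∈ maxNodes (GammaOne ξ)) (hs : s.map Prod.fst ∈ Gam ξ n) :
    combo ξ (n + 1) x a (shiftD (ω ^ ξ * (n : Ordinal.{v})) t ++ s) =
      a 0 • blockSum 𝕜 ξ 1 (fun r => x (shiftD (ω ^ ξ * (n : Ordinal.{v})) r)) t 1 +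
        combo ξ n (fun r => x (shiftD (ω ^ ξ * (n : Ordinal.{v})) t ++ r)) (fun i => a i.succ) s := by
  rw [combo, Fin.sum_univ_succ, combo]
  have hlt := lt_of_mem_Gam hs
  congr 1
  · congr 1
    rw [blockSum_eq_pathSum, blockSum_eq_pathSum, pathSum_append, pathSum_shiftD]
    rw [pathSum_eq_zero (t := s), add_zero]
    · refine pathSum_congr fun r _ _ => ?_
      rw [map_fst_shiftD]
      exact congrArg (fun c : ℝ => (c : 𝕜) • _) coef_shift_one
    · intro r hr hrs
      rw [List.map_append, map_fst_shiftD]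
      refine smul_eq_zero_of_left ?_ _
      exact RCLike.ofReal_eq_zero.2 (coef_shift_append_one (by simpa using hr)
        (lt_of_prefix hlt hrs))
  · refine Finset.sum_congr rfl fun i _ => ?_
    congr 1
    rw [blockSum_eq_pathSum, blockSum_eq_pathSum, pathSum_append, pathSum_shiftD]
    rw [pathSum_eq_zero (t := t), zero_add]
    · refine pathSum_congr fun r _ hrs => ?_
      rw [List.map_append, map_fst_shiftD]
      exact congrArg (fun c : ℝ => (c : 𝕜) • _)
        (coef_shift_append_add_two ht (lt_of_prefix hlt hrs))
    · intro r _ _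
      rw [map_fst_shiftD]
      exact smul_eq_zero_of_left (RCLike.ofReal_eq_zero.2 coef_shift_add_two) _

theorem combo_one {ξ : Ordinal.{v}} (x : List (Ordinal.{v} × D) → X) (a : Fin 1 → 𝕜)
    (t : List (Ordinal.{v} × D)) : combo ξ 1 x a t = a 0 • blockSum 𝕜 ξ 1 x t 1 := by
  simp [combo]

theorem blockSum_zero (x : List (Ordinal.{v} × D) → X) (d : D) :
    blockSum 𝕜 (0 : Ordinal.{v}) 1 x [(0, d)] 1 = x [(0, d)] := by
  rw [blockSum_eq_pathSum]
  simp [pathSum, coef_one_one, weight_eq HasWeight.zero]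

/-- This matches `succOp`: on a branch in `Γ_{ξ,n}`, one block of stage `ξ + 1` is the average of
`n` blocks of stage `ξ`. -/
theorem smul_blockSum_add_one {ξ : Ordinal.{v}} {n : ℕ} (x : List (Ordinal.{v} × D) → X) (a : 𝕜)
    {t : List (Ordinal.{v} × D)} (ht : t.map Prod.fst ∈ Gam ξ n) :
    a • blockSum 𝕜 (ξ + 1) 1 x t 1 = combo ξ n x (fun _ => a / n) t := by
  have h1 : blockSum 𝕜 (ξ + 1) 1 x t 1 = ∑ i : Fin n, (1 / n : 𝕜) • blockSum 𝕜 ξ n x t (i + 1) := by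
    have h2 : ∀ i : Fin n, (1 / n : 𝕜) • blockSum 𝕜 ξ n x t (i + 1) = pathSum (fun s =>
        ((1 / n : 𝕜) * ((coef ξ n (i + 1) (s.map Prod.fst) : ℝ) : 𝕜)) • x s) t := by
      intro i
      rw [blockSum_eq_pathSum, pathSum, pathSum, List.smul_sum, List.map_map]
      simp [Function.comp_def, smul_smul]
    rw [Finset.sum_congr rfl fun i _ => h2 i, blockSum_eq_pathSum]
    have h3 : ∀ F : Fin n → List (Ordinal.{v} × D) → X,
        ∑ i, pathSum (F i) t = pathSum (fun s => ∑ i, F i s) t := by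
      intro F
      simp only [pathSum]
      induction t.inits.tail with
      | nil => simp
      | cons a l ih => simp [Finset.sum_add_distrib, ih]
    rw [h3]
    refine pathSum_congr fun s hs hst => ?_
    rw [← Finset.sum_smul, coef_add_one ht
      (head?_eq_of_prefix (hst.map Prod.fst) (by simpa using hs))]
    push_cast
    rfl
  rw [h1, Finset.smul_sum, combo]
  refine Finset.sum_congr rfl fun i _ => ?_
  rw [smul_smul, mul_one_div]

theorem blockSum_shiftD_limit {ξ ζ : Ordinal.{v}} (hξ : Order.IsSuccLimit ξ) (hζ : ζ < ξ)
    (x : List (Ordinal.{v} × D) → X) {t : List (Ordinal.{v} × D)}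
    (ht : t.map Prod.fst ∈ GammaOne (ζ + 1)) :
    blockSum 𝕜 ξ 1 x (shiftD (ω ^ ζ) t) 1 =
      blockSum 𝕜 (ζ + 1) 1 (fun r => x (shiftD (ω ^ ζ) r)) t 1 := by
  rw [blockSum_eq_pathSum, blockSum_eq_pathSum, pathSum_shiftD]
  refine pathSum_congr fun s hs hst => ?_
  rw [map_fst_shiftD, coef_limit hξ hζ ht
    (head?_eq_of_prefix (hst.map Prod.fst) (by simpa using hs))]

end Blocks

/-! ### The operators bound the infima over the trees -/

section Upper

variable {𝕜 : Type w} [RCLike 𝕜] {X : Type u} [NormedAddCommGroup X] [NormedSpace 𝕜 X]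
  {D : Type u} [Preorder D]

/-- A weakly null collection in the unit ball. -/
def IsBallTree (𝕜 : Type w) [RCLike 𝕜] {X : Type u} [NormedAddCommGroup X] [NormedSpace 𝕜 X]
    {D : Type u} [Preorder D] (T : Set (List Ordinal.{v})) (x : List (Ordinal.{v} × D) → X) : Prop :=
  (∀ t ∈ prodTree T D, ‖x t‖ ≤ 1) ∧ IsWeaklyNull 𝕜 T x

theorem IsBallTree.subset {T T' : Set (List Ordinal.{v})} {x : List (Ordinal.{v} × D) → X}
    (h : IsBallTree 𝕜 T x) (hT : T' ⊆ T) : IsBallTree 𝕜 T' x :=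
  ⟨fun t ht => h.1 t (hT ht), fun t ζ ht => h.2 t ζ (hT ht)⟩

theorem IsBallTree.shiftD {T T' : Set (List Ordinal.{v})} {x : List (Ordinal.{v} × D) → X}
    (h : IsBallTree 𝕜 T x) (β : Ordinal.{v}) (hT : ∀ t ∈ T', shift β t ∈ T) :
    IsBallTree 𝕜 T' fun r => x (SzlenkSum.shiftD β r) := by
  constructor
  · intro t ht
    refine h.1 _ ?_
    change (SzlenkSum.shiftD β t).map Prod.fst ∈ T
    rw [map_fst_shiftD]
    exact hT _ ht
  · intro t ζ ht f
    have e : ∀ d : D, SzlenkSum.shiftD β (t ++ [(ζ, d)]) =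
        SzlenkSum.shiftD β t ++ [(β + ζ, d)] := fun d => by simp [SzlenkSum.shiftD]
    simp only [e]
    refine h.2 _ _ ?_ f
    rw [map_fst_shiftD]
    simpa [shift] using hT _ ht

theorem IsBallTree.append {T T' : Set (List Ordinal.{v})} {x : List (Ordinal.{v} × D) → X}
    (h : IsBallTree 𝕜 T x) (s : List (Ordinal.{v} × D))
    (hT : ∀ t ∈ T', s.map Prod.fst ++ t ∈ T) : IsBallTree 𝕜 T' fun r => x (s ++ r) := by
  constructor
  · intro t ht
    refine h.1 _ ?_
    change (s ++ t).map Prod.fst ∈ T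
    rw [List.map_append]
    exact hT _ ht
  · intro t ζ ht f
    simp only [← List.append_assoc]
    refine h.2 _ _ ?_ f
    rw [List.map_append, List.append_assoc]
    exact hT _ ht

theorem exists_phase (a : 𝕜) : ∃ σ : 𝕜, ‖σ‖ = 1 ∧ ((‖a‖ : ℝ) : 𝕜) * σ = a := by
  by_cases ha : a = 0
  · exact ⟨1, by simp, by simp [ha]⟩
  · have h : ((‖a‖ : ℝ) : 𝕜) ≠ 0 := by simpa using ha
    exact ⟨a / (‖a‖ : ℝ), by simp [ha], by field_simp⟩

/-- The operator `op 𝕜 ξ` bounds the infimum over the branches of any collection on `Γ_{ξ,1}.D`. -/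
def UpperAt (𝕜 : Type w) [RCLike 𝕜] (X : Type u) [NormedAddCommGroup X] [NormedSpace 𝕜 X]
    (D : Type u) [Preorder D] (R : ℝ) (ξ : Ordinal.{v}) : Prop :=
  ∀ x : List (Ordinal.{v} × D) → X, IsBallTree 𝕜 (GammaOne ξ) x → ∀ (a : 𝕜) (g : X → ℝ),
    IsLip R g → ∀ (x₀ : X) (c : ℝ), op 𝕜 ξ ‖a‖ g x₀ < c →
      ∃ t : List (Ordinal.{v} × D), t.map Prod.fst ∈ maxNodes (GammaOne ξ) ∧
        g (x₀ + a • blockSum 𝕜 ξ 1 x t 1) < c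

theorem nonneg_of_mem_ofFn_norm {n : ℕ} (a : Fin n → 𝕜) :
    ∀ b ∈ List.ofFn (fun i => ‖a i‖), 0 ≤ b := by
  intro b hb
  obtain ⟨i, rfl⟩ := (List.mem_ofFn' _ _).1 hb
  exact norm_nonneg _

/-- The branch is built level by level: the first block is chosen against the operator value of the
remaining moves, which is again a Lipschitz function. -/
theorem UpperAt.combo {R : ℝ} (hR : 0 ≤ R) {ξ : Ordinal.{v}} (h : UpperAt 𝕜 X D R ξ) (n : ℕ)
    (x : List (Ordinal.{v} × D) → X) (hx : IsBallTree 𝕜 (Gam ξ (n + 1)) x) (a : Fin (n + 1) → 𝕜)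
    {g : X → ℝ} (hg : IsLip R g) (x₀ : X) {c : ℝ}
    (hc : opL (op 𝕜 ξ) (List.ofFn fun i => ‖a i‖) g x₀ < c) :
    ∃ t : List (Ordinal.{v} × D), t.map Prod.fst ∈ maxNodes (Gam ξ (n + 1)) ∧
      g (x₀ + SzlenkSum.combo ξ (n + 1) x a t) < c := by
  induction n generalizing x x₀ with
  | zero =>
    simp only [zero_add, Gam_one] at hx ⊢
    obtain ⟨t, ht, hlt⟩ := h x hx (a 0) g hg x₀ c (by simpa [opL] using hc)
    exact ⟨t, ht, (congrArg (fun z => g (x₀ + z)) (combo_one x a t)).trans_lt hlt⟩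
  | succ n ih =>
    rw [List.ofFn_succ, opL_cons] at hc
    obtain ⟨t, ht, hlt⟩ := h _ (hx.shiftD (ω ^ ξ * ((n + 1 : ℕ) : Ordinal.{v}))
      fun t ht => mem_Gam_add_one.2 (Or.inl ⟨t, ht, rfl⟩)) (a 0) _
      ((stepOp_op 𝕜 hR ξ).opL_lip (nonneg_of_mem_ofFn_norm fun i => a (Fin.succ i)) hg) x₀ c hc
    obtain ⟨s, hs, hlt'⟩ := ih _ (hx.append (SzlenkSum.shiftD (ω ^ ξ * ((n + 1 : ℕ) : Ordinal.{v})) t)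
      fun s hs => mem_Gam_add_one.2 (Or.inr ⟨_, ht, s, hs, by rw [map_fst_shiftD]⟩))
      (fun i => a (Fin.succ i)) _ hlt
    refine ⟨SzlenkSum.shiftD (ω ^ ξ * ((n + 1 : ℕ) : Ordinal.{v})) t ++ s, ?_, ?_⟩
    · rw [List.map_append, map_fst_shiftD]
      exact shift_append_mem_maxNodes ht hs
    · rwa [combo_shiftD_append x a ht hs.1, ← add_assoc]

theorem upperAt [IsDirectedOrder D] [Nonempty D] {R : ℝ} (hR : 0 ≤ R) (ξ : Ordinal.{v}) : UpperAt 𝕜 X D R ξ := by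
  induction ξ using Ordinal.limitRecOn with
  | zero =>
    intro x hx a g hg x₀ c hc
    rw [op_zero] at hc
    -- Multiplying by a scalar of modulus one preserves weakly null nets in the ball, so only `‖a‖`
    -- matters.
    obtain ⟨σ, hσ, hσa⟩ := exists_phase a
    have h1 : Filter.Tendsto (fun d : D => σ • x [(0, d)]) Filter.atTop (ballFilter 𝕜 X) := by
      refine (tendsto_ballFilter 𝕜).2 ⟨fun f => ?_, .of_forall fun d => ?_⟩
      · have := (hx.2 [] 0 (by simp [GammaOne_zero]) f).const_mul σ
        simpa using this
      · rw [norm_smul, hσ, one_mul]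
        exact hx.1 _ (by simp [prodTree, GammaOne_zero])
    obtain ⟨d, hd⟩ := (h1.eventually
      (eventually_lt_of_baseOp_lt hR hg (norm_nonneg a) hc)).exists
    refine ⟨[(0, d)], by simp [maxNodes_GammaOne_zero], ?_⟩
    rwa [blockSum_zero, ← hσa, mul_smul]
  | add_one ξ ih =>
    intro x hx a g hg x₀ c hc
    rw [op_add_one] at hc
    obtain ⟨n, hn⟩ := exists_lt_of_ciInf_lt hc
    have hx' : IsBallTree 𝕜 (Gam ξ (n + 1)) x := hx.subset (by
      rw [GammaOne_add_one]
      exact Set.subset_iUnion (fun n => Gam ξ n) (n + 1))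
    have e : ‖a / ((n + 1 : ℕ) : 𝕜)‖ = ‖a‖ / (n + 1) := by
      rw [norm_div, RCLike.norm_natCast]
      push_cast
      rfl
    obtain ⟨t, ht, hlt⟩ := ih.combo hR n x hx' (fun _ => a / ((n + 1 : ℕ) : 𝕜)) hg x₀ (c := c) (by
      rwa [List.ofFn_const, e])
    exact ⟨t, (mem_maxNodes_GammaOne_add_one ht.1).2 ht, by
      rwa [smul_blockSum_add_one x a ht.1]⟩
  | limit ξ hξ ih =>
    intro x hx a g hg x₀ c hc
    rw [op_limit 𝕜 hξ] at hc
    have : Nonempty (Set.Iio ξ) := ⟨⟨0, hξ.bot_lt⟩⟩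
    obtain ⟨⟨ζ, hζ⟩, hlt⟩ := exists_lt_of_ciInf_lt hc
    obtain ⟨t, ht, hlt'⟩ := ih _ (hξ.add_one_lt hζ) _ (hx.shiftD (ω ^ ζ) fun t ht => by
      rw [GammaOne_limit hξ]
      exact ⟨ζ, hζ, t, ht, rfl⟩) a g hg x₀ c hlt
    refine ⟨SzlenkSum.shiftD (ω ^ ζ) t, ?_, ?_⟩
    · rw [map_fst_shiftD]
      exact (shift_mem_maxNodes_limit hξ hζ ht.1).2 ht
    · rwa [blockSum_shiftD_limit hξ hζ x ht.1]

end Upper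

/-! ### The operators are attained by collections on the trees -/

section Lower

variable (𝕜 : Type w) [RCLike 𝕜] (X : Type u) [NormedAddCommGroup X] [NormedSpace 𝕜 X]

/-- The directed set of weak neighbourhoods of `0` in the unit ball. -/
abbrev NhdDir : Type u := {U : Set X // U ∈ ballFilter 𝕜 X}ᵒᵈ

instance : Nonempty (NhdDir 𝕜 X) := ⟨OrderDual.toDual ⟨Set.univ, Filter.univ_mem⟩⟩

instance : IsDirectedOrder (NhdDir 𝕜 X) :=
  ⟨fun U V => ⟨OrderDual.toDual ⟨(OrderDual.ofDual U).1 ∩ (OrderDual.ofDual V).1,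
    Filter.inter_mem (OrderDual.ofDual U).2 (OrderDual.ofDual V).2⟩,
    Set.inter_subset_left, Set.inter_subset_right⟩⟩

variable {𝕜 X}

/-- The vectors of the collection lie in the weak neighbourhoods that index them. -/
def IsAdapted (x : List (Ordinal.{v} × NhdDir 𝕜 X) → X) : Prop :=
  ∀ t p, x (t ++ [p]) ∈ (OrderDual.ofDual p.2).1 ∧ ‖x (t ++ [p])‖ ≤ 1

/-- For a functional `f` and a neighbourhood `V` of `0`, the preimage of `V` is itself an index, and
the vectors at all later indices lie in it. -/
theorem IsAdapted.isBallTree {x : List (Ordinal.{v} × NhdDir 𝕜 X) → X} (hx : IsAdapted x)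
    {T : Set (List Ordinal.{v})} (hT : ∀ t ∈ T, t ≠ []) : IsBallTree 𝕜 T x := by
  constructor
  · intro t ht
    have hne : t ≠ [] := by
      rintro rfl
      exact hT _ ht rfl
    rw [← List.dropLast_append_getLast hne]
    exact (hx _ _).2
  · intro t ζ _ f V hV
    have hU : f ⁻¹' V ∈ ballFilter 𝕜 X := tendsto_ballFilter_apply 𝕜 f hV
    refine Filter.mem_atTop_sets.2 ⟨OrderDual.toDual ⟨_, hU⟩, fun d hd => ?_⟩
    exact hd (hx t (ζ, d)).1

/-- A property that holds frequently is realised inside every index neighbourhood, and the vector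
may depend on the last index alone. -/
theorem exists_isAdapted_base {P : X → Prop} (h : ∃ᶠ y in ballFilter 𝕜 X, P y) :
    ∃ x : List (Ordinal.{v} × NhdDir 𝕜 X) → X, IsAdapted x ∧ ∀ t p, P (x (t ++ [p])) := by
  have h1 : ∀ d : NhdDir 𝕜 X, ∃ y, P y ∧ y ∈ (OrderDual.ofDual d).1 ∧ ‖y‖ ≤ 1 := fun d =>
    (h.and_eventually (Filter.Eventually.and (p := fun y => y ∈ (OrderDual.ofDual d).1)
      (OrderDual.ofDual d).2 (eventually_ballFilter_norm_le 𝕜))).exists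
  choose Y hP hY using h1
  refine ⟨fun t => if ht : t ≠ [] then Y (t.getLast ht).2 else 0, fun t p => ?_, fun t p => ?_⟩
  · simpa using hY p.2
  · simpa using hP p.2

open Classical in
/-- Collections on a first level and above its members can be glued. -/
theorem exists_isAdapted_glue (β : Ordinal.{v}) {x : List (Ordinal.{v} × NhdDir 𝕜 X) → X}
    (hx : IsAdapted x)
    {y : List (Ordinal.{v} × NhdDir 𝕜 X) → List (Ordinal.{v} × NhdDir 𝕜 X) → X}
    (hy : ∀ t, IsAdapted (y t)) :
    ∃ z : List (Ordinal.{v} × NhdDir 𝕜 X) → X, IsAdapted z ∧ (∀ t, z (shiftD β t) = x t) ∧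
      ∀ t s, s ≠ [] → (∀ η ∈ s.map Prod.fst, η < β) → z (shiftD β t ++ s) = y t s := by
  let Q : List (Ordinal.{v} × NhdDir 𝕜 X) →
      List (Ordinal.{v} × NhdDir 𝕜 X) × List (Ordinal.{v} × NhdDir 𝕜 X) → Prop := fun r p =>
    p.2 ≠ [] ∧ (∀ η ∈ p.2.map Prod.fst, η < β) ∧ r = shiftD β p.1 ++ p.2
  refine ⟨fun r => if h : ∃ p, Q r p then y h.choose.1 h.choose.2 else x (unshiftD β r), ?_, ?_, ?_⟩
  · intro r p
    by_cases h : ∃ q, Q (r ++ [p]) q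
    · simp only [dif_pos h]
      obtain ⟨h1, -, h3⟩ := h.choose_spec
      generalize h.choose = q at h1 h3
      rw [← List.dropLast_append_getLast h1, ← List.append_assoc] at h3
      have h4 := (List.append_inj' h3 rfl).2
      rw [List.singleton_inj] at h4
      have := hy q.1 q.2.dropLast p
      rw [h4]
      rwa [h4, List.dropLast_append_getLast h1] at this
    · simp only [dif_neg h]
      have := hx (unshiftD β r) (p.1 - β, p.2)
      simpa [unshiftD] using this
  · intro t
    have h : ¬ ∃ q, Q (shiftD β t) q := by
      rintro ⟨q, h1, h2, h3⟩
      rw [← List.append_nil (shiftD β t)] at h3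
      exact h1 (shiftD_append_inj (by simp) h2 h3).2.symm
    simp only [dif_neg h, unshiftD_shiftD]
  · intro t s hs hs'
    have h : ∃ q, Q (shiftD β t ++ s) q := ⟨(t, s), hs, hs', rfl⟩
    simp only [dif_pos h]
    obtain ⟨-, h2, h3⟩ := h.choose_spec
    obtain ⟨h4, h5⟩ := shiftD_append_inj hs' h2 h3
    rw [← h4, ← h5]

/-- Almost optimal collections for the operator `op 𝕜 ξ` exist on `Γ_{ξ,1}`. -/
def LowerAt (𝕜 : Type w) [RCLike 𝕜] (X : Type u) [NormedAddCommGroup X] [NormedSpace 𝕜 X]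
    (R : ℝ) (ξ : Ordinal.{v}) : Prop :=
  ∀ (a : ℝ) (g : X → ℝ), 0 ≤ a → IsLip R g → ∀ (x₀ : X) (c : ℝ), c < op 𝕜 ξ a g x₀ →
    ∃ x : List (Ordinal.{v} × NhdDir 𝕜 X) → X, IsAdapted x ∧
      ∀ t, t.map Prod.fst ∈ maxNodes (GammaOne ξ) → c < g (x₀ + (a : 𝕜) • blockSum 𝕜 ξ 1 x t 1)

/-- An almost optimal first level is followed, above each of its maximal members, by a collection
almost optimal for the point reached there. -/
theorem LowerAt.combo {R : ℝ} (hR : 0 ≤ R) {ξ : Ordinal.{v}} (h : LowerAt 𝕜 X R ξ) (n : ℕ)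
    {a : Fin (n + 1) → ℝ} (ha : ∀ i, 0 ≤ a i) {g : X → ℝ} (hg : IsLip R g) (x₀ : X) {c : ℝ}
    (hc : c < opL (op 𝕜 ξ) (List.ofFn a) g x₀) :
    ∃ x : List (Ordinal.{v} × NhdDir 𝕜 X) → X, IsAdapted x ∧
      ∀ t, t.map Prod.fst ∈ maxNodes (Gam ξ (n + 1)) →
        c < g (x₀ + SzlenkSum.combo ξ (n + 1) x (fun i => (a i : 𝕜)) t) := by
  classical
  induction n generalizing x₀ with
  | zero =>
    simp only [zero_add, Gam_one]
    obtain ⟨x, hx, hlt⟩ := h (a 0) g (ha 0) hg x₀ c (by simpa [opL] using hc)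
    exact ⟨x, hx, fun t ht => (hlt t ht).trans_eq
      (congrArg (fun z => g (x₀ + z)) (combo_one x (fun i => (a i : 𝕜)) t)).symm⟩
  | succ n ih =>
    rw [List.ofFn_succ, opL_cons] at hc
    set β : Ordinal.{v} := ω ^ ξ * ((n + 1 : ℕ) : Ordinal.{v}) with hβ
    obtain ⟨x, hx, hxc⟩ := h (a 0) _ (ha 0) ((stepOp_op 𝕜 hR ξ).opL_lip (by
      intro b hb
      obtain ⟨i, rfl⟩ := (List.mem_ofFn' _ _).1 hb
      exact ha _) hg) x₀ c hc
    have hy : ∀ t : List (Ordinal.{v} × NhdDir 𝕜 X),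
        ∃ y : List (Ordinal.{v} × NhdDir 𝕜 X) → X, IsAdapted y ∧
        (t.map Prod.fst ∈ maxNodes (GammaOne ξ) →
          ∀ s, s.map Prod.fst ∈ maxNodes (Gam ξ (n + 1)) →
            c < g (x₀ + (a 0 : 𝕜) • blockSum 𝕜 ξ 1 x t 1 +
              SzlenkSum.combo ξ (n + 1) y (fun i => (a (Fin.succ i) : 𝕜)) s)) := by
      intro t
      by_cases ht : t.map Prod.fst ∈ maxNodes (GammaOne ξ)
      · obtain ⟨y, hy, hyc⟩ := ih (fun i => ha _) _ (hxc t ht)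
        exact ⟨y, hy, fun _ => hyc⟩
      · exact ⟨x, hx, fun h => absurd h ht⟩
    choose y hy hyc using hy
    obtain ⟨z, hz, hz1, hz2⟩ := exists_isAdapted_glue β hx hy
    refine ⟨z, hz, fun t ht => ?_⟩
    obtain ⟨t₀, ht₀, s₀, hs₀, e⟩ := exists_of_mem_maxNodes_Gam ht
    obtain ⟨t', s', rfl, rfl, rfl⟩ := exists_shiftD_append_eq e
    rw [combo_shiftD_append z _ ht₀ hs₀.1, ← add_assoc]
    simp only [← hβ, hz1]
    have e2 : SzlenkSum.combo ξ (n + 1) (fun r => z (shiftD β t' ++ r))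
        (fun i => (a (Fin.succ i) : 𝕜)) s' =
        SzlenkSum.combo ξ (n + 1) (y t') (fun i => (a (Fin.succ i) : 𝕜)) s' := by
      refine Finset.sum_congr rfl fun i _ => ?_
      congr 1
      refine blockSum_congr (fun s hs _ => hz2 _ _ ?_ (lt_of_mem_Gam hs)) _
      rintro rfl
      exact ne_nil_of_mem_Gam hs rfl
    rw [e2]
    exact hyc t' ht₀ s' hs₀

theorem lowerAt {R : ℝ} (hR : 0 ≤ R) (ξ : Ordinal.{v}) : LowerAt 𝕜 X R ξ := by
  classical
  induction ξ using Ordinal.limitRecOn with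
  | zero =>
    intro a g ha hg x₀ c hc
    rw [op_zero] at hc
    obtain ⟨x, hx, hxc⟩ := exists_isAdapted_base.{u, v, w} (frequently_lt_of_lt_baseOp hR hg ha hc)
    refine ⟨x, hx, fun t ht => ?_⟩
    rw [maxNodes_GammaOne_zero, Set.mem_singleton_iff] at ht
    obtain ⟨⟨η, d⟩, rfl, h⟩ := List.map_eq_singleton_iff.1 ht
    simp only at h
    subst h
    rw [blockSum_zero]
    exact hxc [] _
  | add_one ξ ih =>
    intro a g ha hg x₀ c hc
    rw [op_add_one] at hc
    have hn : ∀ n : ℕ, ∃ x : List (Ordinal.{v} × NhdDir 𝕜 X) → X, IsAdapted x ∧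
        ∀ t, t.map Prod.fst ∈ maxNodes (Gam ξ (n + 1)) →
          c < g (x₀ + combo ξ (n + 1) x (fun _ => ((a / (n + 1) : ℝ) : 𝕜)) t) := by
      intro n
      refine ih.combo hR n (a := fun _ => a / (n + 1)) (fun _ => by positivity) hg x₀ ?_
      rw [List.ofFn_const]
      exact hc.trans_le ((stepOp_op 𝕜 hR ξ).succOp_le ha hg n x₀)
    choose y hy hyc using hn
    -- The first entry determines `n`, so the collections for different `n` do not interfere. The
    -- default `y 0` only keeps the collection adapted off the trees.
    refine ⟨fun r => if h : ∃ n, r.map Prod.fst ∈ Gam ξ (n + 1) then y h.choose r else y 0 r,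
      fun r p => ?_, fun t ht => ?_⟩
    · dsimp only
      split_ifs with h
      exacts [hy _ _ _, hy _ _ _]
    · obtain ⟨n, hn⟩ : ∃ n, t.map Prod.fst ∈ Gam ξ (n + 1) := by
        have := ht.1
        rw [GammaOne_add_one, Set.mem_iUnion] at this
        obtain ⟨m, hm⟩ := this
        cases m with
        | zero => simp [Gam_zero] at hm
        | succ m => exact ⟨m, hm⟩
      have h1 := hyc n t ((mem_maxNodes_GammaOne_add_one hn).1 ht)
      rw [smul_blockSum_add_one _ _ hn]
      convert h1 using 3
      refine Finset.sum_congr rfl fun i _ => ?_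
      congr 1
      · push_cast
        rfl
      · refine blockSum_congr (fun s hs _ => ?_) _
        have h : ∃ n, s.map Prod.fst ∈ Gam ξ (n + 1) := ⟨n, hs⟩
        rw [dif_pos h]
        have := eq_of_mem_Gam_of_head h.choose_spec hs rfl
        rw [show h.choose = n by omega]
  | limit ξ hξ ih =>
    intro a g ha hg x₀ c hc
    have hn : ∀ ζ : Set.Iio ξ, ∃ x : List (Ordinal.{v} × NhdDir 𝕜 X) → X, IsAdapted x ∧
        ∀ t, t.map Prod.fst ∈ maxNodes (GammaOne (ζ.1 + 1)) →
          c < g (x₀ + (a : 𝕜) • blockSum 𝕜 (ζ.1 + 1) 1 x t 1) := fun ζ =>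
      ih _ (hξ.add_one_lt ζ.2) a g ha hg x₀ c (hc.trans_le (op_limit_le 𝕜 hR hξ ζ.2 ha hg x₀))
    choose y hy hyc using hn
    -- The summand of the limit tree containing a sequence is read off from the sequence. Off the
    -- tree the value `0` is a harmless default.
    let N : List (Ordinal.{v} × NhdDir 𝕜 X) → Set.Iio ξ := fun r =>
      if h : ∃ ζ : Set.Iio ξ, ∃ s ∈ GammaOne (ζ.1 + 1), r.map Prod.fst = shift (ω ^ ζ.1) s
      then h.choose else ⟨0, hξ.bot_lt⟩
    refine ⟨fun r => y (N r) (unshiftD (ω ^ (N r).1) r), fun r p => ?_, fun t ht => ?_⟩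
    · have := hy (N (r ++ [p])) (unshiftD (ω ^ (N (r ++ [p])).1) r)
        (p.1 - ω ^ (N (r ++ [p])).1, p.2)
      simpa [unshiftD] using this
    · have h1 := ht.1
      rw [GammaOne_limit hξ] at h1
      obtain ⟨ζ, hζ, s, hs, e⟩ := h1
      obtain ⟨t', rfl, rfl⟩ := exists_shiftD_eq e
      rw [map_fst_shiftD, shift_mem_maxNodes_limit hξ hζ hs] at ht
      rw [blockSum_shiftD_limit hξ hζ _ hs]
      have h2 := hyc ⟨ζ, hζ⟩ t' ht
      convert h2 using 4
      refine blockSum_congr (fun r hr _ => ?_) _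
      have hr' := mem_Gam_one.1 hr
      have h : ∃ ζ' : Set.Iio ξ, ∃ s ∈ GammaOne (ζ'.1 + 1),
          (shiftD (ω ^ ζ) r).map Prod.fst = shift (ω ^ ζ'.1) s :=
        ⟨⟨ζ, hζ⟩, _, hr', map_fst_shiftD _ _⟩
      have hN : N (shiftD (ω ^ ζ) r) = ⟨ζ, hζ⟩ := by
        simp only [N, dif_pos h]
        obtain ⟨s', hs', e'⟩ := h.choose_spec
        refine Subtype.ext (eq_of_mem_GammaOne_of_head hs' hr' ?_)
        rw [← e', map_fst_shiftD]
      simp only [hN, unshiftD_shiftD]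

end Lower

/-! ### The quantities `θ` and `α` -/

section Quantities

variable {𝕜 : Type w} [RCLike 𝕜] {X : Type u} [NormedAddCommGroup X] [NormedSpace 𝕜 X]
  {K : Set (WeakDual 𝕜 X)} {R : ℝ}

theorem treeInf_le (hR : 0 ≤ R) (hK : DualBdd R K) {ξ : Ordinal.{v}} {n : ℕ} {D : Type u}
    [Preorder D] [IsDirectedOrder D] [Nonempty D] {x : List (Ordinal.{v} × D) → X}
    (hx : IsBallTree 𝕜 (Gam ξ (n + 1)) x) (a : Fin (n + 1) → 𝕜) {M : ℝ} (hM : 0 ≤ M)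
    (h : opL (op 𝕜 ξ) (List.ofFn fun i => ‖a i‖) (supportFun K) 0 ≤ M) :
    treeInf K ξ (n + 1) x a ≤ M := by
  refine le_of_forall_gt_imp_ge_of_dense fun c hc => ?_
  obtain ⟨t, ht, hlt⟩ := (upperAt hR ξ).combo hR n x hx a (hK.isLip hR) 0 (h.trans_lt hc)
  rw [zero_add] at hlt
  let F : maxNodes (prodTree (Gam ξ (n + 1)) D) → ℝ := fun t =>
    supportFun K (combo ξ (n + 1) x a t.1)
  change iInf F ≤ c
  -- A real infimum over a set unbounded below is `0` by convention; this case is covered by `0 ≤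
  -- M`.
  by_cases hb : BddBelow (Set.range F)
  · exact (ciInf_le hb ⟨t, mem_maxNodes_prodTree.2 ht⟩).trans hlt.le
  · rw [Real.iInf_of_not_bddBelow hb]
    exact hM.trans hc.le

theorem opL_supportFun_nonneg (hR : 0 ≤ R) (hK : DualBdd R K) (ξ : Ordinal.{v}) {l : List ℝ}
    (hl : ∀ a ∈ l, 0 ≤ a) : 0 ≤ opL (op 𝕜 ξ) l (supportFun K) 0 := by
  have := (stepOp_op 𝕜 hR ξ).le_opL hl (hK.isLip hR) 0
  rwa [supportFun_zero] at this

/-- The set whose infimum is `θ_{ξ,n}(K)`. -/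
def thetaSet (ξ : Ordinal.{v}) (n : ℕ) (K : Set (WeakDual 𝕜 X)) : Set ℝ :=
  {θ : ℝ | 0 < θ ∧
    ∀ (D : Type u) [Preorder D] [IsDirectedOrder D] [Nonempty D]
      (x : List (Ordinal.{v} × D) → X),
      (∀ t ∈ prodTree (Gam ξ n) D, ‖x t‖ ≤ 1) → IsWeaklyNull 𝕜 (Gam ξ n) x →
        treeInf K ξ n x (fun _ => (1 / n : 𝕜)) ≤ θ}

theorem bddBelow_thetaSet (ξ : Ordinal.{v}) (n : ℕ) (K : Set (WeakDual 𝕜 X)) :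
    BddBelow (thetaSet ξ n K) :=
  ⟨0, fun _ h => h.1.le⟩

theorem theta_nonneg (ξ : Ordinal.{v}) (n : ℕ) (K : Set (WeakDual 𝕜 X)) : 0 ≤ theta ξ n K :=
  Real.sInf_nonneg fun _ h => h.1.le

theorem mem_thetaSet (hR : 0 ≤ R) (hK : DualBdd R K) {ξ : Ordinal.{v}} {n : ℕ} {c : ℝ}
    (hc0 : 0 < c) (hc : opL (op 𝕜 ξ) (List.replicate (n + 1) (1 / ((n : ℝ) + 1)))
      (supportFun K) 0 ≤ c) : c ∈ thetaSet ξ (n + 1) K := by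
  refine ⟨hc0, fun D _ _ _ x hx hx' => treeInf_le hR hK ⟨hx, hx'⟩ _ hc0.le ?_⟩
  have e : ‖(1 / ((n + 1 : ℕ) : 𝕜))‖ = 1 / ((n : ℝ) + 1) := by
    rw [norm_div, RCLike.norm_natCast, norm_one]
    push_cast
    rfl
  rwa [List.ofFn_const, e]

theorem theta_le_opL (hR : 0 ≤ R) (hK : DualBdd R K) (ξ : Ordinal.{v}) (n : ℕ) :
    theta ξ (n + 1) K ≤
      opL (op 𝕜 ξ) (List.replicate (n + 1) (1 / ((n : ℝ) + 1))) (supportFun K) 0 := by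
  refine le_of_forall_gt_imp_ge_of_dense fun c hc => ?_
  refine csInf_le (bddBelow_thetaSet ξ (n + 1) K) (mem_thetaSet hR hK ?_ hc.le)
  exact (opL_supportFun_nonneg hR hK ξ (nonneg_of_mem_replicate_div zero_le_one n (n + 1))).trans_lt
    hc

/-- The adapted collections of `lowerAt` are admissible in the definition of `θ`, and positive
homogeneity of the support function replaces coefficients `1 / (n + 1)` by `b`. -/
theorem opL_replicate_le_theta (hR : 0 ≤ R) (hK : DualBdd R K) (ξ : Ordinal.{v}) (n : ℕ) {b : ℝ}
    (hb : 0 ≤ b) : opL (op 𝕜 ξ) (List.replicate (n + 1) b) (supportFun K) 0 ≤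
      b * (n + 1) * theta ξ (n + 1) K := by
  have hne : (thetaSet ξ (n + 1) K).Nonempty :=
    ⟨_, mem_thetaSet hR hK (n := n) ((opL_supportFun_nonneg hR hK ξ
      (nonneg_of_mem_replicate_div zero_le_one n (n + 1))).trans_lt (lt_add_one _)) (le_add_of_nonneg_right zero_le_one)⟩
  have key : ∀ θ ∈ thetaSet ξ (n + 1) K,
      opL (op 𝕜 ξ) (List.replicate (n + 1) b) (supportFun K) 0 ≤ b * (n + 1) * θ := by
    intro θ hθ
    refine le_of_forall_lt_imp_le_of_dense fun c hc => ?_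
    obtain ⟨x, hx, hxc⟩ := (lowerAt hR ξ).combo hR n (a := fun _ => b) (fun _ => hb) (hK.isLip hR)
      0 (c := c) (by rwa [List.ofFn_const])
    have hx' := hx.isBallTree (𝕜 := 𝕜) (T := Gam ξ (n + 1)) fun t => ne_nil_of_mem_Gam
    have h1 := hθ.2 (NhdDir 𝕜 X) x hx'.1 hx'.2
    have h2 : ∀ t, t.map Prod.fst ∈ maxNodes (Gam ξ (n + 1)) →
        c < b * (n + 1) * supportFun K (combo ξ (n + 1) x (fun _ => (1 / (n + 1 : ℕ) : 𝕜)) t) := by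
      intro t ht
      have h3 := hxc t ht
      rw [zero_add] at h3
      rw [← supportFun_real_smul K (by positivity)]
      convert h3 using 2
      rw [combo, combo, Finset.smul_sum]
      refine Finset.sum_congr rfl fun i _ => ?_
      rw [smul_smul]
      congr 1
      have : ((n + 1 : ℕ) : 𝕜) ≠ 0 := by exact_mod_cast Nat.succ_ne_zero n
      push_cast at this ⊢
      field_simp
    rcases hb.eq_or_lt with rfl | hb
    · obtain ⟨t, ht⟩ := maxNodes_Gam_nonempty ξ n
      have := h2 (t.map fun η => (η, Classical.arbitrary _)) (by
        simpa [Function.comp_def] using ht)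
      simp only [zero_mul] at this ⊢
      exact this.le
    · have hbn : 0 < b * (n + 1) := by positivity
      rw [mul_comm, ← div_le_iff₀ hbn]
      refine le_trans ?_ h1
      have : Nonempty (maxNodes (prodTree (Gam ξ (n + 1)) (NhdDir 𝕜 X))) := by
        obtain ⟨t, ht⟩ := maxNodes_Gam_nonempty ξ n
        exact ⟨⟨t.map fun η => (η, Classical.arbitrary _), mem_maxNodes_prodTree.2 (by
          simpa [Function.comp_def] using ht)⟩⟩
      refine le_ciInf fun t => ?_
      rw [div_le_iff₀ hbn, mul_comm]
      exact (h2 t.1 (mem_maxNodes_prodTree.1 t.2)).le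
  rcases hb.eq_or_lt with rfl | hb
  · obtain ⟨θ, hθ⟩ := hne
    simpa using key θ hθ
  · have hbn : 0 < b * (n + 1) := by positivity
    rw [mul_comm, ← div_le_iff₀ hbn]
    refine le_csInf hne fun θ hθ => ?_
    rw [div_le_iff₀ hbn, mul_comm]
    exact key θ hθ

/-! ### Conjugate exponents and the comparison of `α` with `θ` -/

theorem toReal_one_div_add {p q : ℝ≥0∞} (hp : 1 < p) (hq : 1 ≤ q) (hpq : 1 / p + 1 / q = 1) :
    (1 / p).toReal + (1 / q).toReal = 1 := by
  rw [← ENNReal.toReal_add, hpq, ENNReal.toReal_one]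
  · exact (ENNReal.div_lt_top ENNReal.one_ne_top (zero_lt_one.trans hp).ne').ne
  · exact (ENNReal.div_lt_top ENNReal.one_ne_top (zero_lt_one.trans_le hq).ne').ne

theorem toReal_one_div_pos {p q : ℝ≥0∞} (hp : 1 < p) (hq : 1 ≤ q) (hpq : 1 / p + 1 / q = 1) :
    0 < (1 / q).toReal := by
  have h1 := toReal_one_div_add hp hq hpq
  have h2 : (1 / p).toReal < 1 := by
    rw [← ENNReal.toReal_one]
    refine (ENNReal.toReal_lt_toReal
      (ENNReal.div_lt_top ENNReal.one_ne_top (zero_lt_one.trans hp).ne').ne ENNReal.one_ne_top).2 ?_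
    rw [one_div]
    exact ENNReal.inv_lt_one.2 hp
  linarith

/-- This is Hölder's inequality against the constant sequence `1`, with `p = ∞` treated apart. The
case `q = ∞` cannot occur because `p > 1`. -/
theorem sum_norm_le {p q : ℝ≥0∞} (hp : 1 < p) (hq : 1 ≤ q) (hpq : 1 / p + 1 / q = 1) {n : ℕ}
    (a : Fin n → 𝕜) : ∑ i, ‖a i‖ ≤
      (n : ℝ) ^ (1 / q).toReal * ‖(WithLp.toLp p a : PiLp p fun _ : Fin n => 𝕜)‖ := by
  have : Fact (1 ≤ p) := ⟨hp.le⟩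
  have h1 := toReal_one_div_add hp hq hpq
  rcases eq_or_ne p ⊤ with rfl | hpt
  · simp only [ENNReal.div_top, ENNReal.toReal_zero, zero_add] at h1
    rw [h1, Real.rpow_one]
    calc ∑ i, ‖a i‖ ≤ ∑ _i : Fin n, ‖(WithLp.toLp ⊤ a : PiLp ⊤ fun _ : Fin n => 𝕜)‖ :=
          Finset.sum_le_sum fun i _ => PiLp.norm_apply_le (WithLp.toLp ⊤ a) i
      _ = _ := by simp
  · have hp0 : 1 < p.toReal := by
      rw [← ENNReal.toReal_one]
      exact (ENNReal.toReal_lt_toReal ENNReal.one_ne_top hpt).2 hp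
    have hq0 := toReal_one_div_pos hp hq hpq
    have hqt : q ≠ ⊤ := by
      rintro rfl
      simp at hq0
    rw [PiLp.norm_eq_sum (zero_lt_one.trans hp0)]
    simp only [one_div, ENNReal.toReal_inv] at h1 hq0 ⊢
    have hconj : q.toReal.HolderConjugate p.toReal := by
      refine ⟨by linarith, ?_, by linarith⟩
      exact inv_pos.1 hq0
    simpa using Real.inner_le_Lp_mul_Lq Finset.univ (fun _ : Fin n => (1 : ℝ)) (fun i => ‖a i‖)
      hconj

/-- The set whose infimum is `α_{ξ,p,n}(K)`. -/
def alphaSet (ξ : Ordinal.{v}) (p : ℝ≥0∞) (n : ℕ) (K : Set (WeakDual 𝕜 X)) : Set ℝ :=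
  {α : ℝ | 0 < α ∧
    ∀ (D : Type u) [Preorder D] [IsDirectedOrder D] [Nonempty D] (a : Fin n → 𝕜)
      (x : List (Ordinal.{v} × D) → X),
      (∀ t ∈ prodTree (Gam ξ n) D, ‖x t‖ ≤ 1) → IsWeaklyNull 𝕜 (Gam ξ n) x →
        treeInf K ξ n x a ≤ α * ‖(WithLp.toLp p a : PiLp p fun _ : Fin n => 𝕜)‖}

theorem alpha_eq (ξ : Ordinal.{v}) (p : ℝ≥0∞) (n : ℕ) (K : Set (WeakDual 𝕜 X)) :
    alpha ξ p n K = sInf (alphaSet ξ p n K) := rfl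

/-- The moves `‖a i‖` are bounded by the `ℓ_p` norm, so regrouping them into `m + 1` equal moves
costs `2 R m` times that norm. The slightly larger `2 R (m + 1)` makes the bound positive, as
membership requires. -/
theorem mem_alphaSet (hR : 0 < R) (hK : DualBdd R K) (ξ : Ordinal.{v}) {p q : ℝ≥0∞} (hp : 1 < p)
    (hq : 1 ≤ q) (hpq : 1 / p + 1 / q = 1) (n m : ℕ) :
    ((n + 1 : ℕ) : ℝ) ^ (1 / q).toReal * theta ξ (m + 1) K + 2 * R * (m + 1) ∈
      alphaSet ξ p (n + 1) K := by
  have : Fact (1 ≤ p) := ⟨hp.le⟩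
  have hθ := theta_nonneg ξ (m + 1) K
  refine ⟨by positivity, fun D _ _ _ a x hx hx' => ?_⟩
  refine treeInf_le hR.le hK ⟨hx, hx'⟩ a (by positivity) ?_
  set N := ‖(WithLp.toLp p a : PiLp p fun _ : Fin (n + 1) => 𝕜)‖ with hN
  have h1 := (stepOp_op 𝕜 hR.le ξ).opL_le_replicate hR.le (norm_nonneg (WithLp.toLp p a))
    (hK.isLip hR.le) (l := List.ofFn fun i => ‖a i‖) (by
      intro b hb
      obtain ⟨i, rfl⟩ := (List.mem_ofFn' _ _).1 hb
      exact ⟨norm_nonneg _, PiLp.norm_apply_le (WithLp.toLp p a) i⟩) m 0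
  rw [List.sum_ofFn, ← hN] at h1
  have h2 := opL_replicate_le_theta hR.le hK ξ m
    (b := (∑ i, ‖a i‖) / (m + 1)) (by positivity)
  rw [div_mul_cancel₀ _ (by positivity)] at h2
  have h3 := mul_le_mul_of_nonneg_right (sum_norm_le hp hq hpq a) hθ
  have h4 : 0 ≤ R * N := by positivity
  rw [← hN] at h3
  linarith

theorem alpha_le (hR : 0 < R) (hK : DualBdd R K) (ξ : Ordinal.{v}) {p q : ℝ≥0∞} (hp : 1 < p)
    (hq : 1 ≤ q) (hpq : 1 / p + 1 / q = 1) (n m : ℕ) :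
    alpha ξ p (n + 1) K ≤
      ((n + 1 : ℕ) : ℝ) ^ (1 / q).toReal * theta ξ (m + 1) K + 2 * R * (m + 1) :=
  csInf_le ⟨0, fun _ h => h.1.le⟩ (mem_alphaSet hR hK ξ hp hq hpq n m)

/-- The constant sequence `1 / n` of length `n` has `ℓ_p` norm `n^{1/p - 1} = n^{-1/q}`. -/
theorem theta_le_alpha_div (hR : 0 < R) (hK : DualBdd R K) (ξ : Ordinal.{v}) {p q : ℝ≥0∞}
    (hp : 1 < p) (hq : 1 ≤ q) (hpq : 1 / p + 1 / q = 1) (n : ℕ) :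
    theta ξ (n + 1) K ≤ alpha ξ p (n + 1) K / ((n + 1 : ℕ) : ℝ) ^ (1 / q).toReal := by
  have : Fact (1 ≤ p) := ⟨hp.le⟩
  have hn : (0 : ℝ) < ((n + 1 : ℕ) : ℝ) := by positivity
  have hnq : (0 : ℝ) < ((n + 1 : ℕ) : ℝ) ^ (1 / q).toReal := by positivity
  rw [le_div_iff₀ hnq, alpha_eq]
  refine le_csInf ⟨_, mem_alphaSet hR hK ξ hp hq hpq n n⟩ fun α hα => ?_
  rw [← le_div_iff₀ hnq]
  refine csInf_le (bddBelow_thetaSet ξ (n + 1) K) ⟨div_pos hα.1 hnq, fun D _ _ _ x hx hx' => ?_⟩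
  refine (hα.2 D (fun _ => 1 / ((n + 1 : ℕ) : 𝕜)) x hx hx').trans (le_of_eq ?_)
  have h1 : ‖(WithLp.toLp p (fun _ => 1 / ((n + 1 : ℕ) : 𝕜)) : PiLp p fun _ : Fin (n + 1) => 𝕜)‖ =
      ((n + 1 : ℕ) : ℝ) ^ (1 / p).toReal * (1 / ((n + 1 : ℕ) : ℝ)) := by
    have := PiLp.norm_toLp_const' (p := p) (ι := Fin (n + 1)) (1 / ((n + 1 : ℕ) : 𝕜))
    rw [norm_div, norm_one, RCLike.norm_natCast] at this
    simpa [Function.const_def] using this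
  have h2 : ((n + 1 : ℕ) : ℝ) ^ (1 / p).toReal * ((n + 1 : ℕ) : ℝ) ^ (1 / q).toReal =
      ((n + 1 : ℕ) : ℝ) := by
    rw [← Real.rpow_add hn, toReal_one_div_add hp hq hpq, Real.rpow_one]
  rw [h1, eq_div_iff hnq.ne', mul_assoc, mul_right_comm, h2, mul_one_div_cancel hn.ne', mul_one]

theorem bddBelow_range_theta (ξ : Ordinal.{v}) (K : Set (WeakDual 𝕜 X)) :
    BddBelow (Set.range fun n : ℕ+ => theta ξ n K) :=
  ⟨0, by rintro _ ⟨n, rfl⟩; exact theta_nonneg ξ n K⟩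

theorem iInf_theta_le (ξ : Ordinal.{v}) (K : Set (WeakDual 𝕜 X)) (n : ℕ) :
    ⨅ n : ℕ+, theta ξ n K ≤ theta ξ (n + 1) K :=
  ciInf_le (bddBelow_range_theta ξ K) n.succPNat

/-- For fixed `m` the regrouping error is independent of `n`, so it disappears after division by
`n^{1/q}`. Thus the upper limit is a genuine limit. -/
theorem tendsto_alpha_div (hR : 0 < R) (hK : DualBdd R K) (ξ : Ordinal.{v}) {p q : ℝ≥0∞}
    (hp : 1 < p) (hq : 1 ≤ q) (hpq : 1 / p + 1 / q = 1) :
    Filter.Tendsto (fun n : ℕ => alpha ξ p n K / (n : ℝ) ^ (1 / q).toReal) Filter.atTop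
      (𝓝 (⨅ n : ℕ+, theta ξ n K)) := by
  refine (Filter.tendsto_add_atTop_iff_nat 1).1 (tendsto_order.2 ⟨fun c hc => ?_, fun c hc => ?_⟩)
  · exact .of_forall fun n => hc.trans_le
      ((iInf_theta_le ξ K n).trans (theta_le_alpha_div hR hK ξ hp hq hpq n))
  · obtain ⟨m, hm⟩ := exists_lt_of_ciInf_lt hc
    obtain ⟨m, rfl⟩ : ∃ k : ℕ, m = k.succPNat := ⟨m.natPred, (PNat.succPNat_natPred m).symm⟩
    have h1 : Filter.Tendsto (fun n : ℕ => ((n + 1 : ℕ) : ℝ) ^ (1 / q).toReal) Filter.atTop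
        Filter.atTop :=
      ((tendsto_rpow_atTop (toReal_one_div_pos hp hq hpq)).comp
        tendsto_natCast_atTop_atTop).comp (Filter.tendsto_add_atTop_nat 1)
    have h2 := (h1.const_div_atTop (2 * R * (m + 1))).const_add (theta ξ (m + 1) K)
    rw [add_zero] at h2
    filter_upwards [h2.eventually_lt_const (show theta ξ (m + 1) K < c from hm)] with n hn
    refine lt_of_le_of_lt ?_ hn
    have hnq : (0 : ℝ) < ((n + 1 : ℕ) : ℝ) ^ (1 / q).toReal := by positivity
    rw [div_le_iff₀ hnq, add_mul, div_mul_cancel₀ _ hnq.ne', mul_comm (theta _ _ _)]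
    exact alpha_le hR hK ξ hp hq hpq n m

/-! ### The Szlenk index -/

theorem szEps_le_iff {ε : ℝ} {η : Ordinal.{v}} :
    szEps K ε ≤ (η : WithTop Ordinal.{v}) ↔ szDerivIter ε K η = ∅ := by
  rw [szEps]
  split_ifs with h
  · rw [WithTop.coe_le_coe]
    constructor
    · intro hη
      have h1 : szDerivIter ε K (sInf {ξ : Ordinal.{v} | szDerivIter ε K ξ = ∅}) = ∅ := csInf_mem h
      exact Set.subset_eq_empty (szDerivIter_anti ε K hη) h1
    · exact fun h => csInf_le' h
  · simp only [top_le_iff, WithTop.coe_ne_top, false_iff]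
    exact fun h' => h ⟨η, h'⟩

theorem Sz_le_iff {η : Ordinal.{v}} :
    Sz K ≤ (η : WithTop Ordinal.{v}) ↔ ∀ ε : ℝ, 0 < ε → szDerivIter ε K η = ∅ := by
  rw [Sz, iSup₂_le_iff]
  exact forall₂_congr fun ε _ => szEps_le_iff

theorem iInf_theta_eq_zero_of_empty (ξ : Ordinal.{v}) :
    ⨅ n : ℕ+, theta ξ n (∅ : Set (WeakDual 𝕜 X)) = 0 := by
  refine le_antisymm (le_of_forall_pos_le_add fun c hc => ?_) (Real.iInf_nonneg fun n =>
    theta_nonneg ξ n _)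
  refine (iInf_theta_le ξ _ 0).trans (csInf_le (bddBelow_thetaSet ξ (0 + 1) _) ⟨by linarith, ?_⟩)
  intro D _ _ _ x _ _
  rw [treeInf]
  simp only [supportFun_empty]
  rw [Real.iInf_const_zero]
  linarith

/-- Compactness makes an empty stage `ω^(ξ+1)` empty already at some `ω^ξ n`, which the upper
estimate needs. The converse uses the lower estimate at `x = 0`. -/
theorem Sz_le_iff_iInf_theta (hR : 0 < R) (hKc : IsCompact K) (hK : DualBdd R K)
    (ξ : Ordinal.{v}) : Sz K ≤ ((ω ^ (ξ + 1) : Ordinal.{v}) : WithTop Ordinal.{v}) ↔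
      ⨅ n : ℕ+, theta ξ n K = 0 := by
  rw [Sz_le_iff]
  constructor
  · intro H
    rcases K.eq_empty_or_nonempty with rfl | hne
    · exact iInf_theta_eq_zero_of_empty ξ
    refine le_antisymm (le_of_forall_pos_le_add fun ε hε => ?_) (Real.iInf_nonneg fun n =>
      theta_nonneg ξ n K)
    obtain ⟨η, hη, h⟩ := exists_lt_szDerivIter_eq_empty hKc (isSuccLimit_opow_add_one ξ) (H ε hε)
    obtain ⟨n, hn⟩ := exists_nat_of_lt_opow_add_one hη
    have h1 := Set.subset_eq_empty (szDerivIter_anti ε K hn.le) h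
    -- The domination argument assumes `ε ≤ R`, so the norm bound is enlarged if necessary.
    have hK' : DualBdd (max R ε) K := fun f hf x => (hK f hf x).trans (by
      gcongr
      exact le_max_left _ _)
    rw [zero_add]
    refine le_of_forall_nat_le_add_div (c := n * max R ε) fun N => ?_
    exact (iInf_theta_le ξ K N).trans ((theta_le_opL hR.le hK ξ N).trans
      (opL_supportFun_le hε.le (le_max_right _ _) ξ hKc hK' hne h1 N))
  · intro H ε hε
    by_contra hne
    obtain ⟨f, hf⟩ := Set.nonempty_iff_ne_empty.2 hne
    have h1 : ε / 4 ≤ ⨅ n : ℕ+, theta ξ n K := by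
      refine le_ciInf fun m => ?_
      obtain ⟨n, rfl⟩ : ∃ k : ℕ, m = k.succPNat := ⟨m.natPred, (PNat.succPNat_natPred m).symm⟩
      have hb : (0 : ℝ) ≤ 1 / ((n : ℝ) + 1) := by positivity
      have h2 := le_opL_of_le_step hR.le (stepOp_op 𝕜 hR.le ξ) hb (ω ^ ξ)
        (fun L hL f hf x => le_op_supportFun hR.le ξ hL hf hb x) (n + 1) hK
        (szDerivIter_anti ε K (opow_mul_natCast_le ξ (n + 1)) hf) 0
      have h3 := opL_replicate_le_theta hR.le hK ξ n hb
      rw [one_div_mul_cancel (by positivity), one_mul] at h3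
      have h4 : ((n + 1 : ℕ) : ℝ) * (1 / ((n : ℝ) + 1) * (ε / 4)) = ε / 4 := by
        push_cast
        field_simp
      rw [map_zero, map_zero, zero_add, h4] at h2
      exact h2.trans h3
    linarith

end Quantities

end SzlenkSum

end

theorem mainTheorem3 {𝕜 : Type w} [RCLike 𝕜] {X : Type u} [NormedAddCommGroup X]
    [NormedSpace 𝕜 X] [CompleteSpace X] (K : Set (WeakDual 𝕜 X)) (hK : IsCompact K)
    (ξ : Ordinal.{v}) (p q : ℝ≥0∞) (hp : 1 < p) (hq : 1 ≤ q) (hpq : 1 / p + 1 / q = 1) :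
    (⨅ n : ℕ+, SzlenkSum.theta ξ n K) =
        Filter.limsup (fun n : ℕ => SzlenkSum.alpha ξ p n K / (n : ℝ) ^ (1 / q).toReal)
          Filter.atTop ∧
      (SzlenkSum.Sz K ≤ ((ω ^ (ξ + 1) : Ordinal.{v}) : WithTop Ordinal.{v}) ↔
        (⨅ n : ℕ+, SzlenkSum.theta ξ n K) = 0) ∧
      ((⨅ n : ℕ+, SzlenkSum.theta ξ n K) = 0 ↔
        Filter.limsup (fun n : ℕ => SzlenkSum.alpha ξ p n K / (n : ℝ) ^ (1 / q).toReal)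
          Filter.atTop = 0) := by
  obtain ⟨R, hR, hKR⟩ := SzlenkSum.exists_dualBdd hK
  -- A strictly positive norm bound is needed for the members of `alphaSet` to be positive.
  have hR' : 0 < R + 1 := by linarith
  have hKR' : SzlenkSum.DualBdd (R + 1) K := fun f hf x => (hKR f hf x).trans (by
    gcongr
    linarith)
  have h := (SzlenkSum.tendsto_alpha_div hR' hKR' ξ hp hq hpq).limsup_eq
  exact ⟨h.symm, SzlenkSum.Sz_le_iff_iInf_theta hR' hK hKR' ξ, by rw [h]⟩
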